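/- **Setting.** Let $p,b\in[0,1]$ with $p+b\neq1$, $\alpha_1,\alpha_2\in(0,1)$, $B_{\alpha_1},B_{\alpha_2}>0$, $U(1),U(2)\in\mathbb R$, $\rho\in\mathbb C$, $T>0$. For $g$ continuous on $[0,T]$ let $$\mathfrak D_t^{1-\alpha_j}g(t)=\Big(\tfrac{d}{dt}+\rho U(j)\Big)\frac1{\Gamma(\alpha_j)}\int_0^t\frac{e^{-(t-\tau)\rho U(j)}}{(t-\tau)^{1-\alpha_j}}g(\tau)\,d\tau .$$ Let $G_1,G_2:[0,T]\to\mathbb C$ be continuous with $G_j(0)=G_{j,0}$, such that $G_j$ and the integrals above are differentiable on $(0,T]$ and, for $t\in(0,T]$, $$p(\partial_t+\rho U(1))G_1+(1-b)(\partial_t+\rho U(2))G_2=(p-1)B_{\alpha_1}^{-1}\mathfrak D_t^{1-\alpha_1}G_1+(1-b)B_{\alpha_2}^{-1}\mathfrak D_t^{1-\alpha_2}G_2,$$ $$(1-p)(\partial_t+\rho U(1))G_1+b(\partial_t+\rho U(2))G_2=(1-p)B_{\alpha_1}^{-1}\mathfrak D_t^{1-\alpha_1}G_1+(b-1)B_{\alpha_2}^{-1}\mathfrak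 D_t^{1-\alpha_2}G_2 .$$ Put $m_1=\frac{1-p}{1-p-b}$, $m_2=\frac{1-b}{1-p-b}$, $C_j=m_jB_{\alpha_j}^{-1}$, $s_j=z+\rho U(j)$, and, with principal powers, $H(z)=\{(s_1^{\alpha_1}-C_1)(s_2^{\alpha_2}-C_2)-C_1C_2\}^{-1}$. For $j\in\{1,2\}$ let $j^*$ be the other index and $$\widehat G_j(z)=H(z)\,(s_{j^*}^{\alpha_{j^*}}-C_{j^*})\,s_j^{\alpha_j-1}G_{j,0}-C_{j^*}H(z)\,s_j^{\alpha_j-1}G_{j^*,0}.$$ For a contour $z(\phi)$, a step $h>0$ and $N\ge1$ the contour integral method (CIM) is $$G_{j,N}(t)=h\sum_{k=1-N}^{N-1}v_j(t,kh),\qquad v_j(t,\phi)=\frac1{2\pi i}e^{z(\phi)t}\,\widehat G_j(z(\phi))\,z'(\phi);$$ write $G^{\langle1\rangle}_{j,N}$ for the parabola $z(\phi)=\eta_1(i\phi+1)^2$ with step $h_1$, and $G^{\langle2\rangle}_{j,N}$ for the hyperbola $z(\phi)=\eta_2(1+\sin(i\phi-\alpha))$ with step $h_2$ ($\eta_1,\eta_2>0$).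 Let $$R=\max\Big\{2|\rho U(1)|,\ 2|\rho U(2)|,\ (4|C_1|)^{1/\alpha_1},\ (4|C_2|)^{1/\alpha_2},\ (32|C_1C_2|)^{1/(\alpha_1+\alpha_2)}\Big\},\qquad L(x)=1+|\ln(1-e^{-x})| .$$ **Theorem.** Let $j\in\{1,2\}$. (1) *Parabola.* Let $0<a<1$, $0<t\le T$, $0<h_1<\pi/(\eta_1t)$, $N\ge1$, and assume $|z(\phi)|>R$ for all $\phi$ with $-\big(\frac{\pi}{\eta_1th_1}-1\big)<\operatorname{Im}\phi<a$. With $B=\max\{16(1-a)^{-1},\,64|C_{j^*}|(1-a)^{-(1+2\alpha_{j^*})}\}$, $$|G_j(t)-G^{\langle1\rangle}_{j,N}(t)|\le B\sqrt{\tfrac{\eta_1}{\pi}}\,t^{-1/2}\Big(\eta_1^{-1}|G_{j,0}|+\eta_1^{-(1+\alpha_{j^*})}|G_{j^*,0}|\Big)\left(\frac{e^{\eta_1t}}{e^{2\pi a/h_1}-1}+\frac{e^{\pi^2/(\eta_1th_1^2)}}{e^{2\pi^2/(\eta_1th_1^2)-2\pi/h_1}-1}+\frac{e^{\eta_1t}}{e^{\eta_1t(Nh_1)^2}}\right).$$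 (2) *Hyperbola.* Let $\alpha,\delta>0$, $\alpha<\pi/2-\delta$, $0<y<\min\{\alpha,\pi/2-\alpha-\delta\}$, $0<t\le T$, $h_2>0$, $N\ge1$, and assume $|z(\phi)|>R$ for all $\phi$ with $-\alpha<\operatorname{Im}\phi<\pi/2-\alpha-\delta$. With $$K(s)=\sqrt{\tfrac{1+s}{1-s}}\Big(|G_{j,0}|+\frac{4|C_{j^*}|}{\eta_2^{\alpha_{j^*}}(1-s)^{\alpha_{j^*}}}|G_{j^*,0}|\Big)\quad\text{and}\quad \gamma=\eta_2t\sin\alpha,$$ $$|G_j(t)-G^{\langle2\rangle}_{j,N}(t)|\le\frac{16}{\pi}e^{\eta_2t}\left(K(\cos\delta)\frac{L(\gamma)}{e^{2\pi(\pi/2-\alpha-\delta)/h_2}-1}+K(\sin(\alpha+y))\Big(\frac{L(\gamma)}{e^{2\pi\alpha/h_2}-1}+\frac{1+L(\gamma)}{e^{\gamma\cosh(Nh_2)}}\Big)\right).$$ (3) *Spectral accuracy.* Let $0<t_0\le t_1\le T$, and let $h=l/N$, $\eta=\kappa N$ with $\kappa,l>0$ fixed. For the parabola with $0<a<1$, if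 $l>1$ and $\kappa t_1l<\pi$, there is $K_0$ such that for all large $N$ and all $t\in[t_0,t_1]$, $|G_j(t)-G^{\langle1\rangle}_{j,N}(t)|\le K_0e^{-cN}$ with $c=\min\{\frac{2\pi a}{l}-\kappa t_1,\ \frac{\pi^2}{\kappa t_1l^2}-\frac{2\pi}{l},\ \kappa t_0(l^2-1)\}$. For the hyperbola with $\alpha,\delta>0$, $\alpha<\pi/2-\delta$, if $\sin\alpha\cosh l>1$, there is $K_0$ such that for all large $N$ and all $t\in[t_0,t_1]$, $|G_j(t)-G^{\langle2\rangle}_{j,N}(t)|\le K_0e^{-cN}$ with $c=\min\{\frac{2\pi(\pi/2-\alpha-\delta)}{l}-\kappa t_1,\ \frac{2\pi\alpha}{l}-\kappa t_1,\ \kappa t_0(\sin\alpha\cosh l-1)\}$. In both cases there are admissible $\kappa,l$ with $c>0$. -/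

import Mathlib

open Real Set Filter

noncomputable section

/-- The data of the Feynman-Kac system with two internal states (indexed by `0, 1 : Fin 2`):
transition matrix `[[p, 1 - p], [1 - b, b]]`, exponents `α j`, positive constants `B j`
(they enter the system through their inverses), potential `U j`, and frequency `ρ`. -/
structure FeynmanKac where
  p : ℝ
  b : ℝ
  α : Fin 2 → ℝ
  B : Fin 2 → ℝ
  U : Fin 2 → ℝ
  ρ : ℂ
  p_mem : p ∈ Icc (0 : ℝ) 1
  b_mem : b ∈ Icc (0 : ℝ) 1
  p_add_b_ne : p + b ≠ 1
  α_mem : ∀ j, α j ∈ Ioo (0 : ℝ) 1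
  B_pos : ∀ j, 0 < B j

namespace FeynmanKac

/-- The weakly singular integral
`(1 / Γ(α_j)) ∫₀ᵗ exp(-(t - τ) ρ U(j)) (t - τ)^(α_j - 1) g(τ) dτ`. -/
def fracInt (M : FeynmanKac) (j : Fin 2) (g : ℝ → ℂ) (t : ℝ) : ℂ :=
  (1 / (Real.Gamma (M.α j) : ℂ)) *
    ∫ τ in (0 : ℝ)..t,
      Complex.exp (-((t - τ : ℝ) : ℂ) * (M.ρ * M.U j)) * (((t - τ) ^ (M.α j - 1) : ℝ) : ℂ) * g τ

/-- The operator `∂/∂t + ρ U(j)`; time derivatives are taken within `[0, T]`. -/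
def transport (M : FeynmanKac) (T : ℝ) (j : Fin 2) (g : ℝ → ℂ) (t : ℝ) : ℂ :=
  derivWithin g (Icc 0 T) t + M.ρ * M.U j * g t

/-- The fractional substantial derivative of order `1 - α_j`. -/
def substDeriv (M : FeynmanKac) (T : ℝ) (j : Fin 2) (g : ℝ → ℂ) (t : ℝ) : ℂ :=
  M.transport T j (M.fracInt j g) t

/-- `G = (G 0, G 1)` solves the Feynman-Kac system on `(0, T]` with initial value `G₀`. -/
structure IsSolution (M : FeynmanKac) (T : ℝ) (G₀ : Fin 2 → ℂ) (G : Fin 2 → ℝ → ℂ) : Prop where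
  continuousOn : ∀ j, ContinuousOn (G j) (Icc 0 T)
  initial : ∀ j, G j 0 = G₀ j
  differentiable : ∀ j, ∀ t ∈ Ioc 0 T, DifferentiableWithinAt ℝ (G j) (Icc 0 T) t
  differentiable_fracInt : ∀ j, ∀ t ∈ Ioc 0 T,
    DifferentiableWithinAt ℝ (M.fracInt j (G j)) (Icc 0 T) t
  equation₁ : ∀ t ∈ Ioc 0 T,
    (M.p : ℂ) * M.transport T 0 (G 0) t + (1 - M.b : ℂ) * M.transport T 1 (G 1) t =
      (M.p - 1 : ℂ) * (M.B 0 : ℂ)⁻¹ * M.substDeriv T 0 (G 0) t +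
        (1 - M.b : ℂ) * (M.B 1 : ℂ)⁻¹ * M.substDeriv T 1 (G 1) t
  equation₂ : ∀ t ∈ Ioc 0 T,
    (1 - M.p : ℂ) * M.transport T 0 (G 0) t + (M.b : ℂ) * M.transport T 1 (G 1) t =
      (1 - M.p : ℂ) * (M.B 0 : ℂ)⁻¹ * M.substDeriv T 0 (G 0) t +
        (M.b - 1 : ℂ) * (M.B 1 : ℂ)⁻¹ * M.substDeriv T 1 (G 1) t

/-- `m_1 = (1 - p) / (1 - p - b)` and `m_2 = (1 - b) / (1 - p - b)`. -/
def m (M : FeynmanKac) : Fin 2 → ℝ :=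
  ![(1 - M.p) / (1 - M.p - M.b), (1 - M.b) / (1 - M.p - M.b)]

/-- `C_j = m_j B_{α_j}⁻¹`. -/
def C (M : FeynmanKac) (j : Fin 2) : ℝ := M.m j * (M.B j)⁻¹

/-- `(z + ρ U(j))^(α_j) - C_j`, with the principal branch of the power. -/
def symb (M : FeynmanKac) (j : Fin 2) (z : ℂ) : ℂ :=
  (z + M.ρ * M.U j) ^ (M.α j : ℂ) - (M.C j : ℂ)

/-- The function `H(z)`. -/
def H (M : FeynmanKac) (z : ℂ) : ℂ :=
  (M.symb 0 z * M.symb 1 z - (M.C 0 : ℂ) * (M.C 1 : ℂ))⁻¹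

/-- The solution in Laplace space; the index of the other state is `1 - j`. -/
def Ghat (M : FeynmanKac) (G₀ : Fin 2 → ℂ) (j : Fin 2) (z : ℂ) : ℂ :=
  M.H z * M.symb (1 - j) z * (z + M.ρ * M.U j) ^ ((M.α j - 1 : ℝ) : ℂ) * G₀ j -
    (M.C (1 - j) : ℂ) * M.H z * (z + M.ρ * M.U j) ^ ((M.α j - 1 : ℝ) : ℂ) * G₀ (1 - j)

/-- The integrand `v_j(t, φ)` for the contour `φ ↦ z φ`. -/
def integrand (M : FeynmanKac) (G₀ : Fin 2 → ℂ) (j : Fin 2) (z : ℂ → ℂ) (t : ℝ) (φ : ℂ) : ℂ :=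
  1 / (2 * π * Complex.I) * Complex.exp (z φ * t) * M.Ghat G₀ j (z φ) * deriv z φ

/-- The contour integral method: truncated trapezoidal rule with step `h` and nodes `k h`,
`1 - N ≤ k ≤ N - 1`. -/
def cim (M : FeynmanKac) (G₀ : Fin 2 → ℂ) (j : Fin 2) (z : ℂ → ℂ) (h : ℝ) (N : ℕ) (t : ℝ) : ℂ :=
  h * ∑ k ∈ Finset.Icc (1 - (N : ℤ)) ((N : ℤ) - 1),
    M.integrand G₀ j z t (((k : ℝ) * h : ℝ) : ℂ)

/-- The radius outside of which the resolvent-type estimates for `Ghat` are available. -/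
def radius (M : FeynmanKac) : ℝ :=
  max (max (max (2 * ‖M.ρ * M.U 0‖) ((4 * |M.C 0|) ^ (1 / M.α 0)))
      (max (2 * ‖M.ρ * M.U 1‖) ((4 * |M.C 1|) ^ (1 / M.α 1))))
    ((32 * |M.C 0 * M.C 1|) ^ (1 / (M.α 0 + M.α 1)))

end FeynmanKac

/-- The parabolic contour `z(φ) = η (iφ + 1)²`. -/
def parabola (η : ℝ) (φ : ℂ) : ℂ := η * (Complex.I * φ + 1) ^ 2

/-- The hyperbolic contour `z(φ) = η (1 + sin(iφ - α))`. -/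
def hyperbola (η α : ℝ) (φ : ℂ) : ℂ := η * (1 + Complex.sin (Complex.I * φ - α))

/-- The open horizontal strip `-d < Im φ < c`. -/
def strip (d c : ℝ) : Set ℂ := {φ | -d < φ.im ∧ φ.im < c}

/-- `L(x) = 1 + |ln(1 - e^{-x})|`. -/
def Lfun (x : ℝ) : ℝ := 1 + |Real.log (1 - Real.exp (-x))|

/-- The constant
`√((1 + s) / (1 - s)) (|G_{j,0}| + 4 |C_{j*}| / (η^{α_{j*}} (1 - s)^{α_{j*}}) |G_{j*,0}|)`
of the hyperbolic contour, at `s = sin (α + y)`; here `j* = 1 - j` is the other state. -/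
def hypConst (M : FeynmanKac) (G₀ : Fin 2 → ℂ) (j : Fin 2) (η s : ℝ) : ℝ :=
  √((1 + s) / (1 - s)) *
    (‖G₀ j‖ + 4 * |M.C (1 - j)| / (η ^ M.α (1 - j) * (1 - s) ^ M.α (1 - j)) * ‖G₀ (1 - j)‖)

end

/-! The solution is an inverse Laplace integral of `Ghat` along the contour, and the method is the
trapezoidal rule for that integral. So there are two halves: the representation and the quadrature
error.

Representation. Since `Ghat` is only known to decay like `1 / ‖z‖`, its integral along a vertical
line is not absolutely convergent, and nothing is known of the solution beyond `[0, T]`. Integrating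
in time removes both obstacles. Elimination in the 2×2 system and two integrations give a Volterra
system for the primitives of the solution (`IsSolution.volterra`). The vertical inverse transform of
`Ghat / z`, which decays quadratically, solves the same system (`primCand_volterra`), and the
solution is unique (`volterra_unique`). The vertical line is then deformed into the contour inside
`region`, the exterior of a parabola, where `Ghat` is holomorphic and has primitives
(`integral_contour_eq`). On the contour one may differentiate in time, which removes the factor `1 /
z` (`IsSolution.eq_integral_contour`).

Quadrature. By Poisson summation the error of the infinite rule is the sum of the Fourier integrals
of the integrand at the frequencies `2 π n / h`, `n ≠ 0`; the omitted nodes add the truncation error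
(`trapezoid_error`, `IsSolution.norm_sub_cim_le`). Shifting the line of integration by `c` in the
favourable direction gains `exp (-2 π n c / h)`.

For the parabola every shifted line carries a Gaussian majorant, and the downward shift is chosen
optimally. For the hyperbola the upward shift works likewise, but the downward shift by the full `α`
reaches a vertical line on which the majorant no longer decays. There the integral is written with a
primitive, and its endpoints are joined by a path on which the weight `exp (ω β - l sin β cosh x)`
stays under control (`exists_descent`); the logarithmic length of the path is what `L` pays for.
Spectral accuracy follows by inserting `h = l / N`, `η = κ N`. -/

/-! ### The trapezoidal rule on the line: Poisson summation and truncation. -/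

open MeasureTheory Asymptotics in
open scoped FourierTransform in
/-- Error of the infinite trapezoidal rule in terms of the oscillatory integrals of `f`. -/
theorem trapezoid_error_aux {f : ℝ → ℂ} (hc : Continuous f) {D : ℝ}
    (hf : ∀ x, ‖f x‖ ≤ D * (1 + x ^ 2)⁻¹) {h : ℝ} (hh : 0 < h) {A B r s : ℝ}
    (hr0 : 0 ≤ r) (hr1 : r < 1) (hs0 : 0 ≤ s) (hs1 : s < 1)
    (hA : ∀ n : ℕ, 1 ≤ n →
      ‖∫ x : ℝ, f x * Complex.exp (((2 * π * n / h : ℝ) : ℂ) * x * Complex.I)‖ ≤ A * r ^ n)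
    (hB : ∀ n : ℕ, 1 ≤ n →
      ‖∫ x : ℝ, f x * Complex.exp (-(((2 * π * n / h : ℝ) : ℂ) * x * Complex.I))‖ ≤ B * s ^ n) :
    Summable (fun k : ℤ => f (k * h)) ∧
      ‖(∫ x : ℝ, f x) - h * ∑' k : ℤ, f (k * h)‖ ≤ A * (r / (1 - r)) + B * (s / (1 - s)) := by
  set g : ℝ → ℂ := fun x => f (x * h) with hg
  have hgc : Continuous g := by fun_prop
  have hD : 0 ≤ D := by
    have := (norm_nonneg _).trans (hf 0)
    simpa using this
  have hgO : g =O[cocompact ℝ] fun x : ℝ => |x| ^ (-(2:ℝ)) := by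
    refine IsBigO.of_bound (D * (h ^ 2)⁻¹) ?_
    have : ∀ᶠ x : ℝ in cocompact ℝ, x ≠ 0 := by
      have := (isCompact_singleton (x := (0:ℝ))).compl_mem_cocompact
      filter_upwards [this] with x hx
      simpa using hx
    filter_upwards [this] with x hx
    refine (hf (x * h)).trans ?_
    have h2 : (|x| ^ (-(2:ℝ))) = (x ^ 2)⁻¹ := by
      rw [Real.rpow_neg (abs_nonneg _)]
      norm_num
    rw [h2, Real.norm_of_nonneg (by positivity), mul_assoc, ← mul_inv]
    gcongr
    nlinarith
  have hF : ∀ n : ℤ, 𝓕 g n = (1 / h : ℂ) *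
      ∫ x : ℝ, f x * Complex.exp (-(((2 * π * n / h : ℝ) : ℂ) * x * Complex.I)) := by
    intro n
    rw [Real.fourier_eq']
    have := MeasureTheory.Measure.integral_comp_mul_right
      (fun x : ℝ => f x * Complex.exp (-(((2 * π * n / h : ℝ) : ℂ) * x * Complex.I))) h
    rw [abs_of_pos (inv_pos.mpr hh)] at this
    rw [one_div, ← Complex.ofReal_inv, ← Complex.real_smul, ← this]
    congr 1
    ext x
    simp only [hg, smul_eq_mul]
    rw [mul_comm]
    congr 2
    have : (h : ℂ) ≠ 0 := by exact_mod_cast hh.ne'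
    push_cast
    simp only [RCLike.inner_apply, conj_trivial]
    field_simp
    push_cast
    ring
  have hneg : ∀ n : ℕ, 1 ≤ n → ‖𝓕 g (n : ℤ)‖ ≤ (1 / h) * (B * s ^ n) := by
    intro n hn
    rw [hF, norm_mul]
    have := hB n hn
    gcongr
    · simp [abs_of_pos hh]
    · simpa using this
  have hpos : ∀ n : ℕ, 1 ≤ n → ‖𝓕 g (-(n : ℤ) : ℤ)‖ ≤ (1 / h) * (A * r ^ n) := by
    intro n hn
    rw [hF, norm_mul]
    have := hA n hn
    gcongr
    · simp [abs_of_pos hh]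
    · refine le_trans (le_of_eq ?_) this
      congr 2
      ext x
      congr 2
      push_cast
      ring
  have sB : Summable fun n : ℕ => (1 / h) * (B * s ^ (n + 1)) :=
    (((summable_nat_add_iff 1).mpr (summable_geometric_of_lt_one hs0 hs1)).mul_left _).mul_left _
  have sA : Summable fun n : ℕ => (1 / h) * (A * r ^ (n + 1)) :=
    (((summable_nat_add_iff 1).mpr (summable_geometric_of_lt_one hr0 hr1)).mul_left _).mul_left _
  have s1 : Summable fun n : ℕ => 𝓕 g ((n + 1 : ℕ) : ℤ) :=
    Summable.of_norm_bounded sB fun n => hneg (n + 1) (by omega)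
  have s2 : Summable fun n : ℕ => 𝓕 g ((-((n + 1 : ℕ) : ℤ) : ℤ)) :=
    Summable.of_norm_bounded sA fun n => hpos (n + 1) (by omega)
  have s1' : Summable fun n : ℕ => 𝓕 g ((n : ℤ)) := (summable_nat_add_iff 1).mp s1
  have s2' : Summable fun n : ℕ => 𝓕 g ((-((n : ℤ) + 1) : ℤ)) := by
    refine s2.congr fun n => ?_
    push_cast; ring_nf
  have hsum : Summable fun n : ℤ => 𝓕 g n :=
    Summable.of_nat_of_neg_add_one (f := fun n : ℤ => 𝓕 g n) s1' s2'
  -- Poisson summation: the term `n = 0` is the integral divided by `h`, and all other terms are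
  -- error.
  have hP := Real.tsum_eq_tsum_fourier_of_rpow_decay_of_summable hgc one_lt_two hgO hsum 0
  have hsf : Summable (fun k : ℤ => f (k * h)) := by
    refine summable_of_isBigO (Real.summable_abs_int_rpow one_lt_two)
      (hgO.comp_tendsto Int.tendsto_coe_cofinite)
  refine ⟨hsf, ?_⟩
  have hP' : ∑' k : ℤ, f (k * h) = ∑' n : ℤ, 𝓕 g n := by
    simpa [hg] using hP
  rw [hP', tsum_of_nat_of_neg_add_one (f := fun n : ℤ => 𝓕 g n) s1' s2', s1'.tsum_eq_zero_add]
  have h0 : 𝓕 g ((0 : ℕ) : ℤ) = (1 / h : ℂ) * ∫ x : ℝ, f x := by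
    have := hF 0
    simpa using this
  have hne : (h : ℂ) ≠ 0 := by exact_mod_cast hh.ne'
  have e : (∫ x : ℝ, f x) - h * (𝓕 g ((0 : ℕ) : ℤ) + ∑' n : ℕ, 𝓕 g ((n + 1 : ℕ) : ℤ) +
      ∑' n : ℕ, 𝓕 g ((-((n : ℤ) + 1) : ℤ))) = - (h * ∑' n : ℕ, 𝓕 g ((-((n : ℤ) + 1) : ℤ)) +
        h * ∑' n : ℕ, 𝓕 g ((n + 1 : ℕ) : ℤ)) := by
    rw [h0]; field_simp; ring
  rw [e, norm_neg]
  have geo : ∀ {q : ℝ}, 0 ≤ q → q < 1 → ∑' n : ℕ, q ^ (n + 1) = q / (1 - q) := by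
    intro q h0 h1
    simp_rw [pow_succ']
    rw [tsum_mul_left, tsum_geometric_of_lt_one h0 h1, div_eq_mul_inv]
  refine (norm_add_le _ _).trans (add_le_add ?_ ?_)
  · rw [norm_mul, Complex.norm_real, Real.norm_of_nonneg hh.le]
    have : ‖∑' n : ℕ, 𝓕 g ((-((n : ℤ) + 1) : ℤ))‖ ≤ ∑' n : ℕ, (1 / h) * (A * r ^ (n + 1)) := by
      refine tsum_of_norm_bounded sA.hasSum fun n => ?_
      simpa using hpos (n + 1) (by omega)
    rw [tsum_mul_left, tsum_mul_left, geo hr0 hr1] at this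
    calc _ ≤ h * (1 / h * (A * (r / (1 - r)))) := by gcongr
      _ = _ := by field_simp
  · rw [norm_mul, Complex.norm_real, Real.norm_of_nonneg hh.le]
    have : ‖∑' n : ℕ, 𝓕 g ((n + 1 : ℕ) : ℤ)‖ ≤ ∑' n : ℕ, (1 / h) * (B * s ^ (n + 1)) := by
      refine tsum_of_norm_bounded sB.hasSum fun n => hneg (n + 1) (by omega)
    rw [tsum_mul_left, tsum_mul_left, geo hs0 hs1] at this
    calc _ ≤ h * (1 / h * (B * (s / (1 - s)))) := by gcongr
      _ = _ := by field_simp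

theorem sum_Icc_neg_eq (F : ℤ → ℂ) (n : ℕ) :
    ∑ k ∈ Finset.Icc (-(n : ℤ)) n, F k =
      ∑ k ∈ Finset.range (n + 1), F k + ∑ k ∈ Finset.range n, F (-((k : ℤ) + 1)) := by
  induction n with
  | zero => simp
  | succ n ih =>
    have : Finset.Icc (-((n + 1 : ℕ) : ℤ)) ((n + 1 : ℕ) : ℤ) =
        insert ((n : ℤ) + 1) (insert (-((n : ℤ) + 1)) (Finset.Icc (-(n : ℤ)) n)) := by
      ext k; simp only [Finset.mem_Icc, Finset.mem_insert]; omega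
    rw [this, Finset.sum_insert, Finset.sum_insert, ih, Finset.sum_range_succ _ (n + 1),
      Finset.sum_range_succ (fun k : ℕ => F (-((k : ℤ) + 1))) n]
    · push_cast
      ring
    · simp
    · simp only [Finset.mem_Icc, Finset.mem_insert]; omega

/-- Truncation error of a bilateral series. -/
theorem norm_tsum_sub_sum_Icc_le {F : ℤ → ℂ} (hF : Summable F) {N : ℕ} (hN : 1 ≤ N) {b : ℕ → ℝ}
    (hb : Summable b) (h1 : ∀ m : ℕ, ‖F ((N + m : ℕ) : ℤ)‖ ≤ b m)
    (h2 : ∀ m : ℕ, ‖F (-((N + m : ℕ) : ℤ))‖ ≤ b m) :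
    ‖∑' k, F k - ∑ k ∈ Finset.Icc (1 - (N : ℤ)) ((N : ℤ) - 1), F k‖ ≤ 2 * ∑' m, b m := by
  obtain ⟨n, rfl⟩ : ∃ n, N = n + 1 := ⟨N - 1, by omega⟩
  have e : Finset.Icc (1 - ((n + 1 : ℕ) : ℤ)) (((n + 1 : ℕ) : ℤ) - 1) =
      Finset.Icc (-(n : ℤ)) n := by
    push_cast; congr 1 <;> ring
  have s1 : Summable fun k : ℕ => F k := hF.comp_injective Nat.cast_injective
  have s2 : Summable fun k : ℕ => F (-((k : ℤ) + 1)) :=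
    hF.comp_injective fun a b hab => by simpa using hab
  rw [e, sum_Icc_neg_eq, tsum_of_nat_of_neg_add_one s1 s2, ← s1.sum_add_tsum_nat_add (n + 1),
    ← s2.sum_add_tsum_nat_add n]
  have : ∀ a b c d : ℂ, a + b + (c + d) - (a + c) = b + d := by intros; ring
  rw [this, two_mul]
  refine (norm_add_le _ _).trans (add_le_add ?_ ?_)
  · refine tsum_of_norm_bounded hb.hasSum fun m => ?_
    have := h1 m
    rwa [add_comm] at this
  · refine tsum_of_norm_bounded hb.hasSum fun m => ?_
    have e : -(((m + n : ℕ) : ℤ) + 1) = -((n + 1 + m : ℕ) : ℤ) := by push_cast; ring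
    rw [e]
    exact h2 m

/-- Error of the truncated trapezoidal rule. -/
theorem trapezoid_error {f : ℝ → ℂ} (hc : Continuous f) {D : ℝ}
    (hf : ∀ x, ‖f x‖ ≤ D * (1 + x ^ 2)⁻¹) {h : ℝ} (hh : 0 < h) {A B r s : ℝ}
    (hr0 : 0 ≤ r) (hr1 : r < 1) (hs0 : 0 ≤ s) (hs1 : s < 1)
    (hA : ∀ n : ℕ, 1 ≤ n →
      ‖∫ x : ℝ, f x * Complex.exp (((2 * π * n / h : ℝ) : ℂ) * x * Complex.I)‖ ≤ A * r ^ n)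
    (hB : ∀ n : ℕ, 1 ≤ n →
      ‖∫ x : ℝ, f x * Complex.exp (-(((2 * π * n / h : ℝ) : ℂ) * x * Complex.I))‖ ≤ B * s ^ n)
    {N : ℕ} (hN : 1 ≤ N) {b : ℕ → ℝ} (hb : Summable b)
    (h1 : ∀ m : ℕ, ‖f (((N + m : ℕ) : ℝ) * h)‖ ≤ b m)
    (h2 : ∀ m : ℕ, ‖f (-(((N + m : ℕ) : ℝ) * h))‖ ≤ b m) :
    ‖(∫ x : ℝ, f x) - h * ∑ k ∈ Finset.Icc (1 - (N : ℤ)) ((N : ℤ) - 1), f (k * h)‖ ≤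
      A * (r / (1 - r)) + B * (s / (1 - s)) + 2 * h * ∑' m, b m := by
  obtain ⟨hs, herr⟩ := trapezoid_error_aux hc hf hh hr0 hr1 hs0 hs1 hA hB
  have htr := norm_tsum_sub_sum_Icc_le hs hN hb (by simpa using h1)
    (fun m => by rw [Int.cast_neg, Int.cast_natCast, neg_mul]; exact h2 m)
  have e : (∫ x : ℝ, f x) - h * ∑ k ∈ Finset.Icc (1 - (N : ℤ)) ((N : ℤ) - 1), f (k * h) =
      ((∫ x : ℝ, f x) - h * ∑' k : ℤ, f (k * h)) + h * (∑' k : ℤ, f (k * h) -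
        ∑ k ∈ Finset.Icc (1 - (N : ℤ)) ((N : ℤ) - 1), f (k * h)) := by ring
  rw [e]
  refine (norm_add_le _ _).trans (add_le_add herr ?_)
  rw [norm_mul, Complex.norm_real, Real.norm_of_nonneg hh.le]
  calc _ ≤ h * (2 * ∑' m, b m) := by gcongr
    _ = _ := by ring

/-! ### Shifting a horizontal line of integration. -/

open MeasureTheory in
/-- Shift of a horizontal line of integration for a holomorphic function on a strip. -/
theorem integral_shift_im {f : ℂ → ℂ} {c : ℝ}
    (hf : DifferentiableOn ℂ f {z | z.im ∈ uIcc 0 c}) {b : ℝ → ℝ} (hb : Tendsto b atTop (nhds 0))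
    (hfb : ∀ x y : ℝ, y ∈ uIcc 0 c → ‖f (x + y * Complex.I)‖ ≤ b |x|)
    (h0 : Integrable fun x : ℝ => f x) (h1 : Integrable fun x : ℝ => f (x + c * Complex.I)) :
    ∫ x : ℝ, f x = ∫ x : ℝ, f (x + c * Complex.I) := by
  have t0 := intervalIntegral_tendsto_integral h0 tendsto_neg_atTop_atBot tendsto_id
  have t1 := intervalIntegral_tendsto_integral h1 tendsto_neg_atTop_atBot tendsto_id
  -- Cauchy's theorem on the rectangle over `[-X, X]`; each vertical side is at most `b |X|` times
  -- its length.
  have key : ∀ X : ℝ, ‖(∫ x in -X..X, f x) - ∫ x in -X..X, f (x + c * Complex.I)‖ ≤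
      2 * (b |X| * |c|) := by
    intro X
    have hrect := Complex.integral_boundary_rect_eq_zero_of_differentiableOn f (-X : ℝ)
      (X + c * Complex.I) (hf.mono fun z hz => by
        have := hz.2
        simpa using this)
    simp only [Complex.ofReal_im, Complex.add_im, Complex.mul_im, Complex.ofReal_re,
      Complex.I_im, mul_one, Complex.I_re, mul_zero, add_zero, zero_add, Complex.add_re,
      Complex.mul_re, sub_zero, Complex.ofReal_zero, zero_mul, smul_eq_mul] at hrect
    have e : (∫ x in -X..X, f x) - ∫ x in -X..X, f (x + c * Complex.I) =
        Complex.I * (∫ y in (0:ℝ)..c, f ((-X : ℝ) + y * Complex.I)) -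
        Complex.I * (∫ y in (0:ℝ)..c, f ((X : ℝ) + y * Complex.I)) := by
      linear_combination hrect
    have bd : ∀ Y : ℝ, ‖∫ y in (0:ℝ)..c, f ((Y : ℝ) + y * Complex.I)‖ ≤ b |Y| * |c| := by
      intro Y
      have := intervalIntegral.norm_integral_le_of_norm_le_const (a := 0) (b := c)
        (f := fun y : ℝ => f ((Y : ℝ) + y * Complex.I)) (C := b |Y|)
        fun y hy => hfb Y y (uIoc_subset_uIcc hy)
      simpa using this
    rw [e]
    refine (norm_sub_le _ _).trans ?_
    simp only [norm_mul, Complex.norm_I, one_mul]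
    have h1 := bd X
    have h2 := bd (-X)
    rw [abs_neg] at h2
    linarith
  have lim : Tendsto (fun X : ℝ => (∫ x in -X..X, f x) - ∫ x in -X..X, f (x + c * Complex.I))
      atTop (nhds 0) := by
    refine squeeze_zero_norm key ?_
    have : Tendsto (fun X : ℝ => b |X|) atTop (nhds 0) := hb.comp tendsto_abs_atTop_atTop
    simpa using (this.mul_const |c|).const_mul 2
  exact sub_eq_zero.mp (tendsto_nhds_unique (t0.sub t1) lim)

/-! ### Bounds and holomorphy of `Ghat`. -/

/-- Right side minus left side is affine in `A` with nonnegative slope `c θ - 1`, so `A = θ X` is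
the worst case, and there `h` suffices. -/
theorem le_mul_sub_of_le {θ c μ A X : ℝ} (hX : 0 < X) (hθ : 0 < θ) (hμ : 0 < μ) (hc : 0 < c)
    (h : 1 ≤ c * (θ - 1 / 4 - μ)) (hA : θ * X ≤ A) : A ≤ c * θ * (A - X / 4 - μ * X) := by
  have h1 : 0 ≤ c * θ - 1 := by
    have : 0 < c * μ := mul_pos hc hμ
    linarith
  have h2 := mul_nonneg h1 (sub_nonneg.mpr hA)
  have h3 := mul_nonneg (mul_pos hθ hX).le (sub_nonneg.mpr h)
  linarith

/-- The same affine comparison, with slope `c θ (θ - 1 / 4) - 1`. -/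
theorem le_mul_mul_sub_of_le {θ c A X : ℝ} (hX : 0 < X) (hθ : 1 / 4 < θ) (hc : 0 < c)
    (h : 1 ≤ c * ((θ - 1 / 4) ^ 2 - 1 / 32)) (hA : θ * X ≤ A) :
    A ≤ c * θ * ((A - X / 4) * (θ - 1 / 4) - X / 32) := by
  have h1 : 0 ≤ c * θ * (θ - 1 / 4) - 1 := by
    have : 0 < c * (θ - 1 / 4) := mul_pos hc (by linarith)
    linarith
  have h2 := mul_nonneg h1 (sub_nonneg.mpr hA)
  have hθ0 : 0 < θ := by linarith
  have h3 := mul_nonneg (mul_pos hθ0 hX).le (sub_nonneg.mpr h)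
  linarith

namespace FeynmanKac

variable (M : FeynmanKac)

/-- The exterior of a parabola with focus at the origin on which `Ghat` is holomorphic. -/
def region : Set ℂ := {z | 2 * M.radius < ‖z‖ + z.re}

variable {M}

theorem two_mul_norm_le_radius (j : Fin 2) : 2 * ‖M.ρ * M.U j‖ ≤ M.radius := by
  unfold radius
  fin_cases j
  · exact ((le_max_left _ _).trans (le_max_left _ _)).trans (le_max_left _ _)
  · exact ((le_max_left _ _).trans (le_max_right _ _)).trans (le_max_left _ _)

theorem radius_nonneg : 0 ≤ M.radius :=
  le_trans (by positivity) (M.two_mul_norm_le_radius 0)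

theorem four_mul_abs_C_le {r : ℝ} (hr : M.radius ≤ r) (j : Fin 2) : 4 * |M.C j| ≤ r ^ M.α j := by
  have h : (4 * |M.C j|) ^ (1 / M.α j) ≤ r := by
    refine le_trans ?_ hr
    unfold radius
    fin_cases j
    · exact ((le_max_right _ _).trans (le_max_left _ _)).trans (le_max_left _ _)
    · exact ((le_max_right _ _).trans (le_max_right _ _)).trans (le_max_left _ _)
  have hα := (M.α_mem j).1
  calc 4 * |M.C j| = ((4 * |M.C j|) ^ (1 / M.α j)) ^ M.α j := by
        rw [← Real.rpow_mul (by positivity), one_div_mul_cancel hα.ne', Real.rpow_one]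
    _ ≤ r ^ M.α j := Real.rpow_le_rpow (by positivity) h hα.le

theorem abs_C_mul_C_le {r : ℝ} (hr : M.radius ≤ r) (hr0 : 0 < r) (j : Fin 2) :
    32 * (|M.C j| * |M.C (1 - j)|) ≤ r ^ M.α j * r ^ M.α (1 - j) := by
  have h : (32 * |M.C 0 * M.C 1|) ^ (1 / (M.α 0 + M.α 1)) ≤ r :=
    le_trans (le_max_right _ _) hr
  have hα : 0 < M.α 0 + M.α 1 := add_pos (M.α_mem 0).1 (M.α_mem 1).1
  have key : 32 * |M.C 0 * M.C 1| ≤ r ^ (M.α 0 + M.α 1) := by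
    calc 32 * |M.C 0 * M.C 1| =
          ((32 * |M.C 0 * M.C 1|) ^ (1 / (M.α 0 + M.α 1))) ^ (M.α 0 + M.α 1) := by
          rw [← Real.rpow_mul (by positivity), one_div_mul_cancel hα.ne', Real.rpow_one]
      _ ≤ _ := Real.rpow_le_rpow (by positivity) h hα.le
  rw [abs_mul, Real.rpow_add hr0] at key
  fin_cases j
  · exact key
  · simp only [Fin.mk_one, sub_self]
    linarith [mul_comm (|M.C 0|) (|M.C 1|), mul_comm (r ^ M.α 0) (r ^ M.α 1)]

theorem H_eq (j : Fin 2) (z : ℂ) :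
    M.H z = (M.symb j z * M.symb (1 - j) z - (M.C j : ℂ) * (M.C (1 - j) : ℂ))⁻¹ := by
  unfold H
  fin_cases j
  · rfl
  · simp only [Fin.mk_one, sub_self]
    rw [mul_comm (M.symb 1 z), mul_comm (M.C 1 : ℂ)]

/-- Uses `θ ≤ θ ^ α`, which keeps all later constants independent of the exponents. -/
theorem norm_cpow_ge {θ : ℝ} (hθ0 : 0 < θ) (hθ1 : θ ≤ 1) {z : ℂ} (j : Fin 2)
    (hs : θ * ‖z‖ ≤ ‖z + M.ρ * M.U j‖) :
    θ * ‖z‖ ^ M.α j ≤ ‖z + M.ρ * M.U j‖ ^ M.α j := by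
  have hα := M.α_mem j
  calc θ * ‖z‖ ^ M.α j ≤ θ ^ M.α j * ‖z‖ ^ M.α j := by
        gcongr
        calc θ = θ ^ (1 : ℝ) := (Real.rpow_one _).symm
          _ ≤ θ ^ M.α j := Real.rpow_le_rpow_of_exponent_ge hθ0 hθ1 hα.2.le
    _ = (θ * ‖z‖) ^ M.α j := (Real.mul_rpow hθ0.le (norm_nonneg _)).symm
    _ ≤ _ := Real.rpow_le_rpow (by positivity) hs hα.1.le

theorem norm_symb_ge {z : ℂ} (hz : M.radius ≤ ‖z‖) (j : Fin 2) :
    ‖z + M.ρ * M.U j‖ ^ M.α j - ‖z‖ ^ M.α j / 4 ≤ ‖M.symb j z‖ := by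
  have h1 := four_mul_abs_C_le hz j
  have h2 := norm_sub_norm_le ((z + M.ρ * M.U j) ^ (M.α j : ℂ)) (M.C j : ℂ)
  rw [Complex.norm_cpow_real, Complex.norm_real, Real.norm_eq_abs] at h2
  unfold symb
  linarith

/-- The determinant of the Laplace-transformed system, bounded from below. -/
theorem norm_det_ge {θ : ℝ} (hθ0 : 1 / 4 < θ) (hθ1 : θ ≤ 1) {z : ℂ} (hz : M.radius ≤ ‖z‖)
    (hz0 : 0 < ‖z‖) (hs : ∀ i, θ * ‖z‖ ≤ ‖z + M.ρ * M.U i‖) (j : Fin 2) :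
    ((‖z + M.ρ * M.U j‖ ^ M.α j - ‖z‖ ^ M.α j / 4) * (θ - 1 / 4) - ‖z‖ ^ M.α j / 32) *
      ‖z‖ ^ M.α (1 - j) ≤
      ‖M.symb j z * M.symb (1 - j) z - (M.C j : ℂ) * (M.C (1 - j) : ℂ)‖ := by
  have hX : 0 < ‖z‖ ^ M.α j := Real.rpow_pos_of_pos hz0 _
  have hY : 0 < ‖z‖ ^ M.α (1 - j) := Real.rpow_pos_of_pos hz0 _
  have hA := norm_cpow_ge (by linarith) hθ1 j (hs j)
  have hB := norm_cpow_ge (by linarith) hθ1 (1 - j) (hs (1 - j))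
  have h1 := norm_symb_ge hz j
  have h2 := norm_symb_ge hz (1 - j)
  have h3 := abs_C_mul_C_le hz hz0 j
  have h4 := norm_sub_norm_le (M.symb j z * M.symb (1 - j) z) ((M.C j : ℂ) * (M.C (1 - j) : ℂ))
  rw [norm_mul, norm_mul, Complex.norm_real, Complex.norm_real, Real.norm_eq_abs,
    Real.norm_eq_abs] at h4
  have h5 : (‖z + M.ρ * M.U j‖ ^ M.α j - ‖z‖ ^ M.α j / 4) * ((θ - 1 / 4) * ‖z‖ ^ M.α (1 - j)) ≤
      ‖M.symb j z‖ * ‖M.symb (1 - j) z‖ := by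
    apply mul_le_mul h1 (by linarith) (by nlinarith) (norm_nonneg _)
  nlinarith

/-- The parameter `θ` measures how little the shift by `ρ U` matters. The numbers `1 / 4` and `1 /
32` are the sizes of `C j` and of `C 0 * C 1` relative to powers of `‖z‖`, as built into `radius`.
-/
theorem norm_Ghat_le_aux {θ c₁ c₂ : ℝ} (hθ0 : 1 / 4 < θ) (hθ1 : θ ≤ 1)
    (hc₁ : 1 ≤ c₁ * (θ - 1 / 4 - 1 / (32 * (θ - 1 / 4))))
    (hc₂ : 1 ≤ c₂ * ((θ - 1 / 4) ^ 2 - 1 / 32)) (hθ2 : 1 / 32 < (θ - 1 / 4) ^ 2)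
    {z : ℂ} (hz : M.radius ≤ ‖z‖)
    (hz0 : 0 < ‖z‖) (hs : ∀ i, θ * ‖z‖ ≤ ‖z + M.ρ * M.U i‖) (G₀ : Fin 2 → ℂ) (j : Fin 2) :
    M.symb j z * M.symb (1 - j) z - (M.C j : ℂ) * (M.C (1 - j) : ℂ) ≠ 0 ∧
    ‖M.Ghat G₀ j z‖ ≤ c₁ * ‖z‖⁻¹ * ‖G₀ j‖ +
      c₂ * |M.C (1 - j)| * (‖z‖⁻¹ * ‖z‖ ^ (-M.α (1 - j))) * ‖G₀ (1 - j)‖ := by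
  have hX : 0 < ‖z‖ ^ M.α j := Real.rpow_pos_of_pos hz0 _
  have hY : 0 < ‖z‖ ^ M.α (1 - j) := Real.rpow_pos_of_pos hz0 _
  have hA := norm_cpow_ge (by linarith) hθ1 j (hs j)
  have hB := norm_cpow_ge (by linarith) hθ1 (1 - j) (hs (1 - j))
  have h1 := norm_symb_ge hz j
  have h2 := norm_symb_ge hz (1 - j)
  have h3 := abs_C_mul_C_le hz hz0 j
  have hdet := norm_det_ge hθ0 hθ1 hz hz0 hs j
  have hsj : 0 < ‖z + M.ρ * M.U j‖ := lt_of_lt_of_le (mul_pos (by linarith) hz0) (hs j)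
  have hpow : ‖(z + M.ρ * M.U j) ^ ((M.α j - 1 : ℝ) : ℂ)‖ ≤
      ‖z + M.ρ * M.U j‖ ^ M.α j * (θ * ‖z‖)⁻¹ := by
    rw [Complex.norm_cpow_real, Real.rpow_sub hsj, Real.rpow_one, div_eq_mul_inv]
    have : 0 < θ * ‖z‖ := mul_pos (by linarith) hz0
    gcongr
    exact hs j
  set A := ‖z + M.ρ * M.U j‖ ^ M.α j with hAdef
  set X := ‖z‖ ^ M.α j with hXdef
  set Y := ‖z‖ ^ M.α (1 - j) with hYdef
  set d := M.symb j z * M.symb (1 - j) z - (M.C j : ℂ) * (M.C (1 - j) : ℂ) with hd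
  have hk : 0 < θ - 1 / 4 := by linarith
  have hA0 : 0 < A := lt_of_lt_of_le (by positivity) hA
  have hdpos : 0 < ((A - X / 4) * (θ - 1 / 4) - X / 32) * Y := by
    apply mul_pos _ hY
    have : (θ * X - X / 4) * (θ - 1 / 4) ≤ (A - X / 4) * (θ - 1 / 4) := by gcongr
    nlinarith
  have hd0 : 0 < ‖d‖ := lt_of_lt_of_le hdpos hdet
  refine ⟨norm_pos_iff.mp hd0, ?_⟩
  have hH : ‖M.H z‖ = ‖d‖⁻¹ := by rw [H_eq j z, norm_inv]
  -- the two coefficients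
  have hθpos : 0 < θ := by linarith
  have hc₁' : 0 < c₁ := by
    by_contra hneg
    have h6 : 0 < θ - 1 / 4 - 1 / (32 * (θ - 1 / 4)) := by
      have : 1 / (32 * (θ - 1 / 4)) < θ - 1 / 4 := by
        rw [div_lt_iff₀ (by positivity)]; nlinarith
      linarith
    nlinarith
  have hc₂' : 0 < c₂ := by
    by_contra hneg
    nlinarith
  -- The numerator `symb (1 - j)` is cancelled against the determinant instead of being bounded
  -- above: the product of the constants `C` is charged to it through its lower bound `(θ - 1 / 4) *
  -- Y`.
  have t1 : ‖M.symb (1 - j) z‖ * (A * (θ * ‖z‖)⁻¹) ≤ c₁ * ‖z‖⁻¹ * ‖d‖ := by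
    have h4 := norm_sub_norm_le (M.symb j z * M.symb (1 - j) z)
      ((M.C j : ℂ) * (M.C (1 - j) : ℂ))
    rw [norm_mul, norm_mul, Complex.norm_real, Complex.norm_real, Real.norm_eq_abs,
      Real.norm_eq_abs, ← hd] at h4
    set P := ‖M.symb (1 - j) z‖ with hP
    have hP2 : (θ - 1 / 4) * Y ≤ P := by linarith
    have h5 : |M.C j| * |M.C (1 - j)| ≤ X / (32 * (θ - 1 / 4)) * P := by
      calc |M.C j| * |M.C (1 - j)| ≤ X / (32 * (θ - 1 / 4)) * ((θ - 1 / 4) * Y) := by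
            have : ∀ k : ℝ, 0 < k → X / (32 * k) * (k * Y) = X * Y / 32 := by
              intro k hk; field_simp
            rw [this _ hk]; linarith
        _ ≤ _ := by gcongr
    have h6 : (A - X / 4 - X / (32 * (θ - 1 / 4))) * P ≤ ‖d‖ := by
      have : (A - X / 4) * P ≤ ‖M.symb j z‖ * P := by gcongr
      linarith
    have h7 : A ≤ c₁ * θ * (A - X / 4 - X / (32 * (θ - 1 / 4))) := by
      have := le_mul_sub_of_le hX hθpos (by positivity) hc₁' hc₁ hA
      rwa [one_div_mul_eq_div] at this
    have h8 : A * P ≤ c₁ * θ * ‖d‖ := by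
      calc A * P ≤ c₁ * θ * (A - X / 4 - X / (32 * (θ - 1 / 4))) * P := by gcongr
        _ = c₁ * θ * ((A - X / 4 - X / (32 * (θ - 1 / 4))) * P) := by ring
        _ ≤ _ := by gcongr
    calc P * (A * (θ * ‖z‖)⁻¹) = A * P * (θ * ‖z‖)⁻¹ := by ring
      _ ≤ c₁ * θ * ‖d‖ * (θ * ‖z‖)⁻¹ := by gcongr
      _ = _ := by field_simp
  have t2 : A * (θ * ‖z‖)⁻¹ ≤ c₂ * (‖z‖⁻¹ * Y⁻¹) * ‖d‖ := by
    have h7 : A * Y ≤ c₂ * θ * (((A - X / 4) * (θ - 1 / 4) - X / 32) * Y) := by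
      have := mul_le_mul_of_nonneg_right (le_mul_mul_sub_of_le hX hθ0 hc₂' hc₂ hA) hY.le
      linarith
    have h8 : A * Y ≤ c₂ * θ * ‖d‖ := h7.trans (by gcongr)
    calc A * (θ * ‖z‖)⁻¹ = A * Y * ((θ * ‖z‖)⁻¹ * Y⁻¹) := by field_simp
      _ ≤ c₂ * θ * ‖d‖ * ((θ * ‖z‖)⁻¹ * Y⁻¹) := by gcongr
      _ = _ := by field_simp
  unfold Ghat
  refine (norm_sub_le _ _).trans (add_le_add ?_ ?_)
  · simp only [norm_mul, hH]
    refine mul_le_mul_of_nonneg_right ?_ (norm_nonneg _)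
    calc ‖d‖⁻¹ * ‖M.symb (1 - j) z‖ * ‖(z + M.ρ * M.U j) ^ ((M.α j - 1 : ℝ) : ℂ)‖
        ≤ ‖d‖⁻¹ * (‖M.symb (1 - j) z‖ * (A * (θ * ‖z‖)⁻¹)) := by rw [mul_assoc]; gcongr
      _ ≤ ‖d‖⁻¹ * (c₁ * ‖z‖⁻¹ * ‖d‖) := by gcongr
      _ = _ := by field_simp
  · simp only [norm_mul, hH, Complex.norm_real, Real.norm_eq_abs]
    refine mul_le_mul_of_nonneg_right ?_ (norm_nonneg _)
    rw [Real.rpow_neg (norm_nonneg _)]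
    calc |M.C (1 - j)| * ‖d‖⁻¹ * ‖(z + M.ρ * M.U j) ^ ((M.α j - 1 : ℝ) : ℂ)‖
        ≤ |M.C (1 - j)| * ‖d‖⁻¹ * (A * (θ * ‖z‖)⁻¹) := by gcongr
      _ ≤ |M.C (1 - j)| * ‖d‖⁻¹ * (c₂ * (‖z‖⁻¹ * Y⁻¹) * ‖d‖) := by gcongr
      _ = _ := by rw [← hYdef]; field_simp

theorem half_norm_le {z : ℂ} (hz : M.radius ≤ ‖z‖) (i : Fin 2) :
    1 / 2 * ‖z‖ ≤ ‖z + M.ρ * M.U i‖ := by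
  have h1 := M.two_mul_norm_le_radius i
  have h2 := norm_sub_le_norm_add z (M.ρ * M.U i)
  linarith

theorem det_ne_zero {z : ℂ} (hz : M.radius < ‖z‖) (j : Fin 2) :
    M.symb j z * M.symb (1 - j) z - (M.C j : ℂ) * (M.C (1 - j) : ℂ) ≠ 0 :=
  (norm_Ghat_le_aux (θ := 1 / 2) (c₁ := 8) (c₂ := 32) (by norm_num) (by norm_num) (by norm_num)
    (by norm_num) (by norm_num) hz.le (radius_nonneg.trans_lt hz) (half_norm_le hz.le) 0 j).1

/-- Here `θ = 1 / 2`, because `2 ‖ρ U‖ ≤ R < ‖z‖`. Then `1 / 4 - 1 / 8 = 1 / 8` and `1 / 16 - 1 / 32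
= 1 / 32` give the constants `8` and `32 = 8 * 4`. -/
theorem norm_Ghat_le {z : ℂ} (hz : M.radius < ‖z‖) (G₀ : Fin 2 → ℂ) (j : Fin 2) :
    ‖M.Ghat G₀ j z‖ ≤ 8 * (‖z‖⁻¹ * (‖G₀ j‖ +
      4 * |M.C (1 - j)| * ‖z‖ ^ (-M.α (1 - j)) * ‖G₀ (1 - j)‖)) := by
  refine (norm_Ghat_le_aux (θ := 1 / 2) (c₁ := 8) (c₂ := 32) (by norm_num) (by norm_num)
    (by norm_num) (by norm_num) (by norm_num) hz.le (radius_nonneg.trans_lt hz)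
    (half_norm_le hz.le) G₀ j).2.trans (le_of_eq (by ring))

/-- Beyond `3 R / 2` the shift is at most `‖z‖ / 3`, so `θ = 2 / 3` and the constant drops from `8`
to `3`. The gain `3 / 8` is recorded in `farFactor` and keeps the hyperbolic constants small enough.
-/
theorem norm_Ghat_le_of_far {z : ℂ} (hz : M.radius < ‖z‖) (hz' : 3 / 2 * M.radius ≤ ‖z‖)
    (G₀ : Fin 2 → ℂ) (j : Fin 2) :
    ‖M.Ghat G₀ j z‖ ≤ 3 * (‖z‖⁻¹ * (‖G₀ j‖ +
      4 * |M.C (1 - j)| * ‖z‖ ^ (-M.α (1 - j)) * ‖G₀ (1 - j)‖)) := by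
  refine (norm_Ghat_le_aux (θ := 2 / 3) (c₁ := 3) (c₂ := 12) (by norm_num) (by norm_num)
    (by norm_num) (by norm_num) (by norm_num) hz.le (radius_nonneg.trans_lt hz)
    (fun i => ?_) G₀ j).2.trans (le_of_eq (by ring))
  have h1 := M.two_mul_norm_le_radius i
  have h2 := norm_sub_le_norm_add z (M.ρ * M.U i)
  linarith

theorem radius_lt_norm_of_mem_region {z : ℂ} (hz : z ∈ M.region) : M.radius < ‖z‖ := by
  have h1 : 2 * M.radius < ‖z‖ + z.re := hz
  linarith [Complex.re_le_norm z]

/-- If the shifted point lay on the cut, then `|Im z|` and `Re z` would be at most `R / 2`, hence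
`‖z‖ + Re z ≤ 3 R / 2`, contradicting the `2 R` of `region`. -/
theorem add_mem_slitPlane {z : ℂ} (hz : z ∈ M.region) (j : Fin 2) :
    z + M.ρ * M.U j ∈ Complex.slitPlane := by
  by_contra hcon
  rw [Complex.mem_slitPlane_iff, not_or, not_lt, not_not] at hcon
  obtain ⟨h1, h2⟩ := hcon
  set u := M.ρ * M.U j with hu
  have hR : 2 * ‖u‖ ≤ M.radius := M.two_mul_norm_le_radius j
  have hz' : 2 * M.radius < ‖z‖ + z.re := hz
  simp only [Complex.add_re, Complex.add_im] at h1 h2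
  have h3 := Complex.norm_le_abs_re_add_abs_im z
  have h4 := Complex.abs_re_le_norm u
  have h5 := Complex.abs_im_le_norm u
  have h6 : |z.im| = |u.im| := by rw [← abs_neg u.im]; congr 1; linarith
  rcases abs_cases z.re with ⟨h7, _⟩ | ⟨h7, _⟩ <;> rcases abs_cases u.re with ⟨h8, _⟩ | ⟨h8, _⟩ <;>
    linarith [norm_nonneg u]

theorem differentiableOn_Ghat (G₀ : Fin 2 → ℂ) (j : Fin 2) :
    DifferentiableOn ℂ (M.Ghat G₀ j) M.region := by
  have hlin : ∀ i : Fin 2, DifferentiableOn ℂ (fun z : ℂ => z + M.ρ * M.U i) M.region :=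
    fun i => by fun_prop
  have hpow : ∀ (i : Fin 2) (c : ℂ),
      DifferentiableOn ℂ (fun z : ℂ => (z + M.ρ * M.U i) ^ c) M.region := fun i c =>
    (hlin i).cpow_const fun z hz => add_mem_slitPlane hz i
  have hsymb : ∀ i : Fin 2, DifferentiableOn ℂ (M.symb i) M.region := fun i =>
    (hpow i _).sub_const _
  have hH : DifferentiableOn ℂ M.H M.region := by
    refine DifferentiableOn.inv (((hsymb 0).mul (hsymb 1)).sub_const _) fun z hz => ?_
    exact det_ne_zero (radius_lt_norm_of_mem_region hz) 0
  unfold Ghat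
  exact (((hH.mul (hsymb _)).mul (hpow _ _)).mul_const _).sub
    ((((differentiableOn_const _).mul hH).mul (hpow _ _)).mul_const _)

end FeynmanKac

/-! ### The Gamma integral and inverse Laplace integrals on vertical lines. -/

open MeasureTheory in
theorem integrableOn_rpow_mul_exp_neg {a c : ℝ} (ha : 0 < a) (hc : 0 < c) :
    IntegrableOn (fun t : ℝ => t ^ (a - 1) * Real.exp (-(c * t))) (Ioi 0) := by
  have := integrableOn_rpow_mul_exp_neg_mul_rpow (p := 1) (s := a - 1) (b := c) (by linarith)
    (by norm_num) hc
  simpa using this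

open MeasureTheory in
/-- The Gamma integral with complex decay rate. -/
theorem integral_rpow_mul_cexp_neg_mul_Ioi {a : ℝ} (ha : 0 < a) {r : ℂ} (hr : 0 < r.re) :
    ∫ t : ℝ in Ioi 0, ((t ^ (a - 1) : ℝ) : ℂ) * Complex.exp (-(r * t)) =
      r ^ (-(a : ℂ)) * (Real.Gamma a : ℂ) := by
  set U : Set ℂ := {z | 0 < z.re} with hU
  have hUo : IsOpen U := isOpen_lt continuous_const Complex.continuous_re
  have hconv : Convex ℝ U := convex_halfSpace_re_gt 0
  set F : ℂ → ℂ := fun r => ∫ t : ℝ in Ioi 0, ((t ^ (a - 1) : ℝ) : ℂ) * Complex.exp (-(r * t))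
    with hF
  have hmeas : ∀ (b : ℝ) (r : ℂ), AEStronglyMeasurable
      (fun t : ℝ => ((t ^ b : ℝ) : ℂ) * Complex.exp (-(r * t))) (volume.restrict (Ioi 0)) := by
    intro b r
    refine ContinuousOn.aestronglyMeasurable ?_ measurableSet_Ioi
    refine ContinuousOn.mul ?_ (by fun_prop)
    exact Complex.continuous_ofReal.comp_continuousOn
      (ContinuousOn.rpow_const continuousOn_id fun x hx => Or.inl (ne_of_gt hx))
  have hnorm : ∀ (b : ℝ) (r : ℂ) (t : ℝ), t ∈ Ioi (0:ℝ) →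
      ‖((t ^ b : ℝ) : ℂ) * Complex.exp (-(r * t))‖ = t ^ b * Real.exp (-(r.re * t)) := by
    intro b r t ht
    rw [norm_mul, Complex.norm_exp, Complex.norm_real,
      Real.norm_of_nonneg (Real.rpow_nonneg (le_of_lt ht) _)]
    simp
  have hFd : DifferentiableOn ℂ F U := by
    intro r hr
    have hr' : 0 < r.re := hr
    refine DifferentiableAt.differentiableWithinAt ?_
    have hs : {z : ℂ | r.re / 2 < z.re} ∈ nhds r :=
      (isOpen_lt continuous_const Complex.continuous_re).mem_nhds (by simp; linarith)
    refine (hasDerivAt_integral_of_dominated_loc_of_deriv_le (μ := volume.restrict (Ioi 0))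
      (F := fun (r : ℂ) (t : ℝ) => ((t ^ (a - 1) : ℝ) : ℂ) * Complex.exp (-(r * t)))
      (F' := fun (r : ℂ) (t : ℝ) => -(((t ^ a : ℝ) : ℂ) * Complex.exp (-(r * t))))
      (bound := fun t => t ^ (a + 1 - 1) * Real.exp (-(r.re / 2 * t))) hs
      (Eventually.of_forall fun z => hmeas _ z) ?_ ((hmeas _ r).neg) ?_
      (integrableOn_rpow_mul_exp_neg (by linarith) (by linarith)) ?_).2.differentiableAt
    · refine Integrable.mono' (integrableOn_rpow_mul_exp_neg ha hr') (hmeas _ r) ?_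
      filter_upwards [ae_restrict_mem measurableSet_Ioi] with t ht
      rw [hnorm _ _ _ ht]
    · filter_upwards [ae_restrict_mem measurableSet_Ioi] with t ht z hz
      rw [norm_neg, hnorm _ _ _ ht, add_sub_cancel_right]
      have ht' : (0:ℝ) < t := ht
      have hz' : r.re / 2 < z.re := hz
      gcongr
    · filter_upwards [ae_restrict_mem measurableSet_Ioi] with t ht z hz
      have ht' : (0:ℝ) < t := ht
      have h1 : HasDerivAt (fun z : ℂ => Complex.exp (-(z * t)))
          (Complex.exp (-(z * t)) * (-(1 * t))) z :=
        (((hasDerivAt_id z).mul_const (t : ℂ)).neg).cexp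
      refine (h1.const_mul ((t ^ (a - 1) : ℝ) : ℂ)).congr_deriv ?_
      have : t ^ a = t ^ (a - 1) * t := by
        rw [← Real.rpow_add_one ht'.ne', sub_add_cancel]
      rw [this]; push_cast; ring
  have hGd : DifferentiableOn ℂ (fun r : ℂ => r ^ (-(a : ℂ)) * (Real.Gamma a : ℂ)) U := by
    refine DifferentiableOn.mul_const ?_ _
    exact differentiableOn_id.cpow_const fun z hz => Or.inl hz
  have hreal : ∀ x : ℝ, 0 < x → F x = (x : ℂ) ^ (-(a : ℂ)) * (Real.Gamma a : ℂ) := by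
    intro x hx
    have h1 := Real.integral_rpow_mul_exp_neg_mul_Ioi ha hx
    have h2 : F x = ((∫ t in Ioi 0, t ^ (a - 1) * Real.exp (-(x * t)) : ℝ) : ℂ) := by
      rw [← integral_complex_ofReal]
      refine setIntegral_congr_fun measurableSet_Ioi fun t _ => ?_
      push_cast; rfl
    rw [h2, h1, one_div, Real.inv_rpow hx.le, ← Real.rpow_neg hx.le]
    push_cast
    rw [Complex.ofReal_cpow hx.le]; push_cast; rfl
  -- Both sides are holomorphic on the right half-plane and agree on the positive reals, which
  -- accumulate at `1`.
  have hEq := AnalyticOnNhd.eqOn_of_preconnected_of_frequently_eq (hFd.analyticOnNhd hUo)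
    (hGd.analyticOnNhd hUo) hconv.isPreconnected (z₀ := (1 : ℂ)) (by simp [hU]) ?_
  · exact hEq hr
  · have hseq : Tendsto (fun n : ℕ => ((1 + 1 / ((n : ℝ) + 1) : ℝ) : ℂ)) atTop
        (nhdsWithin 1 {1}ᶜ) := by
      refine tendsto_nhdsWithin_iff.mpr ⟨?_, Eventually.of_forall fun n => ?_⟩
      · have : Tendsto (fun n : ℕ => (1 + 1 / ((n : ℝ) + 1) : ℝ)) atTop (nhds (1 + 0)) :=
          tendsto_one_div_add_atTop_nhds_zero_nat.const_add 1
        rw [add_zero] at this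
        exact_mod_cast (Complex.continuous_ofReal.tendsto 1).comp this
      · have : (0:ℝ) < 1 / ((n : ℝ) + 1) := by positivity
        simp only [mem_compl_iff, mem_singleton_iff]
        intro h
        have h' : (1 + 1 / ((n : ℝ) + 1) : ℝ) = 1 := by exact_mod_cast h
        linarith
    refine hseq.frequently (Frequently.of_forall fun n => ?_)
    exact hreal _ (by positivity)

/-- Inverse Laplace integral along the vertical line `re z = σ`. -/
noncomputable def verticalInv (F : ℂ → ℂ) (σ t : ℝ) : ℂ :=
  (1 / (2 * π) : ℂ) * ∫ y : ℝ, Complex.exp ((σ + y * Complex.I) * t) * F (σ + y * Complex.I)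

/-- Holomorphic functions on `re z > r` bounded by `C / ‖z‖ ^ 2`. -/
structure QuadDecay (r C : ℝ) (F : ℂ → ℂ) : Prop where
  diff : DifferentiableOn ℂ F {z | r < z.re}
  bound : ∀ z : ℂ, r < z.re → ‖F z‖ ≤ C / ‖z‖ ^ 2

namespace QuadDecay

variable {r C : ℝ} {F : ℂ → ℂ}

theorem nonneg (h : QuadDecay r C F) (hr : 0 ≤ r) : 0 ≤ C := by
  have h1 := (norm_nonneg _).trans (h.bound ((r + 1 : ℝ) : ℂ) (by simp))
  by_contra hC
  have : C / ‖((r + 1 : ℝ) : ℂ)‖ ^ 2 < 0 := by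
    apply div_neg_of_neg_of_pos (by linarith)
    rw [Complex.norm_real, Real.norm_eq_abs, sq_abs]
    positivity
  linarith

theorem mul (h : QuadDecay r C F) (hr : 0 ≤ r) {g : ℂ → ℂ}
    (hg : DifferentiableOn ℂ g {z | r < z.re})
    (hg1 : ∀ z : ℂ, r < z.re → ‖g z‖ ≤ 1) : QuadDecay r C fun z => F z * g z := by
  refine ⟨h.diff.mul hg, fun z hz => ?_⟩
  rw [norm_mul]
  have h1 := h.bound z hz
  have h2 := hg1 z hz
  have h3 := h.nonneg hr
  calc ‖F z‖ * ‖g z‖ ≤ C / ‖z‖ ^ 2 * 1 := by gcongr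
    _ = _ := mul_one _

theorem norm_sq (σ y : ℝ) : ‖(σ + y * Complex.I : ℂ)‖ ^ 2 = σ ^ 2 + y ^ 2 := by
  rw [← Complex.normSq_eq_norm_sq, Complex.normSq_add_mul_I]

theorem bound_line (h : QuadDecay r C F) (hr : 0 ≤ r) {σ : ℝ} (hσ : r < σ) (hσ1 : 1 ≤ σ) (y : ℝ) :
    ‖F (σ + y * Complex.I)‖ ≤ C * (1 + y ^ 2)⁻¹ := by
  refine (h.bound _ (by simpa using hσ)).trans ?_
  rw [norm_sq, div_eq_mul_inv]
  have := h.nonneg hr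
  gcongr
  nlinarith

theorem continuous_line (h : QuadDecay r C F) {σ : ℝ} (hσ : r < σ) :
    Continuous fun y : ℝ => F (σ + y * Complex.I) :=
  h.diff.continuousOn.comp_continuous (by fun_prop) fun y => by simpa using hσ

theorem norm_exp_line (σ y t : ℝ) :
    ‖Complex.exp ((σ + y * Complex.I) * t)‖ = Real.exp (σ * t) := by
  rw [Complex.norm_exp]
  simp

open MeasureTheory in
theorem integrable_line (h : QuadDecay r C F) (hr : 0 ≤ r) {σ : ℝ} (hσ : r < σ) (hσ1 : 1 ≤ σ) :
    Integrable fun y : ℝ => F (σ + y * Complex.I) :=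
  Integrable.mono' (integrable_inv_one_add_sq.const_mul C)
    (h.continuous_line hσ).aestronglyMeasurable
    (Eventually.of_forall fun y => h.bound_line hr hσ hσ1 y)

open MeasureTheory in
theorem integrable (h : QuadDecay r C F) (hr : 0 ≤ r) {σ : ℝ} (hσ : r < σ) (hσ1 : 1 ≤ σ) (t : ℝ) :
    Integrable fun y : ℝ => Complex.exp ((σ + y * Complex.I) * t) * F (σ + y * Complex.I) := by
  refine (h.integrable_line hr hσ hσ1).bdd_mul (c := Real.exp (σ * t))
    (by fun_prop : Continuous _).aestronglyMeasurable (Eventually.of_forall fun y => ?_)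
  rw [norm_exp_line]

open MeasureTheory in
theorem verticalInv_eq (h : QuadDecay r C F) (hr : 0 ≤ r) {σ σ' : ℝ} (hσ : r < σ) (hσ1 : 1 ≤ σ)
    (hσ' : r < σ') (hσ1' : 1 ≤ σ') (t : ℝ) : verticalInv F σ t = verticalInv F σ' t := by
  unfold verticalInv
  congr 1
  -- With `z = σ + i w`, moving the abscissa from `σ` to `σ'` is a shift of `w` by `i (σ - σ')`.
  set f : ℂ → ℂ := fun w => Complex.exp ((σ + w * Complex.I) * t) * F (σ + w * Complex.I) with hf
  have e : ∀ x y : ℝ, (σ + (x + y * Complex.I) * Complex.I : ℂ) = ((σ - y : ℝ) + x * Complex.I) := by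
    intro x y; push_cast; linear_combination (y : ℂ) * Complex.I_mul_I
  have hcond : ∀ y : ℝ, y ∈ uIcc 0 (σ - σ') → r < σ - y ∧ 1 ≤ σ - y ∧ σ - y ≤ max σ σ' := by
    intro y hy
    rcases le_total 0 (σ - σ') with h1 | h1
    · rw [uIcc_of_le h1] at hy
      exact ⟨by linarith [hy.2], by linarith [hy.2], le_max_of_le_left (by linarith [hy.1])⟩
    · rw [uIcc_of_ge h1] at hy
      exact ⟨by linarith [hy.2], by linarith [hy.2], le_max_of_le_right (by linarith [hy.1])⟩
  have := integral_shift_im (f := f) (c := σ - σ')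
    (b := fun x => Real.exp (max σ σ' * |t|) * (C * (1 + x ^ 2)⁻¹)) ?_ ?_ ?_ ?_ ?_
  · simp only [hf] at this
    rw [this]
    congr 1
    ext x
    rw [e]
    simp
  · intro z hz
    have hmem : r < (σ + z * Complex.I).re := by
      have := (hcond _ hz).1
      simp
      linarith
    have h1 : DifferentiableAt ℂ F (σ + z * Complex.I) :=
      h.diff.differentiableAt
        ((isOpen_lt continuous_const Complex.continuous_re).mem_nhds hmem)
    refine DifferentiableAt.differentiableWithinAt ?_
    refine DifferentiableAt.mul (by fun_prop) ?_
    exact DifferentiableAt.comp z (f := fun z : ℂ => (σ + z * Complex.I)) h1 (by fun_prop)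
  · have : Tendsto (fun x : ℝ => (1 + x ^ 2)⁻¹) atTop (nhds 0) :=
      tendsto_inv_atTop_zero.comp (tendsto_atTop_add_const_left _ _ (tendsto_pow_atTop (by norm_num)))
    simpa using (this.const_mul C).const_mul (Real.exp (max σ σ' * |t|))
  · intro x y hy
    obtain ⟨h1, h2, h3⟩ := hcond y hy
    simp only [hf]
    rw [e, norm_mul, norm_exp_line, sq_abs]
    have h4 := h.bound_line hr h1 h2 x
    have h5 : (σ - y) * t ≤ max σ σ' * |t| := by
      calc (σ - y) * t ≤ (σ - y) * |t| :=
            mul_le_mul_of_nonneg_left (le_abs_self t) (by linarith)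
        _ ≤ _ := mul_le_mul_of_nonneg_right h3 (abs_nonneg t)
    exact mul_le_mul (Real.exp_le_exp.mpr h5) h4 (norm_nonneg _) (Real.exp_pos _).le
  · exact h.integrable hr hσ hσ1 t
  · have := h.integrable hr hσ' hσ1' t
    refine this.congr (Eventually.of_forall fun x => ?_)
    simp only [hf]
    rw [e]
    simp

-- The constant `C` does not depend on `σ`; letting `σ → ∞` for `t < 0` therefore gives causality.
open MeasureTheory in
theorem norm_verticalInv_le (h : QuadDecay r C F) (hr : 0 ≤ r) {σ : ℝ} (hσ : r < σ) (hσ1 : 1 ≤ σ)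
    (t : ℝ) : ‖verticalInv F σ t‖ ≤ Real.exp (σ * t) * C := by
  unfold verticalInv
  have h1 : ‖∫ y : ℝ, Complex.exp ((σ + y * Complex.I) * t) * F (σ + y * Complex.I)‖ ≤
      ∫ y : ℝ, Real.exp (σ * t) * (C * (1 + y ^ 2)⁻¹) := by
    refine norm_integral_le_of_norm_le ((integrable_inv_one_add_sq.const_mul C).const_mul _)
      (Eventually.of_forall fun y => ?_)
    rw [norm_mul, norm_exp_line]
    have := h.bound_line hr hσ hσ1 y
    gcongr
  rw [integral_const_mul, integral_const_mul, integral_univ_inv_one_add_sq] at h1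
  have hC := h.nonneg hr
  rw [norm_mul]
  have h2 : ‖(1 / (2 * π) : ℂ)‖ = 1 / (2 * π) := by
    rw [show (1 / (2 * π) : ℂ) = ((1 / (2 * π) : ℝ) : ℂ) by push_cast; rfl, Complex.norm_real,
      Real.norm_of_nonneg (by positivity)]
  rw [h2]
  calc 1 / (2 * π) * _ ≤ 1 / (2 * π) * (Real.exp (σ * t) * (C * π)) := by gcongr
    _ = Real.exp (σ * t) * C / 2 := by field_simp
    _ ≤ _ := by
      have : 0 ≤ Real.exp (σ * t) * C := by positivity
      linarith

/-- The inverse Laplace integral is causal. -/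
theorem verticalInv_eq_zero (h : QuadDecay r C F) (hr : 0 ≤ r) {σ : ℝ} (hσ : r < σ) (hσ1 : 1 ≤ σ)
    {t : ℝ} (ht : t < 0) : verticalInv F σ t = 0 := by
  have hlim : Tendsto (fun s : ℝ => Real.exp (s * t) * C) atTop (nhds 0) := by
    have : Tendsto (fun s : ℝ => Real.exp (s * t)) atTop (nhds 0) :=
      Real.tendsto_exp_atBot.comp (tendsto_id.atTop_mul_const_of_neg ht)
    simpa using this.mul_const C
  have hle : ∀ᶠ s : ℝ in atTop, ‖verticalInv F σ t‖ ≤ Real.exp (s * t) * C := by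
    filter_upwards [eventually_gt_atTop r, eventually_ge_atTop 1] with s h1 h2
    rw [h.verticalInv_eq hr hσ hσ1 h1 h2]
    exact h.norm_verticalInv_le hr h1 h2 t
  exact norm_le_zero_iff.mp (ge_of_tendsto hlim hle)

open MeasureTheory in
theorem continuous_verticalInv (h : QuadDecay r C F) (hr : 0 ≤ r) {σ : ℝ} (hσ : r < σ)
    (hσ1 : 1 ≤ σ) : Continuous (verticalInv F σ) := by
  unfold verticalInv
  refine continuous_const.mul ?_
  refine continuous_iff_continuousAt.mpr fun t₀ => ?_
  refine continuousAt_of_dominated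
    (bound := fun y : ℝ => Real.exp (σ * (t₀ + 1)) * ‖F (σ + y * Complex.I)‖)
    (Eventually.of_forall fun t => (h.integrable hr hσ hσ1 t).aestronglyMeasurable) ?_
    ((h.integrable_line hr hσ hσ1).norm.const_mul _)
    (Eventually.of_forall fun y => by fun_prop)
  filter_upwards [eventually_lt_nhds (show t₀ < t₀ + 1 by linarith)] with t ht
  refine Eventually.of_forall fun y => ?_
  rw [norm_mul, norm_exp_line]
  gcongr

end QuadDecay

/-! ### Tempered fractional integrals. -/

/-- The tempered Riemann-Liouville integral of order `α` with tempering parameter `u`. -/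
noncomputable def temperedInt (α : ℝ) (u : ℂ) (g : ℝ → ℂ) (t : ℝ) : ℂ :=
  (1 / (Real.Gamma α : ℂ)) * ∫ τ in (0 : ℝ)..t,
    Complex.exp (-((t - τ : ℝ) : ℂ) * u) * (((t - τ) ^ (α - 1) : ℝ) : ℂ) * g τ

/-- The convolution kernel of `temperedInt`, without the Gamma factor. -/
noncomputable def temperedKer (α : ℝ) (u : ℂ) (s : ℝ) : ℂ :=
  Complex.exp (-(s : ℂ) * u) * ((s ^ (α - 1) : ℝ) : ℂ)

theorem FeynmanKac.fracInt_eq (M : FeynmanKac) (j : Fin 2) (g : ℝ → ℂ) (t : ℝ) :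
    M.fracInt j g t = temperedInt (M.α j) (M.ρ * M.U j) g t := rfl

/-- Lets ordinary integration be treated as the case `α = 1`, `u = 0` of the results on tempered
integrals. -/
theorem temperedInt_one_zero (g : ℝ → ℂ) (t : ℝ) : temperedInt 1 0 g t = ∫ τ in (0:ℝ)..t, g τ := by
  simp [temperedInt]

theorem temperedInt_eq (α : ℝ) (u : ℂ) (g : ℝ → ℂ) (t : ℝ) :
    temperedInt α u g t =
      (1 / (Real.Gamma α : ℂ)) * ∫ s in (0 : ℝ)..t, temperedKer α u s * g (t - s) := by
  have := intervalIntegral.integral_comp_sub_left (a := 0) (b := t)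
    (fun s => temperedKer α u s * g (t - s)) t
  simp only [sub_self, sub_zero, sub_sub_cancel] at this
  rw [← this]
  rfl

theorem norm_temperedKer {α : ℝ} {u : ℂ} {s : ℝ} (hs : 0 < s) :
    ‖temperedKer α u s‖ = s ^ (α - 1) * Real.exp (-(u.re * s)) := by
  rw [temperedKer, norm_mul, Complex.norm_exp, Complex.norm_real,
    Real.norm_of_nonneg (Real.rpow_nonneg hs.le _), mul_comm]
  congr 2
  simp [mul_comm]

theorem continuousOn_temperedKer (α : ℝ) (u : ℂ) : ContinuousOn (temperedKer α u) (Ioi 0) := by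
  refine ContinuousOn.mul (by fun_prop) ?_
  exact Complex.continuous_ofReal.comp_continuousOn
    (ContinuousOn.rpow_const continuousOn_id fun x hx => Or.inl (ne_of_gt hx))

open MeasureTheory in
theorem aestronglyMeasurable_temperedKer (α : ℝ) (u : ℂ) :
    AEStronglyMeasurable (temperedKer α u) (volume.restrict (Ioi 0)) :=
  (continuousOn_temperedKer α u).aestronglyMeasurable measurableSet_Ioi

open MeasureTheory in
theorem integrableOn_temperedKer_mul_exp {α : ℝ} (hα : 0 < α) {u : ℂ} {σ : ℝ}
    (hσ : 0 < σ + u.re) :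
    IntegrableOn (fun s : ℝ => Real.exp (-(σ * s)) * ‖temperedKer α u s‖) (Ioi 0) := by
  refine (integrableOn_rpow_mul_exp_neg hα hσ).congr_fun (fun s hs => ?_) measurableSet_Ioi
  rw [norm_temperedKer hs, mul_left_comm, ← Real.exp_add]
  ring_nf

open MeasureTheory in
theorem integrableOn_temperedKer {α : ℝ} (hα : 0 < α) (u : ℂ) (t : ℝ) :
    IntegrableOn (temperedKer α u) (Ioc 0 t) := by
  have h1 := (integrableOn_temperedKer_mul_exp hα (u := u) (σ := 1 - u.re) (by simp)).mono_set
    (Ioc_subset_Ioi_self : Ioc 0 t ⊆ Ioi 0)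
  refine Integrable.mono' (h1.const_mul (Real.exp (|1 - u.re| * t)))
    ((aestronglyMeasurable_temperedKer α u).mono_measure
      (Measure.restrict_mono Ioc_subset_Ioi_self le_rfl)) ?_
  filter_upwards [ae_restrict_mem measurableSet_Ioc] with s hs
  rw [← mul_assoc, ← Real.exp_add]
  refine le_mul_of_one_le_left (norm_nonneg _) (Real.one_le_exp ?_)
  have h2 : (1 - u.re) * s ≤ |1 - u.re| * t :=
    mul_le_mul (le_abs_self _) hs.2 hs.1.le (abs_nonneg _)
  linarith

open MeasureTheory in
/-- Tempered integration multiplies the symbol of an inverse Laplace integral by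
`(z + u) ^ (-α)`. -/
theorem QuadDecay.temperedInt_verticalInv {r C : ℝ} {F : ℂ → ℂ} (h : QuadDecay r C F) (hr : 0 ≤ r)
    {σ : ℝ} (hσ : r < σ) (hσ1 : 1 ≤ σ) {α : ℝ} (hα : 0 < α) {u : ℂ} (hu : 0 < σ + u.re) {t : ℝ}
    (ht : 0 ≤ t) :
    temperedInt α u (verticalInv F σ) t =
      verticalInv (fun z => F z * (z + u) ^ (-(α : ℂ))) σ t := by
  rw [temperedInt_eq, intervalIntegral.integral_of_le ht]
  -- By causality the convolution may run over the whole half-line, where the kernel meets the Gamma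
  -- integral.
  have h1 : ∫ s in Ioc 0 t, temperedKer α u s * verticalInv F σ (t - s) =
      ∫ s in Ioi 0, temperedKer α u s * verticalInv F σ (t - s) := by
    symm
    refine setIntegral_eq_of_subset_of_forall_sdiff_eq_zero measurableSet_Ioi
      Ioc_subset_Ioi_self fun s hs => ?_
    have : t < s := by
      by_contra hcon
      exact hs.2 ⟨hs.1, not_lt.mp hcon⟩
    rw [h.verticalInv_eq_zero hr hσ hσ1 (by linarith), mul_zero]
  have hΓ : (Real.Gamma α : ℂ) ≠ 0 := by exact_mod_cast (Real.Gamma_pos_of_pos hα).ne'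
  set Z : ℝ → ℂ := fun y => σ + y * Complex.I with hZ
  set Q : ℝ → ℝ → ℂ := fun s y =>
    temperedKer α u s * (Complex.exp (Z y * ((t - s : ℝ) : ℂ)) * F (Z y)) with hQ
  -- Fubini: the modulus is a product of a function of `s`, integrable because `σ + u.re > 0`, and
  -- one of `y`.
  have hQint : Integrable (Function.uncurry Q) ((volume.restrict (Ioi 0)).prod volume) := by
    have hk := integrableOn_temperedKer_mul_exp hα hu
    have hF := (h.integrable_line hr hσ hσ1).norm
    refine Integrable.mono' ((hk.mul_prod hF).const_mul (Real.exp (σ * t))) ?_ ?_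
    · refine AEStronglyMeasurable.mul (aestronglyMeasurable_temperedKer α u).comp_fst ?_
      refine AEStronglyMeasurable.mul
        (by fun_prop : Continuous fun p : ℝ × ℝ =>
          Complex.exp (Z p.2 * ((t - p.1 : ℝ) : ℂ))).aestronglyMeasurable ?_
      exact (h.continuous_line hσ).aestronglyMeasurable.comp_snd
    · refine Eventually.of_forall fun p => ?_
      simp only [Function.uncurry, hQ, hZ, norm_mul, norm_exp_line]
      have : σ * (t - p.1) = σ * t + -(σ * p.1) := by ring
      rw [this, Real.exp_add]
      apply le_of_eq; ring
  have h2 : ∫ s in Ioi 0, temperedKer α u s * verticalInv F σ (t - s) =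
      (1 / (2 * π) : ℂ) * ∫ s in Ioi 0, ∫ y, Q s y := by
    rw [← integral_const_mul]
    refine setIntegral_congr_fun measurableSet_Ioi fun s _ => ?_
    simp only [verticalInv, hQ, integral_const_mul, hZ]
    ring
  have h3 : ∀ y : ℝ, ∫ s in Ioi 0, Q s y =
      Complex.exp (Z y * t) * F (Z y) * ((Z y + u) ^ (-(α : ℂ)) * (Real.Gamma α : ℂ)) := by
    intro y
    rw [← integral_rpow_mul_cexp_neg_mul_Ioi hα (r := Z y + u) (by simpa [hZ] using hu),
      ← integral_const_mul]
    refine setIntegral_congr_fun measurableSet_Ioi fun s _ => ?_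
    simp only [hQ, temperedKer]
    have e1 : Complex.exp (Z y * ((t - s : ℝ) : ℂ)) * Complex.exp (-(s : ℂ) * u) =
        Complex.exp (Z y * t) * Complex.exp (-((Z y + u) * s)) := by
      rw [← Complex.exp_add, ← Complex.exp_add]
      congr 1; push_cast; ring
    linear_combination (((s ^ (α - 1) : ℝ) : ℂ) * F (Z y)) * e1
  rw [h1, h2, integral_integral_swap hQint]
  simp_rw [h3]
  unfold verticalInv
  rw [← mul_assoc, mul_comm (1 / (Real.Gamma α : ℂ)), mul_assoc]
  congr 1
  rw [← integral_const_mul]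
  congr 1
  ext y
  simp only [hZ]
  field_simp

open MeasureTheory in
open scoped FourierTransform in
/-- The inverse Laplace integral of `z ^ (-2)` is `t`. -/
theorem verticalInv_inv_sq {σ : ℝ} (hσ : 0 < σ) {t : ℝ} (ht : 0 ≤ t) :
    verticalInv (fun z => (z ^ 2)⁻¹) σ t = t := by
  -- Fourier inversion for `max x 0 * exp (-σ x)`, whose transform is the Gamma integral with
  -- exponent `2`.
  set f : ℝ → ℂ := fun x => ((max x 0 * Real.exp (-(σ * x)) : ℝ) : ℂ) with hf
  have hfc : Continuous f := by fun_prop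
  have hfi0 : IntegrableOn (fun x : ℝ => x ^ ((2:ℝ) - 1) * Real.exp (-(σ * x))) (Ioi 0) :=
    integrableOn_rpow_mul_exp_neg two_pos hσ
  have hfind : f = (Ioi (0:ℝ)).indicator f := by
    ext x
    by_cases hx : x ∈ Ioi (0:ℝ)
    · rw [indicator_of_mem hx]
    · rw [indicator_of_notMem hx]
      simp only [hf]
      rw [max_eq_right (not_lt.mp hx)]; simp
  have hfon : ∀ x ∈ Ioi (0:ℝ), f x = ((x ^ ((2:ℝ) - 1) * Real.exp (-(σ * x)) : ℝ) : ℂ) := by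
    intro x hx
    simp only [hf]
    rw [max_eq_left (le_of_lt hx)]
    norm_num
  have hfi : Integrable f := by
    rw [hfind, integrable_indicator_iff measurableSet_Ioi]
    exact IntegrableOn.congr_fun (hfi0.ofReal (𝕜 := ℂ)) (fun x hx => (hfon x hx).symm)
      measurableSet_Ioi
  have hFf : ∀ ξ : ℝ, 𝓕 f ξ = (((σ : ℂ) + (2 * π * ξ : ℝ) * Complex.I) ^ 2)⁻¹ := by
    intro ξ
    rw [Real.fourier_eq']
    have h1 : (fun v : ℝ => Complex.exp (((-2 * π * inner ℝ v ξ : ℝ) : ℂ) * Complex.I) • f v) =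
        (Ioi (0:ℝ)).indicator
          (fun v : ℝ => Complex.exp (((-2 * π * inner ℝ v ξ : ℝ) : ℂ) * Complex.I) • f v) := by
      ext x
      by_cases hx : x ∈ Ioi (0:ℝ)
      · rw [indicator_of_mem hx]
      · rw [indicator_of_notMem hx, hfind, indicator_of_notMem hx, smul_zero]
    rw [h1, integral_indicator measurableSet_Ioi]
    have h2 := integral_rpow_mul_cexp_neg_mul_Ioi two_pos
      (r := (σ : ℂ) + (2 * π * ξ : ℝ) * Complex.I) (by simpa using hσ)
    rw [Real.Gamma_two, Complex.ofReal_one, mul_one] at h2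
    have h3 : ((σ : ℂ) + (2 * π * ξ : ℝ) * Complex.I) ^ (-((2:ℝ) : ℂ)) =
        (((σ : ℂ) + (2 * π * ξ : ℝ) * Complex.I) ^ 2)⁻¹ := by
      rw [Complex.cpow_neg]
      congr 1
      rw [Complex.ofReal_ofNat]
      exact Complex.cpow_ofNat _ 2
    rw [← h3, ← h2]
    refine setIntegral_congr_fun measurableSet_Ioi fun x hx => ?_
    simp only [smul_eq_mul]
    rw [hfon x hx, Complex.ofReal_mul (x ^ _), mul_left_comm, Complex.ofReal_exp, ← Complex.exp_add]
    congr 2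
    simp only [RCLike.inner_apply, conj_trivial]
    push_cast
    ring
  have hq : QuadDecay 0 1 (fun z : ℂ => (z ^ 2)⁻¹) := by
    refine ⟨fun z hz => ?_, fun z _ => by simp⟩
    have : z ≠ 0 := by rintro rfl; simp at hz
    exact (DifferentiableAt.inv (𝕜 := ℂ) (h := fun z : ℂ => z ^ 2) (by fun_prop)
      (pow_ne_zero 2 this)).differentiableWithinAt
  have hline : Integrable fun y : ℝ => (((σ : ℂ) + y * Complex.I) ^ 2)⁻¹ := by
    refine Integrable.mono' (integrable_inv_one_add_sq.const_mul (1 + (σ ^ 2)⁻¹))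
      (hq.continuous_line hσ).aestronglyMeasurable (Eventually.of_forall fun y => ?_)
    rw [norm_inv, norm_pow, QuadDecay.norm_sq]
    rw [inv_le_iff_one_le_mul₀ (by positivity), mul_assoc, mul_comm, mul_assoc,
      ← div_eq_inv_mul, le_div_iff₀ (by positivity)]
    have : (σ ^ 2 + y ^ 2) * (1 + (σ ^ 2)⁻¹) = σ ^ 2 + y ^ 2 + 1 + y ^ 2 * (σ ^ 2)⁻¹ := by
      field_simp; ring
    rw [this]
    have : 0 ≤ y ^ 2 * (σ ^ 2)⁻¹ := by positivity
    nlinarith [sq_nonneg σ]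
  have hFi : Integrable (𝓕 f) := by
    have := hline.comp_mul_left' (R := 2 * π) (by positivity)
    refine this.congr (Eventually.of_forall fun ξ => ?_)
    rw [hFf]
  have hinv := congrFun (hfc.fourierInv_fourier_eq hfi hFi) t
  rw [Real.fourierInv_eq'] at hinv
  have h4 : ∫ v : ℝ, Complex.exp (((2 * π * inner ℝ v t : ℝ) : ℂ) * Complex.I) • 𝓕 f v =
      (1 / (2 * π) : ℂ) * ∫ y : ℝ, Complex.exp ((y : ℂ) * t * Complex.I) *
        (((σ : ℂ) + y * Complex.I) ^ 2)⁻¹ := by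
    have := MeasureTheory.Measure.integral_comp_mul_left
      (fun y : ℝ => Complex.exp ((y : ℂ) * t * Complex.I) *
        (((σ : ℂ) + y * Complex.I) ^ 2)⁻¹) (2 * π)
    rw [abs_of_pos (by positivity)] at this
    rw [show (1 / (2 * π) : ℂ) = (((2 * π)⁻¹ : ℝ) : ℂ) by push_cast; rw [one_div],
      ← Complex.real_smul, ← this]
    congr 1
    ext v
    rw [hFf, smul_eq_mul]
    congr 2
    simp only [RCLike.inner_apply, conj_trivial]
    push_cast
    ring
  rw [h4] at hinv
  unfold verticalInv
  have h5 : ∫ y : ℝ, Complex.exp ((σ + y * Complex.I) * t) * ((σ + y * Complex.I : ℂ) ^ 2)⁻¹ =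
      Complex.exp (σ * t) * ∫ y : ℝ, Complex.exp ((y : ℂ) * t * Complex.I) *
        (((σ : ℂ) + y * Complex.I) ^ 2)⁻¹ := by
    rw [← integral_const_mul]
    congr 1
    ext y
    rw [← mul_assoc, ← Complex.exp_add]
    congr 2
    ring
  rw [h5, mul_left_comm, hinv]
  simp only [hf]
  rw [max_eq_left ht]
  push_cast
  rw [mul_left_comm, ← Complex.exp_add]
  simp

open MeasureTheory in
theorem intervalIntegrable_temperedKer_mul {α : ℝ} (hα : 0 < α) (u : ℂ) {g : ℝ → ℂ} {T t : ℝ}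
    (hg : ContinuousOn g (Icc 0 T)) (ht : t ∈ Icc 0 T) :
    IntervalIntegrable (fun s => temperedKer α u s * g (t - s)) volume 0 t := by
  have hk := integrableOn_temperedKer hα u t
  obtain ⟨B, hB⟩ := isCompact_Icc.exists_bound_of_continuousOn hg
  have hmaps : ∀ s ∈ Ioc 0 t, t - s ∈ Icc 0 T := fun s hs => ⟨by linarith [hs.2], by linarith [hs.1, ht.2]⟩
  rw [intervalIntegrable_iff_integrableOn_Ioc_of_le ht.1]
  refine Integrable.mul_bdd (c := B) hk ?_ ?_
  · refine ContinuousOn.aestronglyMeasurable ?_ measurableSet_Ioc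
    exact hg.comp (by fun_prop) hmaps
  · filter_upwards [ae_restrict_mem measurableSet_Ioc] with s hs
    exact hB _ (hmaps s hs)

theorem temperedInt_sub {α : ℝ} (hα : 0 < α) (u : ℂ) {g₁ g₂ : ℝ → ℂ} {T t : ℝ}
    (h₁ : ContinuousOn g₁ (Icc 0 T)) (h₂ : ContinuousOn g₂ (Icc 0 T)) (ht : t ∈ Icc 0 T) :
    temperedInt α u (fun s => g₁ s - g₂ s) t = temperedInt α u g₁ t - temperedInt α u g₂ t := by
  rw [temperedInt_eq, temperedInt_eq, temperedInt_eq, ← mul_sub,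
    ← intervalIntegral.integral_sub (intervalIntegrable_temperedKer_mul hα u h₁ ht)
      (intervalIntegrable_temperedKer_mul hα u h₂ ht)]
  simp_rw [mul_sub]

open MeasureTheory in
/-- Exponentially weighted bound for tempered integrals. -/
theorem norm_temperedInt_le {α : ℝ} (hα : 0 < α) {u : ℂ} {c m : ℝ} (hc : 0 < c + u.re)
    (hm : 0 ≤ m) {g : ℝ → ℂ} {t : ℝ} (ht : 0 ≤ t)
    (hg : ∀ s ∈ Icc 0 t, ‖g s‖ ≤ m * Real.exp (c * s)) :
    ‖temperedInt α u g t‖ ≤ m * (1 / (c + u.re)) ^ α * Real.exp (c * t) := by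
  have hΓ := Real.Gamma_pos_of_pos hα
  rw [temperedInt_eq, norm_mul, intervalIntegral.integral_of_le ht]
  have hI := integrableOn_temperedKer_mul_exp hα hc
  have h1 : ‖∫ s in Ioc 0 t, temperedKer α u s * g (t - s)‖ ≤
      ∫ s in Ioc 0 t, m * Real.exp (c * t) * (Real.exp (-(c * s)) * ‖temperedKer α u s‖) := by
    refine norm_integral_le_of_norm_le ((hI.mono_set Ioc_subset_Ioi_self).const_mul _) ?_
    filter_upwards [ae_restrict_mem measurableSet_Ioc] with s hs
    rw [norm_mul]
    have h2 := hg (t - s) ⟨by linarith [hs.2], by linarith [hs.1]⟩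
    have h3 : Real.exp (c * (t - s)) = Real.exp (c * t) * Real.exp (-(c * s)) := by
      rw [← Real.exp_add]; ring_nf
    rw [h3] at h2
    calc ‖temperedKer α u s‖ * ‖g (t - s)‖ ≤
          ‖temperedKer α u s‖ * (m * (Real.exp (c * t) * Real.exp (-(c * s)))) := by gcongr
      _ = _ := by ring
  have h4 : ∫ s in Ioc 0 t, Real.exp (-(c * s)) * ‖temperedKer α u s‖ ≤
      (1 / (c + u.re)) ^ α * Real.Gamma α := by
    rw [← Real.integral_rpow_mul_exp_neg_mul_Ioi hα hc]
    calc _ ≤ ∫ s in Ioi 0, Real.exp (-(c * s)) * ‖temperedKer α u s‖ :=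
          setIntegral_mono_set hI (Eventually.of_forall fun s => by positivity)
            (Eventually.of_forall Ioc_subset_Ioi_self)
      _ = _ := by
        refine setIntegral_congr_fun measurableSet_Ioi fun s hs => ?_
        rw [norm_temperedKer hs, mul_left_comm, ← Real.exp_add]
        ring_nf
  rw [integral_const_mul] at h1
  have h5 : ‖(1 / (Real.Gamma α : ℂ))‖ = 1 / Real.Gamma α := by
    rw [norm_div, norm_one, Complex.norm_real, Real.norm_of_nonneg hΓ.le]
  rw [h5]
  calc 1 / Real.Gamma α * _ ≤
        1 / Real.Gamma α * (m * Real.exp (c * t) * ((1 / (c + u.re)) ^ α * Real.Gamma α)) := by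
        gcongr
        exact h1.trans (by gcongr)
    _ = _ := by field_simp

open MeasureTheory in
/-- Tempered integration commutes with ordinary integration. -/
theorem temperedInt_integral {α : ℝ} (hα : 0 < α) (u : ℂ) {g : ℝ → ℂ} {T t : ℝ}
    (hg : ContinuousOn g (Icc 0 T)) (ht : t ∈ Icc 0 T) :
    temperedInt α u (fun x => ∫ τ in (0:ℝ)..x, g τ) t =
      ∫ x in (0:ℝ)..t, temperedInt α u g x := by
  -- Extension by zero frees the inner domain from the outer variable, so that Fubini is applied on
  -- a square.
  set gz : ℝ → ℂ := (Ioc 0 T).indicator g with hgz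
  obtain ⟨B, hB⟩ := isCompact_Icc.exists_bound_of_continuousOn hg
  have hgzm : Measurable gz := by
    have h1 : Continuous (IccExtend (ht.1.trans ht.2) ((Icc 0 T).domRestrict g)) :=
      hg.domRestrict.Icc_extend'
    have h2 : gz = (Ioc 0 T).indicator (IccExtend (ht.1.trans ht.2) ((Icc 0 T).domRestrict g)) := by
      refine indicator_congr fun x hx => ?_
      rw [IccExtend_of_mem _ _ (Ioc_subset_Icc_self hx)]
      rfl
    rw [h2]
    exact h1.measurable.indicator measurableSet_Ioc
  have hgzB : ∀ x, ‖gz x‖ ≤ |B| := by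
    intro x
    by_cases hx : x ∈ Ioc 0 T
    · rw [hgz, indicator_of_mem hx]
      exact (hB x (Ioc_subset_Icc_self hx)).trans (le_abs_self B)
    · rw [hgz, indicator_of_notMem hx, norm_zero]; positivity
  set Q : ℝ → ℝ → ℂ := fun x s => temperedKer α u s * gz (x - s) with hQ
  have hk := integrableOn_temperedKer hα u t
  have hone : IntegrableOn (fun _ : ℝ => (1 : ℂ)) (Ioc 0 t) := by
    simp
  have hQint : Integrable (Function.uncurry Q)
      ((volume.restrict (Ioc 0 t)).prod (volume.restrict (Ioc 0 t))) := by
    have h1 : Integrable (fun p : ℝ × ℝ => (1 : ℂ) * temperedKer α u p.2)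
      ((volume.restrict (Ioc 0 t)).prod (volume.restrict (Ioc 0 t))) := hone.mul_prod hk
    simp only [one_mul] at h1
    refine h1.mul_bdd (c := |B|) ?_ (Eventually.of_forall fun p => hgzB _)
    exact (hgzm.comp (measurable_fst.sub measurable_snd)).aestronglyMeasurable
  rw [temperedInt_eq]
  have hR : ∫ x in (0:ℝ)..t, temperedInt α u g x =
      (1 / (Real.Gamma α : ℂ)) * ∫ x in Ioc 0 t, ∫ s in Ioc 0 t, Q x s := by
    rw [intervalIntegral.integral_of_le ht.1, ← integral_const_mul]
    refine setIntegral_congr_fun measurableSet_Ioc fun x hx => ?_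
    rw [temperedInt_eq, intervalIntegral.integral_of_le hx.1.le, integral_Ioc_eq_integral_Ioo]
    congr 1
    -- The extension vanishes at `0`, so the endpoint `s = x` has to be left out.
    have h1 : ∫ s in Ioc 0 t, Q x s = ∫ s in Ioo 0 x, Q x s := by
      refine setIntegral_eq_of_subset_of_forall_sdiff_eq_zero measurableSet_Ioc
        (fun s hs => ⟨hs.1, hs.2.le.trans hx.2⟩) fun s hs => ?_
      have h2 : ¬ s < x := fun h => hs.2 ⟨hs.1.1, h⟩
      have h3 : x - s ∉ Ioc 0 T := fun h => h2 (by linarith [h.1])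
      simp only [hQ]
      rw [hgz, indicator_of_notMem h3, mul_zero]
    rw [h1]
    refine setIntegral_congr_fun measurableSet_Ioo fun s hs => ?_
    simp only [hQ]
    rw [hgz, indicator_of_mem]
    exact ⟨by linarith [hs.2], by linarith [hs.1, hx.2, ht.2]⟩
  rw [hR, integral_integral_swap hQint, intervalIntegral.integral_of_le ht.1]
  congr 1
  refine setIntegral_congr_fun measurableSet_Ioc fun s hs => ?_
  simp only [hQ]
  rw [integral_const_mul, ← intervalIntegral.integral_of_le ht.1,
    intervalIntegral.integral_comp_sub_right (fun x => gz x) s]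
  congr 1
  have hgzI : ∀ a b, IntervalIntegrable gz volume a b := by
    intro a b
    have hc : IntervalIntegrable (fun _ : ℝ => |B|) volume a b := by simp
    exact hc.mono_fun hgzm.aestronglyMeasurable
      (Eventually.of_forall fun x => (hgzB x).trans (le_abs_self _))
  rw [← intervalIntegral.integral_add_adjacent_intervals (hgzI (0 - s) 0) (hgzI 0 (t - s))]
  have h0 : ∫ x in (0 - s)..0, gz x = 0 := by
    rw [intervalIntegral.integral_of_le (by linarith [hs.1])]
    refine setIntegral_eq_zero_of_forall_eq_zero fun x hx => ?_
    rw [hgz, indicator_of_notMem]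
    exact fun h => absurd h.1 (not_lt.mpr hx.2)
  rw [h0, zero_add]
  refine intervalIntegral.integral_congr_ae (Eventually.of_forall fun x hx => ?_)
  rw [uIoc_of_le (by linarith [hs.2])] at hx
  rw [hgz, indicator_of_mem]
  exact ⟨hx.1, by linarith [hx.2, hs.1, ht.2]⟩

open MeasureTheory in
/-- Tempered integrals of continuous functions vanish continuously at the origin. -/
theorem continuousWithinAt_temperedInt_zero {α : ℝ} (hα : 0 < α) (u : ℂ) {g : ℝ → ℂ} {T : ℝ}
    (hg : ContinuousOn g (Icc 0 T)) : ContinuousWithinAt (temperedInt α u g) (Icc 0 T) 0 := by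
  obtain ⟨B, hB⟩ := isCompact_Icc.exists_bound_of_continuousOn hg
  have hz : temperedInt α u g 0 = 0 := by simp [temperedInt]
  unfold ContinuousWithinAt
  rw [hz]
  have hΓ := Real.Gamma_pos_of_pos hα
  have hIntg : ∀ a b : ℝ, 0 ≤ a → 0 ≤ b →
      IntervalIntegrable (fun s => ‖temperedKer α u s‖) volume a b := by
    have : ∀ b : ℝ, 0 ≤ b → IntervalIntegrable (fun s => ‖temperedKer α u s‖) volume 0 b := by
      intro b hb
      rw [intervalIntegrable_iff_integrableOn_Ioc_of_le hb]
      exact (integrableOn_temperedKer hα u b).norm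
    exact fun a b ha hb => (this a ha).symm.trans (this b hb)
  have hcont : ContinuousWithinAt (fun t => ∫ s in (0:ℝ)..t, ‖temperedKer α u s‖) (Icc 0 1) 0 := by
    have := intervalIntegral.continuousOn_primitive_interval (μ := volume) (a := 0) (b := 1)
      (f := fun s => ‖temperedKer α u s‖) ?_
    · rw [uIcc_of_le zero_le_one] at this
      exact this 0 (by simp)
    · rw [uIcc_of_le zero_le_one, integrableOn_Icc_iff_integrableOn_Ioc]
      exact (integrableOn_temperedKer hα u 1).norm
  have hlim : Tendsto (fun t => 1 / Real.Gamma α * (|B| * ∫ s in (0:ℝ)..t, ‖temperedKer α u s‖))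
      (nhdsWithin 0 (Icc 0 T)) (nhds 0) := by
    have h1 : Tendsto (fun t => ∫ s in (0:ℝ)..t, ‖temperedKer α u s‖)
        (nhdsWithin 0 (Ici 0)) (nhds 0) := by
      have := hcont
      unfold ContinuousWithinAt at this
      simp only [intervalIntegral.integral_same] at this
      rwa [nhdsWithin_Icc_eq_nhdsGE zero_lt_one] at this
    have h2 := h1.mono_left (nhdsWithin_mono 0 (Icc_subset_Ici_self : Icc 0 T ⊆ Ici 0))
    simpa using (h2.const_mul |B|).const_mul (1 / Real.Gamma α)
  refine squeeze_zero_norm' ?_ hlim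
  filter_upwards [self_mem_nhdsWithin] with t ht
  rw [temperedInt_eq, norm_mul, norm_div, norm_one, Complex.norm_real,
    Real.norm_of_nonneg hΓ.le]
  gcongr
  rw [← intervalIntegral.integral_const_mul]
  refine intervalIntegral.norm_integral_le_of_norm_le ht.1 (Eventually.of_forall fun s hs => ?_)
    ((hIntg 0 t le_rfl ht.1).const_mul _)
  rw [norm_mul, mul_comm]
  gcongr
  exact (hB _ ⟨by linarith [hs.2], by linarith [hs.1, ht.2]⟩).trans (le_abs_self B)

/-! ### The time-integrated system and uniqueness. -/

namespace FeynmanKac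

variable {M : FeynmanKac}

/-- The signs with which the flux enters the two equations. -/
def sgn : Fin 2 → ℂ := ![1, -1]

/-- The time-integrated flux between the two states. -/
noncomputable def flux (M : FeynmanKac) (X : Fin 2 → ℝ → ℂ) (t : ℝ) : ℂ :=
  M.C 0 * (M.fracInt 0 (X 0) t + M.ρ * M.U 0 * ∫ s in (0:ℝ)..t, M.fracInt 0 (X 0) s) -
    M.C 1 * (M.fracInt 1 (X 1) t + M.ρ * M.U 1 * ∫ s in (0:ℝ)..t, M.fracInt 1 (X 1) s)

theorem norm_integral_le_exp {c m : ℝ} (hc : 0 < c) (hm : 0 ≤ m) {g : ℝ → ℂ} {t : ℝ} (ht : 0 ≤ t)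
    (hg : ∀ s ∈ Icc 0 t, ‖g s‖ ≤ m * Real.exp (c * s)) :
    ‖∫ s in (0:ℝ)..t, g s‖ ≤ m * (1 / c) * Real.exp (c * t) := by
  have := norm_temperedInt_le (α := 1) one_pos (u := 0) (c := c) (by simpa using hc) hm ht hg
  rw [temperedInt_one_zero] at this
  simpa using this

/-- The homogeneous Volterra system has only the trivial solution. -/
theorem volterra_unique {T : ℝ} {X : Fin 2 → ℝ → ℂ} (hX : ∀ j, ContinuousOn (X j) (Icc 0 T))
    (hE : ∀ j, ∀ t ∈ Icc 0 T,
      X j t + M.ρ * M.U j * ∫ s in (0:ℝ)..t, X j s = sgn j * M.flux X t) :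
    ∀ j, ∀ t ∈ Icc 0 T, X j t = 0 := by
  rcases lt_or_ge T 0 with hT | hT
  · intro j t ht; linarith [ht.1, ht.2]
  set u : Fin 2 → ℂ := fun j => M.ρ * M.U j with hu
  -- The contraction constant in the norm weighted by `exp (-c t)`. Every term contains an integral
  -- of positive order, so it vanishes as `c → ∞`.
  set K : ℝ → ℝ := fun c => (‖u 0‖ + ‖u 1‖) * (1 / c) +
    2 * (|M.C 0| * ((1 / (c + (u 0).re)) ^ M.α 0 * (1 + ‖u 0‖ * (1 / c))) +
      |M.C 1| * ((1 / (c + (u 1).re)) ^ M.α 1 * (1 + ‖u 1‖ * (1 / c)))) with hK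
  have hKlim : Tendsto K atTop (nhds 0) := by
    have h1 : Tendsto (fun c : ℝ => 1 / c) atTop (nhds 0) := by
      simpa using tendsto_inv_atTop_zero (𝕜 := ℝ)
    have h2 : ∀ j, Tendsto (fun c : ℝ => (1 / (c + (u j).re)) ^ M.α j) atTop (nhds 0) := by
      intro j
      have h3 : Tendsto (fun c : ℝ => 1 / (c + (u j).re)) atTop (nhds 0) :=
        h1.comp (tendsto_atTop_add_const_right _ _ tendsto_id)
      have := h3.rpow_const (p := M.α j) (Or.inr (M.α_mem j).1.le)
      rwa [Real.zero_rpow (M.α_mem j).1.ne'] at this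
    have h3 : ∀ j, Tendsto (fun c : ℝ => |M.C j| *
        ((1 / (c + (u j).re)) ^ M.α j * (1 + ‖u j‖ * (1 / c)))) atTop (nhds 0) := by
      intro j
      simpa using ((h2 j).mul ((h1.const_mul ‖u j‖).const_add 1)).const_mul |M.C j|
    simpa [hK] using (h1.const_mul (‖u 0‖ + ‖u 1‖)).add (((h3 0).add (h3 1)).const_mul 2)
  obtain ⟨c, hc0, hcu, hcK⟩ : ∃ c : ℝ, 0 < c ∧ (∀ j, 0 < c + (u j).re) ∧ K c < 1 / 2 := by
    have h1 := hKlim.eventually (gt_mem_nhds (show (0:ℝ) < 1 / 2 by norm_num))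
    have h2 : ∀ j, ∀ᶠ c : ℝ in atTop, 0 < c + (u j).re := fun j =>
      (tendsto_atTop_add_const_right _ _ tendsto_id).eventually (eventually_gt_atTop 0)
    obtain ⟨c, h3, h4, h5⟩ := ((eventually_gt_atTop (0:ℝ)).and
      ((eventually_all.mpr h2).and h1)).exists
    exact ⟨c, h3, h4, h5⟩
  have hcont : ContinuousOn (fun t => (‖X 0 t‖ + ‖X 1 t‖) * Real.exp (-(c * t))) (Icc 0 T) :=
    ((hX 0).norm.add (hX 1).norm).mul (by fun_prop)
  -- At a maximum point the weighted norm is at most `K c < 1 / 2` times itself, hence zero.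
  obtain ⟨t₀, ht₀, hmax⟩ := isCompact_Icc.exists_isMaxOn (nonempty_Icc.mpr hT) hcont
  set m := (‖X 0 t₀‖ + ‖X 1 t₀‖) * Real.exp (-(c * t₀)) with hm
  have hm0 : 0 ≤ m := by positivity
  have hsum : ∀ s ∈ Icc 0 T, ‖X 0 s‖ + ‖X 1 s‖ ≤ m * Real.exp (c * s) := by
    intro s hs
    have h1 : (‖X 0 s‖ + ‖X 1 s‖) * Real.exp (-(c * s)) ≤ m := hmax hs
    rw [Real.exp_neg, ← div_eq_mul_inv, div_le_iff₀ (Real.exp_pos _)] at h1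
    exact h1
  have hXb : ∀ j, ∀ s ∈ Icc 0 T, ‖X j s‖ ≤ m * Real.exp (c * s) := by
    intro j s hs
    have h1 := hsum s hs
    fin_cases j
    · simp only [Fin.zero_eta]; linarith [norm_nonneg (X 1 s)]
    · simp only [Fin.mk_one]; linarith [norm_nonneg (X 0 s)]
  have hsub : ∀ t ∈ Icc 0 T, ∀ s ∈ Icc 0 t, s ∈ Icc 0 T := fun t ht s hs =>
    ⟨hs.1, hs.2.trans ht.2⟩
  have hJ : ∀ j, ∀ t ∈ Icc 0 T, ‖M.fracInt j (X j) t‖ ≤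
      m * (1 / (c + (u j).re)) ^ M.α j * Real.exp (c * t) := by
    intro j t ht
    rw [fracInt_eq]
    exact norm_temperedInt_le (M.α_mem j).1 (hcu j) hm0 ht.1
      fun s hs => hXb j s (hsub t ht s hs)
  have hJI : ∀ j, ∀ t ∈ Icc 0 T, ‖∫ s in (0:ℝ)..t, M.fracInt j (X j) s‖ ≤
      m * (1 / (c + (u j).re)) ^ M.α j * (1 / c) * Real.exp (c * t) := by
    intro j t ht
    have : 0 ≤ 1 / (c + (u j).re) := by have := hcu j; positivity
    exact norm_integral_le_exp hc0 (by positivity) ht.1 fun s hs => hJ j s (hsub t ht s hs)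
  have hXI : ∀ j, ∀ t ∈ Icc 0 T, ‖∫ s in (0:ℝ)..t, X j s‖ ≤ m * (1 / c) * Real.exp (c * t) :=
    fun j t ht => norm_integral_le_exp hc0 hm0 ht.1 fun s hs => hXb j s (hsub t ht s hs)
  have hpart : ∀ j, ∀ t ∈ Icc 0 T,
      ‖(M.C j : ℂ) * (M.fracInt j (X j) t + M.ρ * M.U j * ∫ s in (0:ℝ)..t, M.fracInt j (X j) s)‖ ≤
      |M.C j| * ((1 / (c + (u j).re)) ^ M.α j * (1 + ‖u j‖ * (1 / c))) * (m * Real.exp (c * t)) := by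
    intro j t ht
    rw [norm_mul, Complex.norm_real, Real.norm_eq_abs, mul_assoc |M.C j|]
    refine mul_le_mul_of_nonneg_left ?_ (abs_nonneg _)
    refine (norm_add_le _ _).trans ?_
    rw [norm_mul]
    have h1 := hJ j t ht
    have h2 := mul_le_mul_of_nonneg_left (hJI j t ht) (norm_nonneg (u j))
    have e : (1 / (c + (u j).re)) ^ M.α j * (1 + ‖u j‖ * (1 / c)) * (m * Real.exp (c * t)) =
      m * (1 / (c + (u j).re)) ^ M.α j * Real.exp (c * t) +
        ‖u j‖ * (m * (1 / (c + (u j).re)) ^ M.α j * (1 / c) * Real.exp (c * t)) := by ring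
    rw [e]
    exact add_le_add h1 h2
  have hflux : ∀ t ∈ Icc 0 T, ‖M.flux X t‖ ≤
      (|M.C 0| * ((1 / (c + (u 0).re)) ^ M.α 0 * (1 + ‖u 0‖ * (1 / c))) +
      |M.C 1| * ((1 / (c + (u 1).re)) ^ M.α 1 * (1 + ‖u 1‖ * (1 / c)))) *
        (m * Real.exp (c * t)) := by
    intro t ht
    unfold flux
    refine (norm_sub_le _ _).trans ?_
    rw [add_mul]
    exact add_le_add (hpart 0 t ht) (hpart 1 t ht)
  have hXj : ∀ j, ∀ t ∈ Icc 0 T, ‖X j t‖ ≤ ‖u j‖ * (1 / c) * (m * Real.exp (c * t)) +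
      ‖M.flux X t‖ := by
    intro j t ht
    have h1 : X j t = sgn j * M.flux X t - u j * ∫ s in (0:ℝ)..t, X j s := by
      rw [← hE j t ht]; ring
    have h2 : ‖sgn j‖ = 1 := by fin_cases j <;> simp [sgn]
    rw [h1]
    refine (norm_sub_le _ _).trans ?_
    rw [norm_mul, norm_mul, h2, one_mul, add_comm]
    have h3 := mul_le_mul_of_nonneg_left (hXI j t ht) (norm_nonneg (u j))
    have e : ‖u j‖ * (1 / c) * (m * Real.exp (c * t)) =
      ‖u j‖ * (m * (1 / c) * Real.exp (c * t)) := by ring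
    rw [e]
    gcongr
  have hfin : ‖X 0 t₀‖ + ‖X 1 t₀‖ ≤ K c * (m * Real.exp (c * t₀)) := by
    have h0 := hXj 0 t₀ ht₀
    have h1 := hXj 1 t₀ ht₀
    have h2 := hflux t₀ ht₀
    simp only [hK]
    nlinarith
  have hm_eq : ‖X 0 t₀‖ + ‖X 1 t₀‖ = m * Real.exp (c * t₀) := by
    rw [hm, mul_assoc, ← Real.exp_add]; simp
  have hmz : m = 0 := by
    rw [hm_eq] at hfin
    have hpos := Real.exp_pos (c * t₀)
    by_contra hne
    have : 0 < m * Real.exp (c * t₀) := mul_pos (lt_of_le_of_ne hm0 (Ne.symm hne)) hpos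
    nlinarith
  intro j t ht
  have := hXb j t ht
  rw [hmz, zero_mul] at this
  exact norm_le_zero_iff.mp this

/-- Adding the two equations shows that the transports are opposite. Substituting this in the first
leaves a multiple `1 - p - b`, nonzero by assumption, of one transport; this is where the weights
`m` come from. -/
theorem IsSolution.transport_eq {T : ℝ} {G₀ : Fin 2 → ℂ} {G : Fin 2 → ℝ → ℂ}
    (hG : M.IsSolution T G₀ G) (j : Fin 2) {t : ℝ} (ht : t ∈ Ioc 0 T) :
    M.transport T j (G j) t = sgn j * (M.C 0 * M.substDeriv T 0 (G 0) t -
      M.C 1 * M.substDeriv T 1 (G 1) t) := by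
  have h1 := hG.equation₁ t ht
  have h2 := hG.equation₂ t ht
  have hq : (1 - M.p - M.b : ℂ) ≠ 0 := by
    intro h
    apply M.p_add_b_ne
    have : (1 - M.p - M.b : ℝ) = 0 := by exact_mod_cast h
    linarith
  have hB0 : (M.B 0 : ℂ) ≠ 0 := by exact_mod_cast (M.B_pos 0).ne'
  have hB1 : (M.B 1 : ℂ) ≠ 0 := by exact_mod_cast (M.B_pos 1).ne'
  have hC0 : (M.C 0 : ℂ) * (1 - M.p - M.b) = (1 - M.p) * (M.B 0 : ℂ)⁻¹ := by
    simp only [C, m, Matrix.cons_val_zero]; push_cast; field_simp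
  have hC1 : (M.C 1 : ℂ) * (1 - M.p - M.b) = (1 - M.b) * (M.B 1 : ℂ)⁻¹ := by
    simp only [C, m, Matrix.cons_val_one, Matrix.cons_val_zero]; push_cast; field_simp
  have hsum : M.transport T 0 (G 0) t + M.transport T 1 (G 1) t = 0 := by
    linear_combination h1 + h2
  have h0 : M.transport T 0 (G 0) t = M.C 0 * M.substDeriv T 0 (G 0) t -
      M.C 1 * M.substDeriv T 1 (G 1) t := by
    apply mul_left_cancel₀ hq
    linear_combination -h1 + (1 - M.b : ℂ) * hsum - M.substDeriv T 0 (G 0) t * hC0 +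
      M.substDeriv T 1 (G 1) t * hC1
  fin_cases j
  · simpa [sgn] using h0
  · simp only [sgn, Fin.mk_one, Matrix.cons_val_one, Matrix.cons_val_zero]
    linear_combination hsum - h0

/-- Differentiability gives continuity for `t > 0` only; at the origin the integral is small because
its domain is. -/
theorem IsSolution.continuousOn_fracInt {T : ℝ} {G₀ : Fin 2 → ℂ} {G : Fin 2 → ℝ → ℂ}
    (hG : M.IsSolution T G₀ G) (j : Fin 2) : ContinuousOn (M.fracInt j (G j)) (Icc 0 T) := by
  intro t ht
  rcases eq_or_lt_of_le ht.1 with h0 | h0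
  · rw [← h0]
    exact continuousWithinAt_temperedInt_zero (M.α_mem j).1 _ (hG.continuousOn j)
  · exact (hG.differentiable_fracInt j t ⟨h0, ht.2⟩).continuousWithinAt

theorem continuousOn_integral {T : ℝ} (hT : 0 ≤ T) {g : ℝ → ℂ} (hg : ContinuousOn g (Icc 0 T)) :
    ContinuousOn (fun t => ∫ s in (0:ℝ)..t, g s) (Icc 0 T) := by
  have := intervalIntegral.continuousOn_primitive_interval (μ := MeasureTheory.volume) (a := 0)
    (b := T) (f := g) (by rw [uIcc_of_le hT]; exact hg.integrableOn_Icc)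
  rwa [uIcc_of_le hT] at this

theorem hasDerivAt_integral {T : ℝ} {g : ℝ → ℂ} (hg : ContinuousOn g (Icc 0 T)) {t : ℝ}
    (ht : t ∈ Ioo 0 T) : HasDerivAt (fun t => ∫ s in (0:ℝ)..t, g s) (g t) t := by
  have hI : IntervalIntegrable g MeasureTheory.volume 0 t :=
    (hg.mono (by rw [uIcc_of_le ht.1.le]; exact Icc_subset_Icc le_rfl ht.2.le)).intervalIntegrable
  refine intervalIntegral.integral_hasDerivAt_right hI ?_
    (hg.continuousAt (Icc_mem_nhds ht.1 ht.2))
  exact (hg.mono Ioo_subset_Icc_self).stronglyMeasurableAtFilter isOpen_Ioo t ht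

/-- The time-integrated system. -/
theorem IsSolution.integrated {T : ℝ} {G₀ : Fin 2 → ℂ} {G : Fin 2 → ℝ → ℂ}
    (hG : M.IsSolution T G₀ G) (j : Fin 2) {t : ℝ} (ht : t ∈ Icc 0 T) :
    G j t + M.ρ * M.U j * ∫ s in (0:ℝ)..t, G j s = G₀ j + sgn j * M.flux G t := by
  have hT : 0 ≤ T := ht.1.trans ht.2
  set D : ℝ → ℂ := fun t => G j t + M.ρ * M.U j * (∫ s in (0:ℝ)..t, G j s) -
    sgn j * M.flux G t with hD
  have hDc : ContinuousOn D (Icc 0 T) := by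
    have hJ := hG.continuousOn_fracInt
    have hJI := fun i => continuousOn_integral hT (hJ i)
    have hGI := continuousOn_integral hT (hG.continuousOn j)
    refine ((hG.continuousOn j).add (continuousOn_const.mul hGI)).sub
      (continuousOn_const.mul ?_)
    exact (continuousOn_const.mul ((hJ 0).add (continuousOn_const.mul (hJI 0)))).sub
      (continuousOn_const.mul ((hJ 1).add (continuousOn_const.mul (hJI 1))))
  have hDd : ∀ x ∈ Ioo 0 T, HasDerivAt D 0 x := by
    intro x hx
    have hx' : x ∈ Ioc 0 T := ⟨hx.1, hx.2.le⟩
    have hmem := Icc_mem_nhds hx.1 hx.2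
    have hg1 : HasDerivAt (G j) (derivWithin (G j) (Icc 0 T) x) x :=
      (hG.differentiable j x hx').hasDerivWithinAt.hasDerivAt hmem
    have hg2 : ∀ i, HasDerivAt (M.fracInt i (G i)) (derivWithin (M.fracInt i (G i)) (Icc 0 T) x) x :=
      fun i => (hG.differentiable_fracInt i x hx').hasDerivWithinAt.hasDerivAt hmem
    have hg3 := hasDerivAt_integral (hG.continuousOn j) hx
    have hg4 := fun i => hasDerivAt_integral (hG.continuousOn_fracInt i) hx
    have := (hg1.add (hg3.const_mul (M.ρ * M.U j))).sub
      (((((hg2 0).add ((hg4 0).const_mul (M.ρ * M.U 0))).const_mul (M.C 0 : ℂ)).sub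
      (((hg2 1).add ((hg4 1).const_mul (M.ρ * M.U 1))).const_mul (M.C 1 : ℂ))).const_mul (sgn j))
    refine this.congr_deriv ?_
    have hkey := hG.transport_eq j hx'
    unfold substDeriv transport at hkey
    rw [hkey]; ring
  have hD0 : D 0 = G₀ j := by
    simp [hD, flux, fracInt, hG.initial]
  -- No derivative is available at `0`: `D` is constant on each `[s, T]`, and continuity then
  -- carries the value to the origin.
  have hconst : ∀ s ∈ Ioc 0 T, ∀ x ∈ Icc s T, D x = D s := by
    intro s hs
    refine constant_of_has_deriv_right_zero (hDc.mono (Icc_subset_Icc hs.1.le le_rfl)) ?_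
    intro x hx
    exact (hDd x ⟨hs.1.trans_le hx.1, hx.2⟩).hasDerivWithinAt
  have hfinal : D t = G₀ j := by
    rcases eq_or_lt_of_le ht.1 with h0 | h0
    · rw [← h0, hD0]
    · have h1 : Tendsto D (nhdsWithin 0 (Ioc 0 t)) (nhds (D 0)) :=
        (hDc 0 ⟨le_rfl, hT⟩).mono_left (nhdsWithin_mono 0 fun x hx =>
          ⟨hx.1.le, hx.2.trans ht.2⟩)
      have h2 : Tendsto D (nhdsWithin 0 (Ioc 0 t)) (nhds (D t)) := by
        refine tendsto_const_nhds.congr' ?_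
        filter_upwards [self_mem_nhdsWithin] with s hs
        exact hconst s ⟨hs.1, hs.2.trans ht.2⟩ t ⟨hs.2, ht.2⟩
      have : (nhdsWithin (0:ℝ) (Ioc 0 t)).NeBot := by
        rw [nhdsWithin_Ioc_eq_nhdsGT h0]; infer_instance
      rw [tendsto_nhds_unique h2 h1, hD0]
  rw [← hfinal]; simp only [hD]; ring

/-- The primitives of a solution satisfy the integrated system with linear data. -/
theorem IsSolution.volterra {T : ℝ} {G₀ : Fin 2 → ℂ} {G : Fin 2 → ℝ → ℂ}
    (hG : M.IsSolution T G₀ G) (j : Fin 2) {t : ℝ} (ht : t ∈ Icc 0 T) :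
    (∫ s in (0:ℝ)..t, G j s) + M.ρ * M.U j * ∫ x in (0:ℝ)..t, ∫ s in (0:ℝ)..x, G j s =
      t * G₀ j + sgn j * M.flux (fun i x => ∫ s in (0:ℝ)..x, G i s) t := by
  have hT : 0 ≤ T := ht.1.trans ht.2
  have ii : ∀ {g : ℝ → ℂ}, ContinuousOn g (Icc 0 T) →
      IntervalIntegrable g MeasureTheory.volume 0 t := fun hg =>
    (hg.mono (by rw [uIcc_of_le ht.1]; exact Icc_subset_Icc le_rfl ht.2)).intervalIntegrable
  have hJ := hG.continuousOn_fracInt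
  have hJI := fun i => continuousOn_integral hT (hJ i)
  have hc := hG.continuousOn j
  have hGI := continuousOn_integral hT hc
  -- Fractional and ordinary integration commute, so the primitive of the flux is the flux of the
  -- primitives.
  have hV : ∀ i, ∀ x ∈ Icc 0 T, M.fracInt i (fun x => ∫ s in (0:ℝ)..x, G i s) x =
      ∫ s in (0:ℝ)..x, M.fracInt i (G i) s := fun i x hx =>
    temperedInt_integral (M.α_mem i).1 _ (hG.continuousOn i) hx
  have hVI : ∀ i, ∫ x in (0:ℝ)..t, M.fracInt i (fun x => ∫ s in (0:ℝ)..x, G i s) x =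
      ∫ x in (0:ℝ)..t, ∫ s in (0:ℝ)..x, M.fracInt i (G i) s := by
    intro i
    refine intervalIntegral.integral_congr fun x hx => ?_
    rw [uIcc_of_le ht.1] at hx
    exact hV i x ⟨hx.1, hx.2.trans ht.2⟩
  have hint : ∫ x in (0:ℝ)..t, (G j x + M.ρ * M.U j * ∫ s in (0:ℝ)..x, G j s) =
      ∫ x in (0:ℝ)..t, (G₀ j + sgn j * M.flux G x) := by
    refine intervalIntegral.integral_congr fun x hx => ?_
    rw [uIcc_of_le ht.1] at hx
    exact hG.integrated j ⟨hx.1, hx.2.trans ht.2⟩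
  have hA : ∀ i, ContinuousOn (fun x => M.fracInt i (G i) x +
      M.ρ * M.U i * ∫ s in (0:ℝ)..x, M.fracInt i (G i) s) (Icc 0 T) := fun i =>
    (hJ i).add (continuousOn_const.mul (hJI i))
  have hAi : ∀ i, ∫ x in (0:ℝ)..t, (M.fracInt i (G i) x +
      M.ρ * M.U i * ∫ s in (0:ℝ)..x, M.fracInt i (G i) s) =
      (∫ x in (0:ℝ)..t, M.fracInt i (G i) x) +
        M.ρ * M.U i * ∫ x in (0:ℝ)..t, ∫ s in (0:ℝ)..x, M.fracInt i (G i) s := by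
    intro i
    rw [intervalIntegral.integral_add (ii (hJ i)) ((ii (hJI i)).const_mul _),
      intervalIntegral.integral_const_mul]
  have hflux : ∫ x in (0:ℝ)..t, M.flux G x = M.flux (fun i x => ∫ s in (0:ℝ)..x, G i s) t := by
    unfold flux
    rw [intervalIntegral.integral_sub ((ii (hA 0)).const_mul _) ((ii (hA 1)).const_mul _),
      intervalIntegral.integral_const_mul, intervalIntegral.integral_const_mul, hAi, hAi,
      hVI, hVI, hV 0 t ht, hV 1 t ht]
  have hfc : ContinuousOn (M.flux G) (Icc 0 T) :=
    (continuousOn_const.mul (hA 0)).sub (continuousOn_const.mul (hA 1))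
  rw [intervalIntegral.integral_add (ii hc) ((ii hGI).const_mul _),
    intervalIntegral.integral_const_mul,
    intervalIntegral.integral_add (by simp) ((ii hfc).const_mul _),
    intervalIntegral.integral_const_mul, hflux] at hint
  rw [hint]
  simp

end FeynmanKac

/-! ### The Laplace-space solution solves the integrated system. -/

theorem QuadDecay.integral_verticalInv {r C : ℝ} {F : ℂ → ℂ} (h : QuadDecay r C F) (hr : 0 ≤ r)
    {σ : ℝ} (hσ : r < σ) (hσ1 : 1 ≤ σ) {t : ℝ} (ht : 0 ≤ t) :
    ∫ s in (0:ℝ)..t, verticalInv F σ s = verticalInv (fun z => F z * z⁻¹) σ t := by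
  have := h.temperedInt_verticalInv hr hσ hσ1 one_pos (u := 0) (by simp; linarith) ht
  rw [temperedInt_one_zero] at this
  simpa [Complex.cpow_neg_one] using this

-- Carries an algebraic identity between symbols on the vertical line over to the time domain.
open MeasureTheory in
theorem sum_verticalInv_eq_zero {n : ℕ} {c : Fin n → ℂ} {F : Fin n → ℂ → ℂ} {σ t : ℝ}
    (hF : ∀ i, Integrable fun y : ℝ =>
      Complex.exp ((σ + y * Complex.I) * t) * F i (σ + y * Complex.I))
    (h : ∀ y : ℝ, ∑ i, c i * F i (σ + y * Complex.I) = 0) :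
    ∑ i, c i * verticalInv (F i) σ t = 0 := by
  have h1 : ∑ i, c i * verticalInv (F i) σ t = (1 / (2 * π) : ℂ) * ∫ y : ℝ, ∑ i, c i *
      (Complex.exp ((σ + y * Complex.I) * t) * F i (σ + y * Complex.I)) := by
    rw [integral_finsetSum _ fun i _ => (hF i).const_mul _, Finset.mul_sum]
    refine Finset.sum_congr rfl fun i _ => ?_
    rw [integral_const_mul, verticalInv]
    ring
  have h2 : ∀ y : ℝ, ∑ i, c i *
      (Complex.exp ((σ + y * Complex.I) * t) * F i (σ + y * Complex.I)) = 0 := by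
    intro y
    have : ∑ i, c i * (Complex.exp ((σ + y * Complex.I) * t) * F i (σ + y * Complex.I)) =
        Complex.exp ((σ + y * Complex.I) * t) * ∑ i, c i * F i (σ + y * Complex.I) := by
      rw [Finset.mul_sum]
      exact Finset.sum_congr rfl fun i _ => by ring
    rw [this, h y, mul_zero]
  rw [h1]
  simp_rw [h2]
  simp

namespace FeynmanKac

variable {M : FeynmanKac}

/-- An abscissa to the right of all singularities of `Ghat`. -/
noncomputable def abscissa (M : FeynmanKac) : ℝ :=
  M.radius + ‖M.ρ * M.U 0‖ + ‖M.ρ * M.U 1‖ + 1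

theorem one_le_abscissa : 1 ≤ M.abscissa := by
  have := M.radius_nonneg
  unfold abscissa
  have := norm_nonneg (M.ρ * M.U 0)
  have := norm_nonneg (M.ρ * M.U 1)
  linarith

theorem radius_le_abscissa : M.radius ≤ M.abscissa := by
  unfold abscissa
  have := norm_nonneg (M.ρ * M.U 0)
  have := norm_nonneg (M.ρ * M.U 1)
  linarith

theorem one_add_norm_le_abscissa (j : Fin 2) : ‖M.ρ * M.U j‖ + 1 ≤ M.abscissa := by
  have := M.radius_nonneg
  have := norm_nonneg (M.ρ * M.U 0)
  have := norm_nonneg (M.ρ * M.U 1)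
  unfold abscissa
  fin_cases j
  · simp only [Fin.zero_eta]; linarith
  · simp only [Fin.mk_one]; linarith

theorem mem_region_of_abscissa_lt {z : ℂ} (hz : M.abscissa < z.re) : z ∈ M.region := by
  have h1 := Complex.re_le_norm z
  have h2 := M.radius_le_abscissa
  show 2 * M.radius < ‖z‖ + z.re
  linarith

theorem one_lt_re_add {z : ℂ} (hz : M.abscissa < z.re) (j : Fin 2) :
    1 < (z + M.ρ * M.U j).re := by
  have h1 := M.one_add_norm_le_abscissa j
  have h2 := (abs_le.mp (Complex.abs_re_le_norm (M.ρ * M.U j))).1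
  rw [Complex.add_re]
  linarith

/-- A constant with `‖Ghat z‖ ≤ ghatConst / ‖z‖` for large `z`. -/
noncomputable def ghatConst (M : FeynmanKac) (G₀ : Fin 2 → ℂ) (j : Fin 2) : ℝ :=
  8 * (‖G₀ j‖ + 4 * |M.C (1 - j)| * ‖G₀ (1 - j)‖)

theorem norm_Ghat_le_const {z : ℂ} (hz : M.radius < ‖z‖) (hz1 : 1 ≤ ‖z‖) (G₀ : Fin 2 → ℂ)
    (j : Fin 2) : ‖M.Ghat G₀ j z‖ ≤ M.ghatConst G₀ j * ‖z‖⁻¹ := by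
  refine (norm_Ghat_le hz G₀ j).trans ?_
  have h1 : ‖z‖ ^ (-M.α (1 - j)) ≤ 1 :=
    Real.rpow_le_one_of_one_le_of_nonpos hz1 (by linarith [(M.α_mem (1 - j)).1])
  unfold ghatConst
  calc 8 * (‖z‖⁻¹ * (‖G₀ j‖ + 4 * |M.C (1 - j)| * ‖z‖ ^ (-M.α (1 - j)) * ‖G₀ (1 - j)‖))
      ≤ 8 * (‖z‖⁻¹ * (‖G₀ j‖ + 4 * |M.C (1 - j)| * 1 * ‖G₀ (1 - j)‖)) := by gcongr
    _ = _ := by ring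

/-- The factor `z⁻¹`, one integration in time, upgrades the decay `1 / ‖z‖` of `Ghat` to the
quadratic decay that makes the inverse transform absolutely convergent. -/
theorem quadDecay_Ghat (G₀ : Fin 2 → ℂ) (j : Fin 2) :
    QuadDecay M.abscissa (M.ghatConst G₀ j) fun z => M.Ghat G₀ j z * z⁻¹ := by
  have hne : ∀ z : ℂ, M.abscissa < z.re → z ≠ 0 := by
    rintro z hz rfl
    have := M.one_le_abscissa
    simp at hz; linarith
  refine ⟨?_, fun z hz => ?_⟩
  · refine ((M.differentiableOn_Ghat G₀ j).mono fun z hz => mem_region_of_abscissa_lt hz).mul ?_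
    exact differentiableOn_id.inv hne
  · have h1 : 1 ≤ ‖z‖ := by
      have := M.one_le_abscissa
      linarith [Complex.re_le_norm z]
    have h2 := M.norm_Ghat_le_const (radius_lt_norm_of_mem_region (mem_region_of_abscissa_lt hz))
      h1 G₀ j
    rw [norm_mul, norm_inv]
    calc ‖M.Ghat G₀ j z‖ * ‖z‖⁻¹ ≤ M.ghatConst G₀ j * ‖z‖⁻¹ * ‖z‖⁻¹ := by gcongr
      _ = _ := by rw [div_eq_mul_inv, sq, mul_inv, mul_assoc]

theorem differentiableOn_cpow_half (j : Fin 2) (c : ℂ) :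
    DifferentiableOn ℂ (fun z : ℂ => (z + M.ρ * M.U j) ^ c) {z | M.abscissa < z.re} := by
  refine DifferentiableOn.cpow_const (by fun_prop) fun z hz => ?_
  exact add_mem_slitPlane (mem_region_of_abscissa_lt hz) j

theorem norm_cpow_neg_le_one (j : Fin 2) {z : ℂ} (hz : M.abscissa < z.re) :
    ‖(z + M.ρ * M.U j) ^ (-(M.α j : ℂ))‖ ≤ 1 := by
  rw [← Complex.ofReal_neg, Complex.norm_cpow_real]
  refine Real.rpow_le_one_of_one_le_of_nonpos ?_ (by linarith [(M.α_mem j).1])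
  linarith [one_lt_re_add hz j, Complex.re_le_norm (z + M.ρ * M.U j)]

theorem norm_inv_le_one {z : ℂ} (hz : M.abscissa < z.re) : ‖z⁻¹‖ ≤ 1 := by
  rw [norm_inv]
  apply inv_le_one_of_one_le₀
  have := M.one_le_abscissa
  linarith [Complex.re_le_norm z]

theorem differentiableOn_inv_half :
    DifferentiableOn ℂ (fun z : ℂ => z⁻¹) {z | M.abscissa < z.re} := by
  refine differentiableOn_id.inv ?_
  rintro z hz rfl
  have := M.one_le_abscissa
  have : M.abscissa < (0 : ℂ).re := hz
  simp at this; linarith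

/-- The Laplace-transformed system. -/
theorem Ghat_system {z : ℂ} (hz : z ∈ M.region) (G₀ : Fin 2 → ℂ) (j : Fin 2) :
    (z + M.ρ * M.U j) * M.Ghat G₀ j z - G₀ j = sgn j *
      (M.C 0 * ((z + M.ρ * M.U 0) * (z + M.ρ * M.U 0) ^ (-(M.α 0 : ℂ)) * M.Ghat G₀ 0 z) -
       M.C 1 * ((z + M.ρ * M.U 1) * (z + M.ρ * M.U 1) ^ (-(M.α 1 : ℂ)) * M.Ghat G₀ 1 z)) := by
  have hs : ∀ i, z + M.ρ * M.U i ≠ 0 := fun i => Complex.slitPlane_ne_zero (add_mem_slitPlane hz i)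
  have hd := det_ne_zero (radius_lt_norm_of_mem_region hz) (0 : Fin 2)
  simp only [sub_zero] at hd
  -- In the unknowns `x i = s_i ^ (1 - α_i) * Ghat i` the system reads `symb i * x i + C (1 - i) * x
  -- (1 - i) = G₀ i`, and `Ghat` is Cramer's rule for it.
  set x : Fin 2 → ℂ := fun i => M.H z * (M.symb (1 - i) z * G₀ i - M.C (1 - i) * G₀ (1 - i)) with hx
  have hG : ∀ i, M.Ghat G₀ i z = (z + M.ρ * M.U i) ^ ((M.α i - 1 : ℝ) : ℂ) * x i := by
    intro i; simp only [Ghat, hx]; ring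
  have h1 : ∀ i, (z + M.ρ * M.U i) * M.Ghat G₀ i z = (M.symb i z + M.C i) * x i := by
    intro i
    rw [hG, ← mul_assoc, mul_comm (z + M.ρ * M.U i)]
    congr 1
    have : (M.α i : ℂ) = ((M.α i - 1 : ℝ) : ℂ) + 1 := by push_cast; ring
    rw [symb, this, Complex.cpow_add _ _ (hs i), Complex.cpow_one]
    ring
  have h2 : ∀ i, (z + M.ρ * M.U i) * (z + M.ρ * M.U i) ^ (-(M.α i : ℂ)) * M.Ghat G₀ i z = x i := by
    intro i
    rw [hG, ← mul_assoc, mul_assoc (z + M.ρ * M.U i), ← Complex.cpow_add _ _ (hs i)]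
    have : (-(M.α i : ℂ) + ((M.α i - 1 : ℝ) : ℂ)) = -1 := by push_cast; ring
    rw [this, Complex.cpow_neg_one, mul_inv_cancel₀ (hs i), one_mul]
  have h3 : ∀ i, M.symb i z * x i + M.C (1 - i) * x (1 - i) = G₀ i := by
    have hH : M.H z * (M.symb 0 z * M.symb 1 z - (M.C 0 : ℂ) * (M.C 1 : ℂ)) = 1 := by
      unfold H; exact inv_mul_cancel₀ hd
    intro i
    fin_cases i
    · simp only [hx, Fin.zero_eta, sub_zero, sub_self]
      linear_combination G₀ 0 * hH
    · simp only [hx, Fin.mk_one, sub_self, sub_zero]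
      linear_combination G₀ 1 * hH
  have h4 := h3 j
  rw [h1, h2, h2]
  fin_cases j
  · simp only [sgn, Fin.zero_eta, Matrix.cons_val_zero, sub_zero] at h4 ⊢
    linear_combination h4
  · simp only [sgn, Fin.mk_one, Matrix.cons_val_one, Matrix.cons_val_zero, sub_self] at h4 ⊢
    linear_combination h4

theorem fracInt_verticalInv {C : ℝ} {F : ℂ → ℂ} (h : QuadDecay M.abscissa C F) {σ : ℝ}
    (hσ : M.abscissa < σ) (j : Fin 2) {t : ℝ} (ht : 0 ≤ t) :
    M.fracInt j (verticalInv F σ) t =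
      verticalInv (fun z => F z * (z + M.ρ * M.U j) ^ (-(M.α j : ℂ))) σ t := by
  have h1 := M.one_le_abscissa
  rw [fracInt_eq]
  refine h.temperedInt_verticalInv (by linarith) hσ (by linarith) (M.α_mem j).1 ?_ ht
  have := one_lt_re_add (M := M) (z := (σ : ℂ)) (by simpa using hσ) j
  rw [Complex.add_re, Complex.ofReal_re] at this
  linarith

theorem quadDecay_mul_cpow {C : ℝ} {F : ℂ → ℂ} (h : QuadDecay M.abscissa C F) (j : Fin 2) :
    QuadDecay M.abscissa C fun z => F z * (z + M.ρ * M.U j) ^ (-(M.α j : ℂ)) :=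
  h.mul (by linarith [M.one_le_abscissa]) (differentiableOn_cpow_half j _)
    fun _ hz => norm_cpow_neg_le_one j hz

theorem quadDecay_mul_inv {C : ℝ} {F : ℂ → ℂ} (h : QuadDecay M.abscissa C F) :
    QuadDecay M.abscissa C fun z => F z * z⁻¹ :=
  h.mul (by linarith [M.one_le_abscissa]) differentiableOn_inv_half fun _ hz => norm_inv_le_one hz

/-- The candidate for the primitive of the solution. -/
noncomputable def primCand (M : FeynmanKac) (G₀ : Fin 2 → ℂ) (σ : ℝ) (j : Fin 2) (t : ℝ) : ℂ :=
  verticalInv (fun z => M.Ghat G₀ j z * z⁻¹) σ t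

theorem continuous_primCand (G₀ : Fin 2 → ℂ) {σ : ℝ} (hσ : M.abscissa < σ) (j : Fin 2) :
    Continuous (M.primCand G₀ σ j) :=
  (quadDecay_Ghat G₀ j).continuous_verticalInv (by linarith [M.one_le_abscissa]) hσ
    (by linarith [M.one_le_abscissa])

theorem continuousOn_fracInt_primCand (G₀ : Fin 2 → ℂ) {σ : ℝ} (hσ : M.abscissa < σ) (j : Fin 2)
    (T : ℝ) : ContinuousOn (M.fracInt j (M.primCand G₀ σ j)) (Icc 0 T) := by
  have h := (quadDecay_mul_cpow (M.quadDecay_Ghat G₀ j) j).continuous_verticalInv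
    (by linarith [M.one_le_abscissa]) hσ (by linarith [M.one_le_abscissa])
  refine h.continuousOn.congr fun t ht => ?_
  exact fracInt_verticalInv (quadDecay_Ghat G₀ j) hσ j ht.1

/-- All seven terms are inverse Laplace integrals on one line, so the claim is `Ghat_system`
multiplied by `z⁻²`; the datum `t * G₀ j` is the inverse transform of `z⁻² G₀ j`. -/
theorem primCand_volterra (G₀ : Fin 2 → ℂ) {σ : ℝ} (hσ : M.abscissa < σ) (j : Fin 2) {t : ℝ}
    (ht : 0 ≤ t) :
    M.primCand G₀ σ j t + M.ρ * M.U j * ∫ s in (0:ℝ)..t, M.primCand G₀ σ j s =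
      t * G₀ j + sgn j * M.flux (M.primCand G₀ σ) t := by
  have h1 := M.one_le_abscissa
  have hr : 0 ≤ M.abscissa := by linarith
  have hσ1 : 1 ≤ σ := by linarith
  have hX := fun i => M.quadDecay_Ghat G₀ i
  have hXs := fun i => quadDecay_mul_cpow (hX i) i
  have hXI : ∫ s in (0:ℝ)..t, M.primCand G₀ σ j s =
      verticalInv (fun z => M.Ghat G₀ j z * z⁻¹ * z⁻¹) σ t :=
    (hX j).integral_verticalInv hr hσ hσ1 ht
  have hJ : ∀ i, ∀ s, 0 ≤ s → M.fracInt i (M.primCand G₀ σ i) s = verticalInv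
      (fun z => M.Ghat G₀ i z * z⁻¹ * (z + M.ρ * M.U i) ^ (-(M.α i : ℂ))) σ s :=
    fun i s hs => fracInt_verticalInv (hX i) hσ i hs
  have hJI : ∀ i, ∫ s in (0:ℝ)..t, M.fracInt i (M.primCand G₀ σ i) s = verticalInv
      (fun z => M.Ghat G₀ i z * z⁻¹ * (z + M.ρ * M.U i) ^ (-(M.α i : ℂ)) * z⁻¹) σ t := by
    intro i
    rw [← (hXs i).integral_verticalInv hr hσ hσ1 ht]
    refine intervalIntegral.integral_congr fun s hs => ?_
    rw [uIcc_of_le ht] at hs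
    exact hJ i s hs.1
  have hq : QuadDecay M.abscissa 1 (fun z : ℂ => (z ^ 2)⁻¹) := by
    refine ⟨?_, fun z _ => by simp⟩
    refine (M.differentiableOn_inv_half.pow 2).congr fun z _ => ?_
    simp
  have hsum := sum_verticalInv_eq_zero (n := 7) (σ := σ) (t := t)
    (c := ![1, M.ρ * M.U j, -G₀ j, -(sgn j * M.C 0), -(sgn j * M.C 0 * (M.ρ * M.U 0)),
      sgn j * M.C 1, sgn j * M.C 1 * (M.ρ * M.U 1)])
    (F := ![fun z => M.Ghat G₀ j z * z⁻¹, fun z => M.Ghat G₀ j z * z⁻¹ * z⁻¹,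
      fun z => (z ^ 2)⁻¹,
      fun z => M.Ghat G₀ 0 z * z⁻¹ * (z + M.ρ * M.U 0) ^ (-(M.α 0 : ℂ)),
      fun z => M.Ghat G₀ 0 z * z⁻¹ * (z + M.ρ * M.U 0) ^ (-(M.α 0 : ℂ)) * z⁻¹,
      fun z => M.Ghat G₀ 1 z * z⁻¹ * (z + M.ρ * M.U 1) ^ (-(M.α 1 : ℂ)),
      fun z => M.Ghat G₀ 1 z * z⁻¹ * (z + M.ρ * M.U 1) ^ (-(M.α 1 : ℂ)) * z⁻¹]) ?_ ?_
  · simp only [Fin.sum_univ_succ, Finset.univ_eq_empty, Finset.sum_empty, Matrix.cons_val_zero,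
      Matrix.cons_val_succ] at hsum
    rw [verticalInv_inv_sq (by linarith) ht] at hsum
    unfold flux
    rw [hXI, hJ 0 t ht, hJ 1 t ht, hJI, hJI]
    unfold primCand
    linear_combination hsum
  · intro i
    fin_cases i
    · exact (hX j).integrable hr hσ hσ1 t
    · exact (quadDecay_mul_inv (hX j)).integrable hr hσ hσ1 t
    · exact hq.integrable hr hσ hσ1 t
    · exact (hXs 0).integrable hr hσ hσ1 t
    · exact (quadDecay_mul_inv (hXs 0)).integrable hr hσ hσ1 t
    · exact (hXs 1).integrable hr hσ hσ1 t
    · exact (quadDecay_mul_inv (hXs 1)).integrable hr hσ hσ1 t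
  · intro y
    set z : ℂ := σ + y * Complex.I with hz
    have hzre : M.abscissa < z.re := by simpa [hz] using hσ
    have hz0 : z ≠ 0 := by
      intro h; rw [h] at hzre; simp at hzre; linarith
    have hsys := Ghat_system (mem_region_of_abscissa_lt hzre) G₀ j
    simp only [Fin.sum_univ_succ, Finset.univ_eq_empty, Finset.sum_empty, Matrix.cons_val_zero,
      Matrix.cons_val_succ]
    have e : z * z⁻¹ = 1 := mul_inv_cancel₀ hz0
    have e2 : (z ^ 2)⁻¹ = z⁻¹ * z⁻¹ := by rw [sq, mul_inv]
    rw [e2]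
    linear_combination (z⁻¹ * z⁻¹) * hsys - (M.Ghat G₀ j z * z⁻¹ -
      sgn j * M.C 0 * (M.Ghat G₀ 0 z * z⁻¹ * (z + M.ρ * M.U 0) ^ (-(M.α 0 : ℂ))) +
      sgn j * M.C 1 * (M.Ghat G₀ 1 z * z⁻¹ * (z + M.ρ * M.U 1) ^ (-(M.α 1 : ℂ)))) * e

/-- The difference of the two primitives solves the homogeneous Volterra system. No Laplace
transform of `G`, hence no extension beyond `T`, is needed. -/
theorem IsSolution.integral_eq_primCand {T : ℝ} {G₀ : Fin 2 → ℂ} {G : Fin 2 → ℝ → ℂ}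
    (hG : M.IsSolution T G₀ G) {σ : ℝ} (hσ : M.abscissa < σ) (j : Fin 2) {t : ℝ}
    (ht : t ∈ Icc 0 T) : ∫ s in (0:ℝ)..t, G j s = M.primCand G₀ σ j t := by
  have hT : 0 ≤ T := ht.1.trans ht.2
  set V : Fin 2 → ℝ → ℂ := fun i x => ∫ s in (0:ℝ)..x, G i s with hV
  set W := M.primCand G₀ σ with hW
  have hVc : ∀ i, ContinuousOn (V i) (Icc 0 T) := fun i => continuousOn_integral hT (hG.continuousOn i)
  have hWc : ∀ i, ContinuousOn (W i) (Icc 0 T) := fun i => (continuous_primCand G₀ hσ i).continuousOn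
  have hJV : ∀ i, ContinuousOn (M.fracInt i (V i)) (Icc 0 T) := fun i =>
    (continuousOn_integral hT (hG.continuousOn_fracInt i)).congr fun x hx =>
      temperedInt_integral (M.α_mem i).1 _ (hG.continuousOn i) hx
  have hJW : ∀ i, ContinuousOn (M.fracInt i (W i)) (Icc 0 T) := fun i =>
    continuousOn_fracInt_primCand G₀ hσ i T
  have ii : ∀ {g : ℝ → ℂ}, ContinuousOn g (Icc 0 T) → ∀ x ∈ Icc 0 T,
      IntervalIntegrable g MeasureTheory.volume 0 x := fun hg x hx =>
    (hg.mono (by rw [uIcc_of_le hx.1]; exact Icc_subset_Icc le_rfl hx.2)).intervalIntegrable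
  have hJE : ∀ i, ∀ x ∈ Icc 0 T, M.fracInt i (fun s => V i s - W i s) x =
      M.fracInt i (V i) x - M.fracInt i (W i) x := fun i x hx =>
    temperedInt_sub (M.α_mem i).1 _ (hVc i) (hWc i) hx
  have hJEI : ∀ i, ∀ x ∈ Icc 0 T, ∫ y in (0:ℝ)..x, M.fracInt i (fun s => V i s - W i s) y =
      (∫ y in (0:ℝ)..x, M.fracInt i (V i) y) - ∫ y in (0:ℝ)..x, M.fracInt i (W i) y := by
    intro i x hx
    rw [← intervalIntegral.integral_sub (ii (hJV i) x hx) (ii (hJW i) x hx)]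
    refine intervalIntegral.integral_congr fun y hy => ?_
    rw [uIcc_of_le hx.1] at hy
    exact hJE i y ⟨hy.1, hy.2.trans hx.2⟩
  have huniq := volterra_unique (M := M) (X := fun i s => V i s - W i s)
    (fun i => (hVc i).sub (hWc i)) ?_ j t ht
  · exact sub_eq_zero.mp huniq
  · intro i x hx
    have h1 := hG.volterra i hx
    have h2 := primCand_volterra (M := M) G₀ hσ i hx.1
    rw [intervalIntegral.integral_sub (ii (hVc i) x hx) (ii (hWc i) x hx)]
    unfold flux at h1 h2 ⊢
    rw [hJE 0 x hx, hJE 1 x hx, hJEI 0 x hx, hJEI 1 x hx]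
    simp only [← hW] at h2
    simp only [hV] at h1 ⊢
    linear_combination h1 - h2

end FeynmanKac

/-! ### Deforming the vertical line into a contour. -/

namespace FeynmanKac

variable {M : FeynmanKac}

theorem mem_slitPlane_of_mem_region {z : ℂ} (hz : z ∈ M.region) : z ∈ Complex.slitPlane := by
  have h1 : 2 * M.radius < ‖z‖ + z.re := hz
  have h2 := M.radius_nonneg
  by_contra hcon
  rw [Complex.mem_slitPlane_iff, not_or, not_lt, not_not] at hcon
  have h3 : ‖z‖ = -z.re := by
    have : z = (z.re : ℂ) := Complex.ext (by simp) (by simp [hcon.2])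
    rw [this, Complex.norm_real, Real.norm_eq_abs, abs_of_nonpos hcon.1]
    simp
  linarith

/-- Under squaring, `2 R < ‖z‖ + z.re` pulls back to `R < w.re ^ 2`: this is why `region` is bounded
by a parabola. -/
theorem norm_sq_add_re_sq (w : ℂ) : ‖w ^ 2‖ + (w ^ 2).re = 2 * w.re ^ 2 := by
  rw [norm_pow, ← Complex.normSq_eq_norm_sq, Complex.normSq_apply, sq w, Complex.mul_re]
  ring

/-- Holomorphic functions on `region` have primitives: the square root maps it to a half-plane. -/
theorem exists_primitive_region {f : ℂ → ℂ} (hf : DifferentiableOn ℂ f M.region) :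
    ∃ Φ : ℂ → ℂ, ∀ z ∈ M.region, HasDerivAt Φ (f z) z := by
  set U : Set ℂ := {w | √M.radius < w.re} with hU
  have hUc : Convex ℝ U := convex_halfSpace_re_gt _
  have hUo : IsOpen U := isOpen_lt continuous_const Complex.continuous_re
  have hsq : ∀ w ∈ U, w ^ 2 ∈ M.region := by
    intro w hw
    show 2 * M.radius < _
    rw [norm_sq_add_re_sq]
    have hw' : √M.radius < w.re := hw
    have : M.radius < w.re ^ 2 := (Real.sqrt_lt' (lt_of_le_of_lt (Real.sqrt_nonneg _) hw')).mp hw'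
    linarith
  have hd : DifferentiableOn ℂ (fun w : ℂ => f (w ^ 2) * (2 * w)) U :=
    (hf.comp (by fun_prop) hsq).mul (by fun_prop)
  -- The half-plane is convex, so the pulled-back form `f (w ^ 2) * 2 w` has a primitive; composing
  -- it with the square root gives one for `f`.
  obtain ⟨P, hP⟩ := hUc.exists_forall_hasDerivWithinAt hd
  refine ⟨fun z => P (Complex.exp (Complex.log z / 2)), fun z hz => ?_⟩
  have hslit := mem_slitPlane_of_mem_region hz
  have hz0 := Complex.slitPlane_ne_zero hslit
  set w := Complex.exp (Complex.log z / 2) with hw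
  have hw2 : w ^ 2 = z := by
    rw [hw, ← Complex.exp_nat_mul]
    push_cast
    rw [mul_div_cancel₀ _ two_ne_zero, Complex.exp_log hz0]
  have hwre : 0 < w.re := by
    rw [hw, Complex.exp_re]
    refine mul_pos (Real.exp_pos _) (Real.cos_pos_of_mem_Ioo ?_)
    have him : (Complex.log z / 2).im = z.arg / 2 := by
      rw [show (Complex.log z / 2) = Complex.log z / ((2 : ℝ) : ℂ) by norm_num,
        Complex.div_ofReal_im, Complex.log_im]
    rw [him]
    have h1 := Complex.neg_pi_lt_arg z
    have h2 := lt_of_le_of_ne (Complex.arg_le_pi z) (Complex.slitPlane_arg_ne_pi hslit)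
    constructor <;> linarith
  have hwU : w ∈ U := by
    show √M.radius < w.re
    rw [Real.sqrt_lt' hwre]
    have h1 : 2 * M.radius < ‖z‖ + z.re := hz
    rw [← hw2, norm_sq_add_re_sq] at h1
    linarith
  have h1 : HasDerivAt P (f (w ^ 2) * (2 * w)) w := (hP w hwU).hasDerivAt (hUo.mem_nhds hwU)
  have h2 : HasDerivAt (fun z : ℂ => Complex.exp (Complex.log z / 2)) (w * (z⁻¹ / 2)) z :=
    ((Complex.hasDerivAt_log hslit).div_const 2).cexp
  refine (h1.comp z h2).congr_deriv ?_
  rw [hw2]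
  have : w * w = z := by rw [← sq, hw2]
  field_simp
  linear_combination f z * this

/-- The quantity `‖z‖ + z.re` does not decrease to the right, so horizontal segments towards the
vertical line stay in `region`. -/
theorem mem_region_of_le {x s Y : ℝ} (h : (x + Y * Complex.I : ℂ) ∈ M.region) (hs : x ≤ s) :
    (s + Y * Complex.I : ℂ) ∈ M.region := by
  have h1 : 2 * M.radius < ‖(x + Y * Complex.I : ℂ)‖ + (x + Y * Complex.I : ℂ).re := h
  show 2 * M.radius < ‖(s + Y * Complex.I : ℂ)‖ + (s + Y * Complex.I : ℂ).re
  have h2 : ‖(x + Y * Complex.I : ℂ)‖ ≤ ‖(s + Y * Complex.I : ℂ)‖ + (s - x) := by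
    have e : (x + Y * Complex.I : ℂ) = (s + Y * Complex.I : ℂ) - ((s - x : ℝ) : ℂ) := by
      push_cast; ring
    rw [e]
    refine (norm_sub_le _ _).trans ?_
    rw [Complex.norm_real, Real.norm_of_nonneg (by linarith)]
  simp at h1 ⊢
  linarith

/-- Horizontal transfer between a point of `region` and a vertical line. -/
theorem norm_primitive_sub_le {Φ F : ℂ → ℂ} {A σ t : ℝ} (ht : 0 < t) (hA : 0 ≤ A)
    (hF : DifferentiableOn ℂ F M.region)
    (hΦ : ∀ z ∈ M.region, HasDerivAt Φ (Complex.exp (z * t) * F z) z)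
    (hFb : ∀ z ∈ M.region, 1 ≤ ‖z‖ → ‖F z‖ ≤ A / ‖z‖ ^ 2) {z : ℂ} (hz : z ∈ M.region)
    (hσ : z.re ≤ σ) (hY : 1 ≤ |z.im|) :
    ‖Φ z - Φ (σ + z.im * Complex.I)‖ ≤ A / z.im ^ 2 * (Real.exp (t * σ) / t) := by
  set x := z.re
  set Y := z.im
  have hzxy : z = x + Y * Complex.I := (Complex.re_add_im z).symm
  rw [hzxy] at hz ⊢
  have hmem : ∀ s ∈ Icc x σ, (s + Y * Complex.I : ℂ) ∈ M.region := fun s hs =>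
    mem_region_of_le hz hs.1
  have hd : ∀ s ∈ Icc x σ, HasDerivAt (fun s : ℝ => Φ (s + Y * Complex.I))
      (Complex.exp ((s + Y * Complex.I) * t) * F (s + Y * Complex.I)) s := by
    intro s hs
    have h1 := hΦ _ (hmem s hs)
    have h2 : HasDerivAt (fun s : ℝ => (s + Y * Complex.I : ℂ)) 1 s :=
      (Complex.ofRealCLM.hasDerivAt (x := s)).add_const _
    have := h1.comp (h := fun s : ℝ => (s + Y * Complex.I : ℂ)) (𝕜' := ℂ) s h2
    rw [mul_one] at this
    exact this
  have hcont : ContinuousOn (fun s : ℝ =>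
      Complex.exp ((s + Y * Complex.I) * t) * F (s + Y * Complex.I)) (uIcc x σ) := by
    rw [uIcc_of_le hσ]
    refine ContinuousOn.mul (by fun_prop) ?_
    exact hF.continuousOn.comp (by fun_prop) hmem
  have hftc := intervalIntegral.integral_eq_sub_of_hasDerivAt
    (fun s hs => hd s (by rwa [uIcc_of_le hσ] at hs)) hcont.intervalIntegrable
  rw [norm_sub_rev, ← hftc]
  have hY2 : 0 < Y ^ 2 := by
    rw [← sq_abs]; positivity
  have hexp : ∫ s in x..σ, Real.exp (t * s) = (Real.exp (t * σ) - Real.exp (t * x)) / t := by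
    rw [intervalIntegral.integral_comp_mul_left (fun s => Real.exp s) ht.ne', integral_exp,
      smul_eq_mul, inv_mul_eq_div]
  calc ‖∫ s in x..σ, Complex.exp ((s + Y * Complex.I) * t) * F (s + Y * Complex.I)‖ ≤
      ∫ s in x..σ, A / Y ^ 2 * Real.exp (t * s) := by
        refine intervalIntegral.norm_integral_le_of_norm_le hσ
          (Eventually.of_forall fun s hs => ?_)
          (Continuous.intervalIntegrable (by fun_prop) _ _)
        have hsm := hmem s ⟨hs.1.le, hs.2⟩
        have hn : Y ^ 2 ≤ ‖(s + Y * Complex.I : ℂ)‖ ^ 2 := by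
          rw [QuadDecay.norm_sq]; nlinarith
        have hn1 : 1 ≤ ‖(s + Y * Complex.I : ℂ)‖ := by
          have := Complex.abs_im_le_norm (s + Y * Complex.I : ℂ)
          simp at this
          linarith
        rw [norm_mul, QuadDecay.norm_exp_line, mul_comm, mul_comm s t]
        refine mul_le_mul_of_nonneg_right ((hFb _ hsm hn1).trans ?_) (Real.exp_pos _).le
        gcongr
    _ = A / Y ^ 2 * ((Real.exp (t * σ) - Real.exp (t * x)) / t) := by
        rw [intervalIntegral.integral_const_mul, hexp]
    _ ≤ _ := by
        gcongr
        linarith [Real.exp_pos (t * x)]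

open MeasureTheory in
/-- Change of contour from a vertical line to a curve in `region`. -/
theorem integral_contour_eq {F : ℂ → ℂ} {A σ t : ℝ} (ht : 0 < t) (hσ : M.abscissa < σ)
    (hF : DifferentiableOn ℂ F M.region)
    (hFb : ∀ z ∈ M.region, 1 ≤ ‖z‖ → ‖F z‖ ≤ A / ‖z‖ ^ 2) {γ γ' : ℝ → ℂ}
    (hγ : ∀ x, HasDerivAt γ (γ' x) x) (hγ' : Continuous γ') (hreg : ∀ x, γ x ∈ M.region)
    (hre : ∀ x, (γ x).re ≤ σ) (hp : Tendsto (fun x => (γ x).im) atTop atTop)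
    (hn : Tendsto (fun x => (γ x).im) atBot atBot)
    (hint : Integrable fun x => Complex.exp (γ x * t) * F (γ x) * γ' x) :
    ∫ x, Complex.exp (γ x * t) * F (γ x) * γ' x =
      2 * π * Complex.I * verticalInv F σ t := by
  have h1 := M.one_le_abscissa
  have hq : QuadDecay M.abscissa A F := by
    refine ⟨hF.mono fun z hz => mem_region_of_abscissa_lt hz, fun z hz => ?_⟩
    refine hFb z (mem_region_of_abscissa_lt hz) ?_
    linarith [Complex.re_le_norm z]
  have hA := hq.nonneg (by linarith)
  obtain ⟨Φ, hΦ⟩ := exists_primitive_region (M := M) (f := fun z => Complex.exp (z * t) * F z)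
    ((by fun_prop : DifferentiableOn ℂ (fun z : ℂ => Complex.exp (z * t)) M.region).mul hF)
  have hγc : Continuous γ := continuous_iff_continuousAt.mpr fun x => (hγ x).continuousAt
  have hFγ : Continuous fun x => Complex.exp (γ x * t) * F (γ x) * γ' x := by
    refine Continuous.mul (Continuous.mul (by fun_prop) ?_) hγ'
    exact hF.continuousOn.comp_continuous hγc hreg
  -- With a primitive `Φ` both truncated integrals are differences of endpoint values. Truncating
  -- the vertical line at the heights of the curve's endpoints leaves two horizontal segments,
  -- negligible at great height.
  have hcurve : ∀ X : ℝ, ∫ x in -X..X, Complex.exp (γ x * t) * F (γ x) * γ' x =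
      Φ (γ X) - Φ (γ (-X)) := by
    intro X
    refine intervalIntegral.integral_eq_sub_of_hasDerivAt (f := fun x => Φ (γ x)) (fun x _ => ?_)
      (hFγ.intervalIntegrable _ _)
    exact (hΦ _ (hreg x)).comp (𝕜' := ℂ) x (hγ x)
  have hvert : ∀ a b : ℝ, ∫ y in a..b, Complex.exp ((σ + y * Complex.I) * t) *
      F (σ + y * Complex.I) * Complex.I = Φ (σ + b * Complex.I) - Φ (σ + a * Complex.I) := by
    intro a b
    have hmem : ∀ y : ℝ, (σ + y * Complex.I : ℂ) ∈ M.region := fun y =>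
      mem_region_of_abscissa_lt (by simpa using hσ)
    refine intervalIntegral.integral_eq_sub_of_hasDerivAt
      (f := fun y : ℝ => Φ (σ + y * Complex.I)) (fun y _ => ?_) ?_
    · have h2 : HasDerivAt (fun y : ℝ => (σ + y * Complex.I : ℂ)) Complex.I y := by
        simpa using ((Complex.ofRealCLM.hasDerivAt (x := y)).mul_const Complex.I).const_add (σ : ℂ)
      exact (hΦ _ (hmem y)).comp (𝕜' := ℂ) y h2
    · refine Continuous.intervalIntegrable ?_ _ _
      exact Continuous.mul (Continuous.mul (by fun_prop) (hq.continuous_line hσ)) continuous_const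
  have hvint : Integrable fun y : ℝ => Complex.exp ((σ + y * Complex.I) * t) *
      F (σ + y * Complex.I) * Complex.I :=
    (hq.integrable (by linarith) hσ (by linarith) t).mul_const _
  have t1 := intervalIntegral_tendsto_integral hint tendsto_neg_atTop_atBot tendsto_id
  have t2 := intervalIntegral_tendsto_integral hvint (hn.comp tendsto_neg_atTop_atBot) hp
  simp only [id, hcurve] at t1
  simp only [hvert, Function.comp] at t2
  have hdiff : ∀ {l : Filter ℝ} {p : ℝ → ℝ}, Tendsto (fun X => |(γ (p X)).im|) l atTop →
      Tendsto (fun X => Φ (γ (p X)) - Φ (σ + (γ (p X)).im * Complex.I)) l (nhds 0) := by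
    intro l p hl
    refine squeeze_zero_norm' (a := fun X => A / (|(γ (p X)).im|) ^ 2 * (Real.exp (t * σ) / t))
      ?_ ?_
    · filter_upwards [hl.eventually_ge_atTop 1] with X hX
      rw [sq_abs]
      exact norm_primitive_sub_le ht hA hF hΦ hFb (hreg _) (hre _) hX
    · have : Tendsto (fun X => A / (|(γ (p X)).im|) ^ 2) l (nhds 0) :=
        tendsto_const_nhds.div_atTop ((tendsto_pow_atTop two_ne_zero).comp hl)
      simpa using this.mul_const (Real.exp (t * σ) / t)
  have d1 := hdiff (l := atTop) (p := fun X => X) (tendsto_abs_atTop_atTop.comp hp)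
  have d2 := hdiff (l := atTop) (p := fun X => -X)
    (tendsto_abs_atBot_atTop.comp (hn.comp tendsto_neg_atTop_atBot))
  have t3 := (t1.sub t2).sub (d1.sub d2)
  have e : ∀ X : ℝ, Φ (γ X) - Φ (γ (-X)) - (Φ (σ + (γ X).im * Complex.I) -
      Φ (σ + (γ (-X)).im * Complex.I)) - (Φ (γ X) - Φ (σ + (γ X).im * Complex.I) -
      (Φ (γ (-X)) - Φ (σ + (γ (-X)).im * Complex.I))) = 0 := by intro X; ring
  simp only [e, sub_zero] at t3
  have := tendsto_nhds_unique t3 tendsto_const_nhds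
  rw [sub_eq_zero] at this
  rw [this, integral_mul_const, verticalInv]
  have hpi : (π : ℂ) ≠ 0 := by exact_mod_cast Real.pi_ne_zero
  generalize (∫ y : ℝ, Complex.exp ((σ + y * Complex.I) * t) * F (σ + y * Complex.I)) = J
  field_simp

open MeasureTheory in
/-- Representation of the solution by a contour integral. -/
theorem IsSolution.eq_integral_contour {T : ℝ} {G₀ : Fin 2 → ℂ} {G : Fin 2 → ℝ → ℂ}
    (hG : M.IsSolution T G₀ G) (j : Fin 2) {γ γ' : ℝ → ℂ}
    (hγ : ∀ x, HasDerivAt γ (γ' x) x) (hγ' : Continuous γ') (hreg : ∀ x, γ x ∈ M.region)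
    {ε : ℝ} (hε : 0 < ε) (hεγ : ∀ x, ε ≤ ‖γ x‖) {σ : ℝ}
    (hre : ∀ x, (γ x).re ≤ σ) (hp : Tendsto (fun x => (γ x).im) atTop atTop)
    (hn : Tendsto (fun x => (γ x).im) atBot atBot)
    (hint : ∀ t : ℝ, 0 < t → Integrable fun x => Complex.exp (γ x * t) * M.Ghat G₀ j (γ x) * γ' x)
    {t : ℝ} (ht : t ∈ Ioc 0 T) :
    ∫ x, 1 / (2 * π * Complex.I) * Complex.exp (γ x * t) * M.Ghat G₀ j (γ x) * γ' x = G j t := by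
  have h1 := M.one_le_abscissa
  set σ' := max σ (M.abscissa + 1) with hσ'
  have hσ1 : M.abscissa < σ' := lt_of_lt_of_le (by linarith) (le_max_right _ _)
  have hγc : Continuous γ := continuous_iff_continuousAt.mpr fun x => (hγ x).continuousAt
  have hγ0 : ∀ x, γ x ≠ 0 := fun x => norm_pos_iff.mp (hε.trans_le (hεγ x))
  have hGc : Continuous fun x => M.Ghat G₀ j (γ x) :=
    (M.differentiableOn_Ghat G₀ j).continuousOn.comp_continuous hγc hreg
  have hne : ∀ z ∈ M.region, z ≠ 0 := fun z hz =>
    Complex.slitPlane_ne_zero (mem_slitPlane_of_mem_region hz)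
  have hint' : ∀ s : ℝ, 0 < s → Integrable fun x =>
      Complex.exp (γ x * s) * (M.Ghat G₀ j (γ x) * (γ x)⁻¹) * γ' x := by
    intro s hs
    refine ((hint s hs).bdd_mul (c := ε⁻¹) (f := fun x => (γ x)⁻¹)
      (hγc.inv₀ hγ0).aestronglyMeasurable (Eventually.of_forall fun x => ?_)).congr
      (Eventually.of_forall fun x => by simp only; ring)
    rw [norm_inv]
    exact inv_anti₀ hε (hεγ x)
  set P : ℝ → ℂ := fun s => ∫ x, Complex.exp (γ x * s) * (M.Ghat G₀ j (γ x) * (γ x)⁻¹) * γ' x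
    with hP
  -- The primitive is represented first, since its symbol `Ghat / z` decays quadratically; the
  -- factor `1 / z` disappears on differentiating in time.
  have hrep : ∀ s ∈ Ioc 0 T, ∫ τ in (0:ℝ)..s, G j τ = 1 / (2 * π * Complex.I) * P s := by
    intro s hs
    rw [hG.integral_eq_primCand hσ1 j ⟨hs.1.le, hs.2⟩, primCand, hP]
    simp only
    rw [integral_contour_eq (F := fun z => M.Ghat G₀ j z * z⁻¹) (A := M.ghatConst G₀ j) hs.1 hσ1
      ?_ ?_ hγ hγ' hreg (fun x => (hre x).trans (le_max_left _ _)) hp hn (hint' s hs.1)]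
    · have hpi : (π : ℂ) ≠ 0 := by exact_mod_cast Real.pi_ne_zero
      field_simp
    · exact (M.differentiableOn_Ghat G₀ j).mul (differentiableOn_id.inv hne)
    · intro z hz hz1
      have h2 := M.norm_Ghat_le_const (radius_lt_norm_of_mem_region hz) hz1 G₀ j
      rw [norm_mul, norm_inv]
      calc ‖M.Ghat G₀ j z‖ * ‖z‖⁻¹ ≤ M.ghatConst G₀ j * ‖z‖⁻¹ * ‖z‖⁻¹ := by gcongr
        _ = _ := by rw [div_eq_mul_inv, sq, mul_inv, mul_assoc]
  have hder : HasDerivAt P (∫ x, Complex.exp (γ x * t) * M.Ghat G₀ j (γ x) * γ' x) t := by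
    have hnb : Ioo (t / 2) (2 * t) ∈ nhds t := Ioo_mem_nhds (by linarith [ht.1]) (by linarith [ht.1])
    refine (hasDerivAt_integral_of_dominated_loc_of_deriv_le (μ := volume)
      (F := fun (s : ℝ) x => Complex.exp (γ x * s) * (M.Ghat G₀ j (γ x) * (γ x)⁻¹) * γ' x)
      (F' := fun (s : ℝ) x => Complex.exp (γ x * s) * M.Ghat G₀ j (γ x) * γ' x)
      (bound := fun x => ‖Complex.exp (γ x * (t / 2 : ℝ)) * M.Ghat G₀ j (γ x) * γ' x‖ +
        ‖Complex.exp (γ x * (2 * t : ℝ)) * M.Ghat G₀ j (γ x) * γ' x‖) hnb ?_ (hint' t ht.1)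
      (hint t ht.1).aestronglyMeasurable ?_
      ((hint _ (by linarith [ht.1])).norm.add (hint _ (by linarith [ht.1])).norm) ?_).2
    · refine Eventually.of_forall fun s => Continuous.aestronglyMeasurable ?_
      exact ((by fun_prop : Continuous fun x => Complex.exp (γ x * s)).mul
        (hGc.mul (hγc.inv₀ hγ0))).mul hγ'
    · refine Eventually.of_forall fun x s hs => ?_
      simp only [norm_mul, Complex.norm_exp]
      have e : ∀ r : ℝ, (γ x * (r : ℂ)).re = (γ x).re * r := by intro r; simp
      rw [e, e, e, ← add_mul, ← add_mul]
      -- One end of the time window dominates, depending on the sign of `Re γ`; both majorants are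
      -- integrable by `hint`.
      have hexp : Real.exp ((γ x).re * s) ≤
          Real.exp ((γ x).re * (t / 2)) + Real.exp ((γ x).re * (2 * t)) := by
        rcases le_total 0 (γ x).re with h | h
        · have := Real.exp_le_exp.mpr (mul_le_mul_of_nonneg_left hs.2.le h)
          linarith [Real.exp_pos ((γ x).re * (t / 2))]
        · have := Real.exp_le_exp.mpr (mul_le_mul_of_nonpos_left hs.1.le h)
          linarith [Real.exp_pos ((γ x).re * (2 * t))]
      gcongr
    · refine Eventually.of_forall fun x s _ => ?_
      have h2 : HasDerivAt (fun s : ℝ => Complex.exp (γ x * s))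
          (Complex.exp (γ x * s) * (γ x * 1)) s := by
        exact ((Complex.ofRealCLM.hasDerivAt (x := s)).const_mul (γ x)).cexp
      refine ((h2.mul_const (M.Ghat G₀ j (γ x) * (γ x)⁻¹)).mul_const (γ' x)).congr_deriv ?_
      have := hγ0 x
      field_simp
  -- Left derivatives are compared, because `t = T` is allowed.
  have hV : HasDerivWithinAt (fun s => ∫ τ in (0:ℝ)..s, G j τ) (G j t) (Iic t) t := by
    have hc := hG.continuousOn j
    have hsub : Icc 0 t ⊆ Icc 0 T := Icc_subset_Icc le_rfl ht.2
    refine intervalIntegral.integral_hasDerivWithinAt_right (s := Iic t) (t := Iic t)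
      ((hc.mono (by rw [uIcc_of_le ht.1.le]; exact hsub)).intervalIntegrable) ?_ ?_
    · exact ⟨Icc 0 t, Icc_mem_nhdsLE ht.1, (hc.mono hsub).aestronglyMeasurable measurableSet_Icc⟩
    · exact ((hc.mono hsub) t ⟨ht.1.le, le_rfl⟩).mono_of_mem_nhdsWithin (Icc_mem_nhdsLE ht.1)
  have hV2 : HasDerivWithinAt (fun s => ∫ τ in (0:ℝ)..s, G j τ)
      (1 / (2 * π * Complex.I) * ∫ x, Complex.exp (γ x * t) * M.Ghat G₀ j (γ x) * γ' x)
      (Iic t) t := by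
    refine ((hder.const_mul (1 / (2 * π * Complex.I))).hasDerivWithinAt).congr_of_eventuallyEq
      ?_ (hrep t ht)
    filter_upwards [Ioc_mem_nhdsLE ht.1] with s hs
    exact hrep s ⟨hs.1, hs.2.trans ht.2⟩
  have huniq := (uniqueDiffWithinAt_Iic t).eq_deriv _ hV hV2
  rw [huniq, ← integral_const_mul]
  congr 1
  ext x
  ring

end FeynmanKac

/-! ### Fourier integrals and the general error of the method. -/

open MeasureTheory in
/-- A Fourier integral is bounded after shifting the line of integration. -/
theorem norm_integral_mul_exp_le {f : ℂ → ℂ} {c ω D J : ℝ}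
    (hf : DifferentiableOn ℂ f {z | z.im ∈ uIcc 0 c})
    (hD : ∀ x y : ℝ, y ∈ uIcc 0 c → ‖f (x + y * Complex.I)‖ ≤ D * (1 + x ^ 2)⁻¹)
    (hJ : ∫ x : ℝ, ‖f (x + c * Complex.I)‖ ≤ J) :
    ‖∫ x : ℝ, f x * Complex.exp (ω * x * Complex.I)‖ ≤ J * Real.exp (-(ω * c)) := by
  have hcont : ∀ y ∈ uIcc 0 c, Continuous fun x : ℝ => f (x + y * Complex.I) := fun y hy =>
    hf.continuousOn.comp_continuous (by fun_prop) fun x => by simpa using hy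
  have hnorm : ∀ x y : ℝ, ‖Complex.exp (ω * (x + y * Complex.I) * Complex.I)‖ =
      Real.exp (-(ω * y)) := by
    intro x y
    rw [Complex.norm_exp]
    congr 1
    simp
  have hint : ∀ y ∈ uIcc 0 c, Integrable fun x : ℝ =>
      f (x + y * Complex.I) * Complex.exp (ω * (x + y * Complex.I) * Complex.I) := by
    intro y hy
    refine (integrable_inv_one_add_sq.const_mul (D * Real.exp (-(ω * y)))).mono'
      ((hcont y hy).mul (by fun_prop)).aestronglyMeasurable (Eventually.of_forall fun x => ?_)
    rw [norm_mul, hnorm, mul_right_comm]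
    exact mul_le_mul_of_nonneg_right (hD x y hy) (Real.exp_pos _).le
  have h0 : (0 : ℝ) ∈ uIcc 0 c := left_mem_uIcc
  have hc : c ∈ uIcc 0 c := right_mem_uIcc
  have hD0 : 0 ≤ D := by
    have := (norm_nonneg _).trans (hD 0 0 h0)
    simpa using this
  have hshift := integral_shift_im (f := fun z => f z * Complex.exp (ω * z * Complex.I)) (c := c)
    (hf.mul (by fun_prop)) (b := fun x => D * Real.exp (|ω| * |c|) * (1 + x ^ 2)⁻¹) ?_ ?_
    (by simpa using hint 0 h0) (hint c hc)
  · rw [hshift]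
    refine (norm_integral_le_integral_norm _).trans ?_
    simp only [norm_mul, hnorm]
    rw [integral_mul_const]
    exact mul_le_mul_of_nonneg_right hJ (Real.exp_pos _).le
  · have : Tendsto (fun x : ℝ => (1 + x ^ 2)⁻¹) atTop (nhds 0) :=
      tendsto_inv_atTop_zero.comp (tendsto_atTop_add_const_left _ _ (tendsto_pow_atTop two_ne_zero))
    simpa using this.const_mul (D * Real.exp (|ω| * |c|))
  · intro x y hy
    rw [norm_mul, hnorm, sq_abs, mul_right_comm]
    have hyc : |y| ≤ |c| := by
      have := abs_sub_left_of_mem_uIcc hy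
      simpa using this
    refine mul_le_mul (hD x y hy) (Real.exp_le_exp.mpr ?_) (Real.exp_pos _).le (by positivity)
    calc -(ω * y) ≤ |ω * y| := neg_le_abs _
      _ = |ω| * |y| := abs_mul _ _
      _ ≤ |ω| * |c| := by gcongr

/-- The strip is open, so estimates hold for shifts `c < a`; continuity in `c` reaches the full
width `a`. -/
theorem le_mul_exp_of_forall_lt {I A ω a : ℝ} (ha : 0 < a)
    (h : ∀ c, 0 ≤ c → c < a → I ≤ A * Real.exp (-(ω * c))) : I ≤ A * Real.exp (-(ω * a)) := by
  have hc : Tendsto (fun c => A * Real.exp (-(ω * c))) (nhdsWithin a (Iio a))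
      (nhds (A * Real.exp (-(ω * a)))) :=
    ((by fun_prop : Continuous fun c => A * Real.exp (-(ω * c))).tendsto a).mono_left
      nhdsWithin_le_nhds
  refine ge_of_tendsto hc ?_
  filter_upwards [self_mem_nhdsWithin, nhdsWithin_le_nhds (Ioi_mem_nhds ha)] with c hc hc'
  exact h c (le_of_lt hc') hc

theorem exp_neg_pow_div (u : ℝ) (hu : 0 < u) :
    Real.exp (-u) / (1 - Real.exp (-u)) = 1 / (Real.exp u - 1) := by
  have h1 : 1 < Real.exp u := Real.one_lt_exp_iff.mpr hu
  rw [Real.exp_neg]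
  have : Real.exp u - 1 ≠ 0 := by linarith
  have h2 : 1 - (Real.exp u)⁻¹ ≠ 0 := by
    have : (Real.exp u)⁻¹ < 1 := inv_lt_one_of_one_lt₀ h1
    linarith
  field_simp

theorem exp_neg_le_inv {u : ℝ} (hu : 0 < u) : Real.exp (-u) ≤ u⁻¹ := by
  rw [Real.exp_neg]
  exact inv_anti₀ hu (by linarith [Real.add_one_le_exp u])

namespace FeynmanKac

variable {M : FeynmanKac}

theorem differentiableOn_integrand (G₀ : Fin 2 → ℂ) (j : Fin 2) {z : ℂ → ℂ}
    (hz : Differentiable ℂ z) (t : ℝ) {S : Set ℂ} (hS : ∀ φ ∈ S, z φ ∈ M.region) :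
    DifferentiableOn ℂ (M.integrand G₀ j z t) S := by
  unfold integrand
  refine DifferentiableOn.mul (DifferentiableOn.mul ?_ ?_) hz.deriv.differentiableOn
  · exact (by fun_prop : Differentiable ℂ fun φ => 1 / (2 * π * Complex.I) *
      Complex.exp (z φ * t)).differentiableOn
  · exact (M.differentiableOn_Ghat G₀ j).comp hz.differentiableOn hS

theorem norm_integrand (G₀ : Fin 2 → ℂ) (j : Fin 2) (z : ℂ → ℂ) (t : ℝ) (φ : ℂ) :
    ‖M.integrand G₀ j z t φ‖ = (2 * π)⁻¹ * Real.exp ((z φ).re * t) * ‖M.Ghat G₀ j (z φ)‖ *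
      ‖deriv z φ‖ := by
  simp [integrand, Complex.norm_exp, abs_of_pos Real.pi_pos]

open MeasureTheory in
/-- The error of the contour integral method in terms of Fourier integrals and truncation. -/
theorem IsSolution.norm_sub_cim_le {T : ℝ} {G₀ : Fin 2 → ℂ} {G : Fin 2 → ℝ → ℂ}
    (hG : M.IsSolution T G₀ G) (j : Fin 2) {z : ℂ → ℂ} (hz : Differentiable ℂ z)
    (hreg : ∀ x : ℝ, z x ∈ M.region) {ε σ : ℝ} (hε : 0 < ε) (hεz : ∀ x : ℝ, ε ≤ ‖z x‖)
    (hre : ∀ x : ℝ, (z x).re ≤ σ) (hp : Tendsto (fun x : ℝ => (z x).im) atTop atTop)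
    (hn : Tendsto (fun x : ℝ => (z x).im) atBot atBot)
    (hD : ∀ t : ℝ, 0 < t → ∃ D, ∀ x : ℝ, ‖M.integrand G₀ j z t x‖ ≤ D * (1 + x ^ 2)⁻¹)
    {t : ℝ} (ht : t ∈ Ioc 0 T) {h : ℝ} (hh : 0 < h) {A B u w : ℝ} (hu : 0 < u) (hw : 0 < w)
    (hA : ∀ n : ℕ, 1 ≤ n → ‖∫ x : ℝ, M.integrand G₀ j z t x *
      Complex.exp (((2 * π * n / h : ℝ) : ℂ) * x * Complex.I)‖ ≤ A * Real.exp (-(n * u)))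
    (hB : ∀ n : ℕ, 1 ≤ n → ‖∫ x : ℝ, M.integrand G₀ j z t x *
      Complex.exp (((-(2 * π * n / h) : ℝ) : ℂ) * x * Complex.I)‖ ≤ B * Real.exp (-(n * w)))
    {N : ℕ} (hN : 1 ≤ N) {b : ℕ → ℝ} {S : ℝ}
    (hb : ∀ (m : ℕ) (x : ℝ), |x| = (N + m) * h → ‖M.integrand G₀ j z t x‖ ≤ b m)
    (hS : ∀ n, h * ∑ m ∈ Finset.range n, b m ≤ S) :
    ‖G j t - M.cim G₀ j z h N t‖ ≤
      A * (1 / (Real.exp u - 1)) + B * (1 / (Real.exp w - 1)) + 2 * S := by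
  have hcont : ∀ t : ℝ, Continuous fun x : ℝ => M.integrand G₀ j z t x := fun t =>
    (differentiableOn_integrand (S := {φ | z φ ∈ M.region}) G₀ j hz t
      fun _ h => h).continuousOn.comp_continuous Complex.continuous_ofReal hreg
  have hγ : ∀ x : ℝ, HasDerivAt (fun x : ℝ => z x) (deriv z x) x := fun x =>
    ((hz x).hasDerivAt).comp_ofReal
  have hrep := hG.eq_integral_contour j (γ := fun x => z x) (γ' := fun x => deriv z x) hγ
    (hz.deriv.continuous.comp Complex.continuous_ofReal) hreg hε hεz hre hp hn ?_ ht
  · have hpow : ∀ (v : ℝ) (n : ℕ), Real.exp (-(n * v)) = Real.exp (-v) ^ n := by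
      intro v n
      rw [← Real.exp_nat_mul]
      congr 1
      ring
    obtain ⟨D, hD'⟩ := hD t ht.1
    have hbn : ∀ m : ℕ, ‖M.integrand G₀ j z t (((N + m : ℕ) * h : ℝ) : ℂ)‖ ≤ b m := fun m =>
      hb m _ (by rw [abs_of_nonneg (by positivity)]; push_cast; ring)
    have hb0 : ∀ m, 0 ≤ b m := fun m => (norm_nonneg _).trans (hbn m)
    have hS' : ∀ n, ∑ m ∈ Finset.range n, b m ≤ S / h := fun n => by
      rw [le_div_iff₀ hh, mul_comm]
      exact hS n
    have key := trapezoid_error (hcont t) hD' hh (Real.exp_pos (-u)).le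
      (Real.exp_lt_one_iff.mpr (by linarith)) (Real.exp_pos (-w)).le
      (Real.exp_lt_one_iff.mpr (by linarith)) (A := A) (B := B)
      (fun n hn' => (hA n hn').trans_eq (by rw [hpow]))
      (fun n hn' => le_trans (le_of_eq ?_) ((hB n hn').trans_eq (by rw [hpow]))) hN
      (summable_of_sum_range_le hb0 hS')
      (fun m => hbn m) (fun m => hb m _ ?_)
    · rw [exp_neg_pow_div u hu, exp_neg_pow_div w hw] at key
      have e : (∫ x : ℝ, M.integrand G₀ j z t x) = G j t := hrep
      rw [e] at key
      refine key.trans ?_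
      have h3 : ∑' m, b m ≤ S / h := Real.tsum_le_of_sum_range_le hb0 hS'
      have h4 : 2 * h * ∑' m, b m ≤ 2 * S := by
        calc 2 * h * ∑' m, b m ≤ 2 * h * (S / h) := by gcongr
          _ = _ := by field_simp
      linarith
    · congr 2
      ext x
      push_cast
      ring_nf
    · rw [abs_neg, abs_of_nonneg (by positivity)]
      push_cast; ring
  · intro s hs
    obtain ⟨D, hD'⟩ := hD s hs
    have h1 : Integrable fun x : ℝ => M.integrand G₀ j z s x :=
      (integrable_inv_one_add_sq.const_mul D).mono' (hcont s).aestronglyMeasurable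
        (Eventually.of_forall hD')
    refine (h1.const_mul (2 * π * Complex.I)).congr (Eventually.of_forall fun x => ?_)
    have hpi : (π : ℂ) ≠ 0 := by exact_mod_cast Real.pi_ne_zero
    simp only [integrand]
    field_simp

end FeynmanKac

/-! ### The parabolic contour. -/

theorem differentiable_parabola (η : ℝ) : Differentiable ℂ (parabola η) := by
  unfold parabola; fun_prop

theorem deriv_parabola (η : ℝ) (φ : ℂ) :
    deriv (parabola η) φ = 2 * η * Complex.I * (Complex.I * φ + 1) := by
  have h : HasDerivAt (fun φ : ℂ => Complex.I * φ + 1) (Complex.I * 1) φ :=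
    ((hasDerivAt_id φ).const_mul Complex.I).add_const 1
  have := ((h.pow 2).const_mul (η : ℂ)).deriv
  refine Eq.trans this ?_
  push_cast
  ring

theorem parabola_eq (η x c : ℝ) :
    parabola η (x + c * Complex.I) = η * (((1 - c : ℝ) : ℂ) + x * Complex.I) ^ 2 := by
  unfold parabola
  congr 2
  push_cast
  linear_combination (c : ℂ) * Complex.I_sq

theorem norm_parabola {η : ℝ} (hη : 0 < η) (x c : ℝ) :
    ‖parabola η (x + c * Complex.I)‖ = η * ((1 - c) ^ 2 + x ^ 2) := by
  rw [parabola_eq, norm_mul, norm_pow, QuadDecay.norm_sq, Complex.norm_real,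
    Real.norm_of_nonneg hη.le]

theorem parabola_re (η x c : ℝ) :
    (parabola η (x + c * Complex.I)).re = η * ((1 - c) ^ 2 - x ^ 2) := by
  rw [parabola_eq]
  simp [sq]

theorem parabola_im (η x c : ℝ) :
    (parabola η (x + c * Complex.I)).im = 2 * η * (1 - c) * x := by
  rw [parabola_eq]
  simp [sq]
  ring

theorem norm_deriv_parabola {η : ℝ} (hη : 0 < η) (x c : ℝ) :
    ‖deriv (parabola η) (x + c * Complex.I)‖ = 2 * η * √((1 - c) ^ 2 + x ^ 2) := by
  have e : Complex.I * (x + c * Complex.I) + 1 = ((1 - c : ℝ) : ℂ) + x * Complex.I := by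
    push_cast
    linear_combination (c : ℂ) * Complex.I_sq
  rw [deriv_parabola, e, norm_mul, ← QuadDecay.norm_sq, Real.sqrt_sq (norm_nonneg _)]
  simp [abs_of_pos hη]

namespace FeynmanKac

variable {M : FeynmanKac}

/-- The strip hypothesis is needed only at the vertices `φ = i c`, as `c → a`; this one inequality
keeps all lines `Im φ < a` in `region`. -/
theorem radius_le_of_parabola {η a d : ℝ} (hη : 0 < η) (ha : 0 < a) (hd : 0 < d)
    (h : ∀ φ ∈ strip d a, M.radius < ‖parabola η φ‖) : M.radius ≤ η * (1 - a) ^ 2 := by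
  have hc : Tendsto (fun c => η * (1 - c) ^ 2) (nhdsWithin a (Iio a)) (nhds (η * (1 - a) ^ 2)) :=
    ((by fun_prop : Continuous fun c : ℝ => η * (1 - c) ^ 2).tendsto a).mono_left
      nhdsWithin_le_nhds
  refine ge_of_tendsto hc ?_
  filter_upwards [self_mem_nhdsWithin, nhdsWithin_le_nhds (Ioi_mem_nhds ha)] with c hc hc'
  have := h ((0 : ℝ) + c * Complex.I) ⟨by simp; linarith [mem_Ioi.mp hc'], by simpa using hc⟩
  rw [norm_parabola hη] at this
  simpa using this.le

/-- The parabola has its focus at the origin, like `region`: `‖z‖ + z.re = 2 η (1 - c) ^ 2` all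
along it. -/
theorem parabola_mem_region {η a : ℝ} (hη : 0 < η) (hR : M.radius ≤ η * (1 - a) ^ 2)
    (ha : a < 1) {c : ℝ} (hc : c < a) (x : ℝ) : parabola η (x + c * Complex.I) ∈ M.region := by
  show 2 * M.radius < _
  rw [norm_parabola hη, parabola_re]
  have : η * (1 - a) ^ 2 < η * (1 - c) ^ 2 := by
    have : (1 - a) ^ 2 < (1 - c) ^ 2 := by gcongr
    gcongr
  nlinarith

/-- The maximum in the parabolic error bound. -/
noncomputable def parabolaConst (M : FeynmanKac) (j : Fin 2) (a : ℝ) : ℝ :=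
  max (16 * (1 - a)⁻¹) (64 * |M.C (1 - j)| * (1 - a) ^ (-(1 + 2 * M.α (1 - j))))

theorem parabolaConst_pos (M : FeynmanKac) (j : Fin 2) {a : ℝ} (ha : a < 1) :
    0 < M.parabolaConst j a :=
  lt_of_lt_of_le (by have : 0 < 1 - a := by linarith
                     positivity) (le_max_left _ _)

/-- With `r = (1 - c) ^ 2 + x ^ 2`, `Ghat` contributes `1 / (η r)` and the contour derivative `2 η
√r`, so `1 / √r` survives. The factor `(1 - c) / √r ≤ 1` is dropped in the Fourier integrals but
needed for the truncation with large steps. -/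
theorem norm_integrand_parabola_le (G₀ : Fin 2 → ℂ) (j : Fin 2) {η a : ℝ} (hη : 0 < η)
    (hR : M.radius ≤ η * (1 - a) ^ 2) (ha : a < 1) {c : ℝ} (hc : c < a) (t x : ℝ) :
    ‖M.integrand G₀ j (parabola η) t (x + c * Complex.I)‖ ≤
      M.parabolaConst j a / (2 * π) * (‖G₀ j‖ + η ^ (-M.α (1 - j)) * ‖G₀ (1 - j)‖) *
        Real.exp (η * t * ((1 - c) ^ 2 - x ^ 2)) * ((1 - c) / √((1 - c) ^ 2 + x ^ 2)) := by
  have hα := M.α_mem (1 - j)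
  set β := M.α (1 - j)
  set s := 1 - c with hs
  set C := |M.C (1 - j)|
  have hC : 0 ≤ C := abs_nonneg _
  have hs0 : 0 < s := by rw [hs]; linarith
  have ha0 : 0 < 1 - a := by linarith
  have hsa : 1 - a ≤ s := by rw [hs]; linarith
  set r := s ^ 2 + x ^ 2 with hr
  have hr0 : 0 < r := by positivity
  have hz := radius_lt_norm_of_mem_region (parabola_mem_region hη hR ha hc x)
  have hb := norm_Ghat_le hz G₀ j
  rw [norm_integrand, parabola_re, norm_deriv_parabola hη]
  rw [norm_parabola hη] at hb
  have hpow : (η * r) ^ (-β) ≤ η ^ (-β) * s ^ (-(2 * β)) := by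
    rw [Real.mul_rpow hη.le hr0.le]
    gcongr
    calc r ^ (-β) ≤ (s ^ 2) ^ (-β) :=
          Real.rpow_le_rpow_of_nonpos (by positivity) (by nlinarith [sq_nonneg x]) (by linarith [hα.1])
      _ = s ^ (-(2 * β)) := by
          rw [← Real.rpow_natCast, ← Real.rpow_mul hs0.le]
          congr 1
          push_cast
          ring
  have hm1 : 16 * s⁻¹ ≤ M.parabolaConst j a := by
    refine le_trans ?_ (le_max_left _ _)
    gcongr
  have hm2 : 64 * C * (s ^ (-(2 * β)) * s⁻¹) ≤ M.parabolaConst j a := by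
    refine le_trans ?_ (le_max_right _ _)
    rw [← Real.rpow_neg_one s, ← Real.rpow_add hs0]
    have e : -(2 * β) + -1 = -(1 + 2 * β) := by ring
    rw [e]
    gcongr 64 * C * ?_
    exact Real.rpow_le_rpow_of_nonpos ha0 hsa (by linarith [hα.1])
  have hsq : √r * √r = r := Real.mul_self_sqrt hr0.le
  have hsr : 0 < √r := Real.sqrt_pos.mpr hr0
  have hmain : 16 * (‖G₀ j‖ + 4 * C * (η * r) ^ (-β) * ‖G₀ (1 - j)‖) ≤
      M.parabolaConst j a * (‖G₀ j‖ + η ^ (-β) * ‖G₀ (1 - j)‖) * s := by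
    have h1 : 16 ≤ M.parabolaConst j a * s := by
      rwa [← div_eq_mul_inv, div_le_iff₀ hs0] at hm1
    have h2 : 64 * C * s ^ (-(2 * β)) ≤ M.parabolaConst j a * s := by
      rwa [← mul_assoc, ← div_eq_mul_inv, div_le_iff₀ hs0] at hm2
    have h3 : 64 * C * (η * r) ^ (-β) ≤ M.parabolaConst j a * s * η ^ (-β) := by
      calc 64 * C * (η * r) ^ (-β) ≤ 64 * C * (η ^ (-β) * s ^ (-(2 * β))) := by gcongr
        _ = 64 * C * s ^ (-(2 * β)) * η ^ (-β) := by ring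
        _ ≤ _ := by gcongr
    have h4 := mul_le_mul_of_nonneg_right h3 (norm_nonneg (G₀ (1 - j)))
    have h5 := mul_le_mul_of_nonneg_right h1 (norm_nonneg (G₀ j))
    nlinarith
  calc (2 * π)⁻¹ * Real.exp (η * (s ^ 2 - x ^ 2) * t) * ‖M.Ghat G₀ j (parabola η (x + c * Complex.I))‖ *
        (2 * η * √r)
      ≤ (2 * π)⁻¹ * Real.exp (η * (s ^ 2 - x ^ 2) * t) *
        (8 * ((η * r)⁻¹ * (‖G₀ j‖ + 4 * C * (η * r) ^ (-β) * ‖G₀ (1 - j)‖))) * (2 * η * √r) := by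
        gcongr
    _ = (2 * π)⁻¹ * Real.exp (η * t * (s ^ 2 - x ^ 2)) * (√r)⁻¹ *
        (16 * (‖G₀ j‖ + 4 * C * (η * r) ^ (-β) * ‖G₀ (1 - j)‖)) := by
        have e1 : η * (s ^ 2 - x ^ 2) * t = η * t * (s ^ 2 - x ^ 2) := by ring
        have e2 : (η * r)⁻¹ * (2 * η * √r) = 2 * (√r)⁻¹ := by
          rw [inv_mul_eq_div, div_eq_iff (by positivity)]
          linear_combination 2 * η * (√r)⁻¹ * hsq - 2 * η * √r * inv_mul_cancel₀ hsr.ne'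
        rw [e1]
        linear_combination (2 * π)⁻¹ * Real.exp (η * t * (s ^ 2 - x ^ 2)) * 8 *
          (‖G₀ j‖ + 4 * C * (η * r) ^ (-β) * ‖G₀ (1 - j)‖) * e2
    _ ≤ (2 * π)⁻¹ * Real.exp (η * t * (s ^ 2 - x ^ 2)) * (√r)⁻¹ *
        (M.parabolaConst j a * (‖G₀ j‖ + η ^ (-β) * ‖G₀ (1 - j)‖) * s) := by gcongr
    _ = _ := by
        rw [div_eq_mul_inv, div_eq_mul_inv]
        ring

end FeynmanKac

open MeasureTheory in
/-- Gaussian sums are dominated by the half Gaussian integral. -/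
theorem sum_exp_neg_sq_le {b : ℝ} (hb : 0 < b) (n : ℕ) :
    ∑ m ∈ Finset.range n, Real.exp (-b * ((m + 1 : ℕ) : ℝ) ^ 2) ≤ √(π / b) / 2 := by
  have hanti : AntitoneOn (fun x : ℝ => Real.exp (-b * x ^ 2)) (Icc (0:ℝ) (0 + n)) := by
    intro x hx y hy hxy
    refine Real.exp_le_exp.mpr ?_
    have : x ^ 2 ≤ y ^ 2 := by
      have := hx.1
      gcongr
    nlinarith
  have h1 := hanti.sum_le_integral
  simp only [zero_add] at h1
  refine h1.trans ?_
  rw [← integral_gaussian_Ioi, intervalIntegral.integral_of_le (Nat.cast_nonneg n)]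
  exact setIntegral_mono_set (integrable_exp_neg_mul_sq hb).integrableOn
    (Eventually.of_forall fun x => (Real.exp_pos _).le)
    (LE.le.eventuallyLE Ioc_subset_Ioi_self)

/-- The truncation estimate for the parabola. -/
theorem parabola_truncation {τ h : ℝ} (hτ : 0 < τ) (hh : 0 < h) (hhτ : h < π / τ) {N : ℕ}
    (hN : 1 ≤ N) (n : ℕ) :
    h * ∑ m ∈ Finset.range n, Real.exp (τ * (1 - ((N + m) * h) ^ 2)) /
      √(1 + ((N + m) * h) ^ 2) ≤ √(π / τ) * Real.exp (τ * (1 - (N * h) ^ 2)) := by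
  have hN' : (1 : ℝ) ≤ N := by exact_mod_cast hN
  set E := Real.exp (τ * (1 - (N * h) ^ 2)) with hE
  have hE0 : 0 < E := Real.exp_pos _
  have hexp : ∀ m : ℕ, Real.exp (τ * (1 - ((N + m) * h) ^ 2)) ≤
      E * Real.exp (-(τ * h ^ 2) * (2 * m + m ^ 2)) := by
    intro m
    rw [hE, ← Real.exp_add]
    refine Real.exp_le_exp.mpr ?_
    have h0 : (0:ℝ) ≤ m := Nat.cast_nonneg m
    have : 0 ≤ τ * h ^ 2 * (2 * ((N:ℝ) - 1) * m) := by
      have : (0:ℝ) ≤ N - 1 := by linarith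
      positivity
    nlinarith
  have hτh : 0 < τ * h ^ 2 := by positivity
  -- Small steps: the first term costs `h ≤ √(π / τ) / 2`, and the others at most a half Gaussian
  -- integral, again `√(π / τ) / 2`.
  rcases le_total (τ * h ^ 2) (π / 4) with hc | hc
  · have hterm : ∀ m : ℕ, Real.exp (τ * (1 - ((N + m) * h) ^ 2)) / √(1 + ((N + m) * h) ^ 2) ≤
        E * Real.exp (-(τ * h ^ 2) * (m:ℝ) ^ 2) := by
      intro m
      refine (div_le_self (Real.exp_pos _).le ?_).trans ((hexp m).trans ?_)
      · rw [Real.one_le_sqrt]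
        nlinarith [sq_nonneg ((N + m) * h)]
      · gcongr E * Real.exp ?_
        have h0 : (0:ℝ) ≤ m := Nat.cast_nonneg m
        nlinarith [mul_nonneg hτh.le h0]
    have hsum : ∑ m ∈ Finset.range n, Real.exp (-(τ * h ^ 2) * (m:ℝ) ^ 2) ≤
        1 + √(π / (τ * h ^ 2)) / 2 := by
      calc ∑ m ∈ Finset.range n, Real.exp (-(τ * h ^ 2) * (m:ℝ) ^ 2) ≤
          ∑ m ∈ Finset.range (n + 1), Real.exp (-(τ * h ^ 2) * (m:ℝ) ^ 2) :=
            Finset.sum_le_sum_of_subset_of_nonneg (Finset.range_mono (Nat.le_succ n))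
              fun _ _ _ => (Real.exp_pos _).le
        _ ≤ _ := by
            rw [Finset.sum_range_succ', add_comm]
            have := sum_exp_neg_sq_le hτh n
            simpa using this
    have hsq : h * √(π / (τ * h ^ 2)) = √(π / τ) := by
      rw [← div_div, Real.sqrt_div' _ (sq_nonneg h), Real.sqrt_sq hh.le]
      field_simp
    have hh2 : h ≤ √(π / τ) / 2 := by
      have : 2 * h ≤ √(π / τ) := by
        refine Real.le_sqrt_of_sq_le ?_
        rw [le_div_iff₀ hτ]
        nlinarith
      linarith
    calc h * ∑ m ∈ Finset.range n, Real.exp (τ * (1 - ((N + m) * h) ^ 2)) /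
          √(1 + ((N + m) * h) ^ 2)
        ≤ h * ∑ m ∈ Finset.range n, E * Real.exp (-(τ * h ^ 2) * (m:ℝ) ^ 2) := by
          gcongr with m _
          exact hterm m
      _ ≤ h * (E * (1 + √(π / (τ * h ^ 2)) / 2)) := by
          rw [← Finset.mul_sum]
          gcongr
      _ = (h + h * √(π / (τ * h ^ 2)) / 2) * E := by ring
      _ ≤ _ := by
          rw [hsq]
          gcongr
          linarith
  -- Large steps: the ratio is at most `1 / 4`, so the series is at most `4 / 3`. The factor `1 /
  -- √(1 + h ^ 2)`, with `h < π / τ` and `2 h ≤ 1 + h ^ 2`, compensates the size of `h`.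
  · set q := Real.exp (-(2 * (τ * h ^ 2))) with hq
    have hq0 : 0 ≤ q := (Real.exp_pos _).le
    have hq1 : q ≤ 1 / 4 := by
      have h1 : q ≤ Real.exp (-(3 / 2)) := Real.exp_le_exp.mpr (by linarith [Real.pi_gt_three])
      have h2 : (4 : ℝ) ≤ Real.exp (3 / 2) := by
        have := Real.sum_le_exp_of_nonneg (show (0:ℝ) ≤ 3 / 2 by norm_num) 4
        refine le_trans ?_ this
        norm_num [Finset.sum_range_succ, Nat.factorial]
      rw [Real.exp_neg] at h1
      refine h1.trans ?_
      rw [one_div]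
      exact inv_anti₀ (by norm_num) h2
    have hterm : ∀ m : ℕ, Real.exp (τ * (1 - ((N + m) * h) ^ 2)) / √(1 + ((N + m) * h) ^ 2) ≤
        E / √(1 + h ^ 2) * q ^ m := by
      intro m
      have h0 : (0:ℝ) ≤ m := Nat.cast_nonneg m
      have h1 : √(1 + h ^ 2) ≤ √(1 + ((N + m) * h) ^ 2) := by
        refine Real.sqrt_le_sqrt ?_
        have : h ≤ (N + m) * h := by nlinarith
        gcongr
      have h2 : Real.exp (-(τ * h ^ 2) * (2 * m + m ^ 2)) ≤ q ^ m := by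
        rw [hq, ← Real.exp_nat_mul]
        refine Real.exp_le_exp.mpr ?_
        nlinarith [mul_nonneg hτh.le (sq_nonneg (m:ℝ))]
      have h3 : 0 < √(1 + h ^ 2) := by positivity
      calc _ ≤ E * q ^ m / √(1 + h ^ 2) := by
            gcongr
            exact (hexp m).trans (by gcongr)
        _ = _ := by ring
    have hgeom : ∑ m ∈ Finset.range n, q ^ m ≤ 4 / 3 := by
      have h1 := (summable_geometric_of_lt_one hq0 (by linarith)).sum_le_tsum (Finset.range n)
        (fun m _ => pow_nonneg hq0 m)
      rw [tsum_geometric_of_lt_one hq0 (by linarith)] at h1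
      refine h1.trans ?_
      rw [inv_le_comm₀ (by linarith) (by norm_num)]
      linarith
    have hs : h / √(1 + h ^ 2) * (4 / 3) ≤ √(π / τ) := by
      have h3 : 0 < √(1 + h ^ 2) := by positivity
      refine Real.le_sqrt_of_sq_le ?_
      rw [mul_pow, div_pow, Real.sq_sqrt (by positivity), div_mul_eq_mul_div,
        div_le_iff₀ (by positivity)]
      have : h * (1 + h ^ 2) ≤ π / τ * (1 + h ^ 2) := by gcongr
      nlinarith [sq_nonneg (h - 1), sq_nonneg h]
    calc h * ∑ m ∈ Finset.range n, Real.exp (τ * (1 - ((N + m) * h) ^ 2)) /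
          √(1 + ((N + m) * h) ^ 2)
        ≤ h * ∑ m ∈ Finset.range n, E / √(1 + h ^ 2) * q ^ m := by
          gcongr with m _
          exact hterm m
      _ ≤ h * (E / √(1 + h ^ 2) * (4 / 3)) := by
          rw [← Finset.mul_sum]
          gcongr
      _ = h / √(1 + h ^ 2) * (4 / 3) * E := by ring
      _ ≤ _ := by gcongr

theorem exp_neg_mul_sq_le {τ : ℝ} (hτ : 0 < τ) (x : ℝ) :
    Real.exp (-(τ * x ^ 2)) ≤ Real.exp τ / τ * (1 + x ^ 2)⁻¹ := by
  have h1 := exp_neg_le_inv (u := τ * (1 + x ^ 2)) (by positivity)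
  calc Real.exp (-(τ * x ^ 2)) = Real.exp τ * Real.exp (-(τ * (1 + x ^ 2))) := by
        rw [← Real.exp_add]; congr 1; ring
    _ ≤ Real.exp τ * (τ * (1 + x ^ 2))⁻¹ := by gcongr
    _ = _ := by rw [mul_inv]; ring

namespace FeynmanKac

variable {M : FeynmanKac}

theorem norm_integrand_parabola_le' (G₀ : Fin 2 → ℂ) (j : Fin 2) {η a : ℝ} (hη : 0 < η)
    (hR : M.radius ≤ η * (1 - a) ^ 2) (ha : a < 1) {c : ℝ} (hc : c < a) (t x : ℝ) :
    ‖M.integrand G₀ j (parabola η) t (x + c * Complex.I)‖ ≤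
      M.parabolaConst j a / (2 * π) * (‖G₀ j‖ + η ^ (-M.α (1 - j)) * ‖G₀ (1 - j)‖) *
        Real.exp (η * t * (1 - c) ^ 2) * Real.exp (-(η * t * x ^ 2)) := by
  refine (norm_integrand_parabola_le G₀ j hη hR ha hc t x).trans ?_
  have hP := M.parabolaConst_pos j ha
  have h1 : (1 - c) / √((1 - c) ^ 2 + x ^ 2) ≤ 1 := by
    refine div_le_one_of_le₀ (Real.le_sqrt_of_sq_le ?_) (Real.sqrt_nonneg _)
    nlinarith [sq_nonneg x]
  rw [mul_assoc _ (Real.exp _) (Real.exp _), ← Real.exp_add,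
    show η * t * (1 - c) ^ 2 + -(η * t * x ^ 2) = η * t * ((1 - c) ^ 2 - x ^ 2) by ring]
  exact mul_le_of_le_one_right (by positivity) h1

open MeasureTheory in
theorem norm_fourier_parabola_le (G₀ : Fin 2 → ℂ) (j : Fin 2) {η a : ℝ} (hη : 0 < η)
    (hR : M.radius ≤ η * (1 - a) ^ 2) (ha0 : 0 < a) (ha : a < 1) {c : ℝ} (hc : c < a) {t : ℝ}
    (ht : 0 < t) (ω : ℝ) :
    ‖∫ x : ℝ, M.integrand G₀ j (parabola η) t x * Complex.exp (ω * x * Complex.I)‖ ≤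
      M.parabolaConst j a / (2 * π) * (‖G₀ j‖ + η ^ (-M.α (1 - j)) * ‖G₀ (1 - j)‖) *
        √(π / (η * t)) * Real.exp (η * t * (1 - c) ^ 2) * Real.exp (-(ω * c)) := by
  have hP := M.parabolaConst_pos j ha
  have hτ : 0 < η * t := by positivity
  set A := M.parabolaConst j a / (2 * π) * (‖G₀ j‖ + η ^ (-M.α (1 - j)) * ‖G₀ (1 - j)‖) with hA
  have hA0 : 0 ≤ A := by positivity
  have hlt : ∀ y ∈ uIcc 0 c, y < a := fun y hy => (mem_uIcc.mp hy).elim (fun h => h.2.trans_lt hc)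
    fun h => h.2.trans_lt ha0
  have hbd : ∀ y ∈ uIcc 0 c, (1 - y) ^ 2 ≤ (1 + |c|) ^ 2 := by
    intro y hy
    have hyc : |y| ≤ |c| := by simpa using abs_sub_left_of_mem_uIcc hy
    have := neg_abs_le y
    have := hlt y hy
    have : 0 ≤ 1 - y := by linarith
    gcongr
    linarith
  refine norm_integral_mul_exp_le
    (D := A * Real.exp (η * t * (1 + |c|) ^ 2) * (Real.exp (η * t) / (η * t))) ?_ ?_ ?_
  · refine differentiableOn_integrand G₀ j (differentiable_parabola η) t fun φ hφ => ?_
    rw [← Complex.re_add_im φ]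
    exact parabola_mem_region hη hR ha (hlt _ hφ) _
  · intro x y hy
    refine (norm_integrand_parabola_le' G₀ j hη hR ha (hlt y hy) t x).trans ?_
    rw [mul_assoc _ (Real.exp (η * t) / (η * t))]
    have := hbd y hy
    gcongr
    exact exp_neg_mul_sq_le hτ x
  · have hi : Integrable fun x : ℝ => A * Real.exp (η * t * (1 - c) ^ 2) *
        Real.exp (-(η * t) * x ^ 2) := (integrable_exp_neg_mul_sq hτ).const_mul _
    calc ∫ x : ℝ, ‖M.integrand G₀ j (parabola η) t (x + c * Complex.I)‖ ≤
        ∫ x : ℝ, A * Real.exp (η * t * (1 - c) ^ 2) * Real.exp (-(η * t) * x ^ 2) := by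
          refine integral_mono_of_nonneg (Eventually.of_forall fun x => norm_nonneg _) hi
            (Eventually.of_forall fun x => ?_)
          have := norm_integrand_parabola_le' G₀ j hη hR ha hc t x
          simpa only [neg_mul] using this
      _ = _ := by
          rw [integral_const_mul, integral_gaussian]
          ring

/-- Error bound for the parabolic contour. -/
theorem IsSolution.norm_sub_cim_parabola_le {T : ℝ} {G₀ : Fin 2 → ℂ} {G : Fin 2 → ℝ → ℂ}
    (hG : M.IsSolution T G₀ G) (j : Fin 2) {a η t h : ℝ} {N : ℕ} (ha0 : 0 < a) (ha : a < 1)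
    (hη : 0 < η) (ht : 0 < t) (htT : t ≤ T) (hh : 0 < h) (hhη : h < π / (η * t)) (hN : 1 ≤ N)
    (hR : M.radius ≤ η * (1 - a) ^ 2) :
    ‖G j t - M.cim G₀ j (parabola η) h N t‖ ≤
      M.parabolaConst j a * √(η / π) * t ^ (-(1 / 2) : ℝ) *
        (η⁻¹ * ‖G₀ j‖ + η ^ (-(1 + M.α (1 - j))) * ‖G₀ (1 - j)‖) *
        (Real.exp (η * t) / (Real.exp (2 * π * a / h) - 1) +
          Real.exp (π ^ 2 / (η * t * h ^ 2)) /
            (Real.exp (2 * π ^ 2 / (η * t * h ^ 2) - 2 * π / h) - 1) +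
          Real.exp (η * t) / Real.exp (η * t * (N * h) ^ 2)) := by
  have hP := M.parabolaConst_pos j ha
  set P := M.parabolaConst j a
  set τ := η * t with hτd
  have hτ : 0 < τ := by positivity
  set E := ‖G₀ j‖ + η ^ (-M.α (1 - j)) * ‖G₀ (1 - j)‖ with hE
  have hE0 : 0 ≤ E := by positivity
  set Q := P / (2 * π) * E * √(π / τ) with hQ
  have hQ0 : 0 ≤ Q := by positivity
  have hτh : τ * h < π := by rwa [lt_div_iff₀ hτ, mul_comm] at hhη
  -- The depth minimising `τ (1 + d) ^ 2 - 2 π d / h`, the exponent of the first downward Fourier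
  -- term.
  set d := π / (τ * h) - 1 with hd
  have hd0 : 0 < d := by
    have : 1 < π / (τ * h) := by rw [one_lt_div (by positivity)]; exact hτh
    linarith
  -- Each Fourier sum carries `Q` and the two truncated tails together `2 Q`, so `2 Q` serves as
  -- common prefactor.
  have hQeq : P * √(η / π) * t ^ (-(1 / 2) : ℝ) *
      (η⁻¹ * ‖G₀ j‖ + η ^ (-(1 + M.α (1 - j))) * ‖G₀ (1 - j)‖) = 2 * Q := by
    have e1 : η ^ (-(1 + M.α (1 - j))) = η⁻¹ * η ^ (-M.α (1 - j)) := by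
      rw [neg_add, Real.rpow_add hη, Real.rpow_neg_one]
    have e2 : t ^ (-(1 / 2) : ℝ) = (√t)⁻¹ := by
      rw [Real.rpow_neg ht.le, ← Real.sqrt_eq_rpow]
    have e3 : η⁻¹ * ‖G₀ j‖ + η⁻¹ * η ^ (-M.α (1 - j)) * ‖G₀ (1 - j)‖ = η⁻¹ * E := by
      rw [hE]; ring
    rw [e1, e2, e3, hQ, hτd, Real.sqrt_div hη.le, Real.sqrt_div Real.pi_pos.le,
      Real.sqrt_mul hη.le]
    have s1 := Real.sq_sqrt hη.le
    have s2 := Real.sq_sqrt Real.pi_pos.le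
    have p1 : 0 < √η := Real.sqrt_pos.mpr hη
    have p2 : 0 < √π := Real.sqrt_pos.mpr Real.pi_pos
    have p3 : 0 < √t := Real.sqrt_pos.mpr ht
    generalize √η = x at *
    generalize √π = y at *
    generalize √t = w at *
    rw [← s1, ← s2]
    field_simp
  rw [hQeq]
  have hz : ∀ x : ℝ, parabola η x = parabola η (x + (0:ℝ) * Complex.I) := by intro x; simp
  have hline : ∀ s x : ℝ, ‖M.integrand G₀ j (parabola η) s x‖ ≤
      P / (2 * π) * E * Real.exp (η * s) * Real.exp (-(η * s * x ^ 2)) := by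
    intro s x
    simpa using norm_integrand_parabola_le' G₀ j hη hR ha ha0 s x
  have hmain := hG.norm_sub_cim_le j (differentiable_parabola η) (ε := η) (σ := η)
    (fun x => by rw [hz]; exact parabola_mem_region hη hR ha ha0 x) hη
    (fun x => by rw [hz, norm_parabola hη]; nlinarith [sq_nonneg x, mul_nonneg hη.le (sq_nonneg x)])
    (fun x => by rw [hz, parabola_re]; nlinarith [mul_nonneg hη.le (sq_nonneg x)])
    (by simp only [hz, parabola_im]; exact tendsto_id.const_mul_atTop (by linarith))
    (by simp only [hz, parabola_im]; exact tendsto_id.const_mul_atBot (by linarith))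
    (fun s hs => ⟨P / (2 * π) * E * Real.exp (η * s) * (Real.exp (η * s) / (η * s)), fun x => by
      refine (hline s x).trans ?_
      rw [mul_assoc _ (Real.exp (η * s) / (η * s))]
      gcongr
      exact exp_neg_mul_sq_le (by positivity) x⟩)
    ⟨ht, htT⟩ hh (u := 2 * π * a / h) (w := 2 * π ^ 2 / (τ * h ^ 2) - 2 * π / h)
    (A := Q * Real.exp τ) (B := Q * Real.exp (π ^ 2 / (τ * h ^ 2))) (by positivity)
    (by
      have : 2 * π ^ 2 / (τ * h ^ 2) - 2 * π / h = 2 * π / h * d := by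
        rw [hd]; field_simp
      rw [this]; positivity)
    (fun n _ => by
      have := le_mul_exp_of_forall_lt (ω := 2 * π * n / h) (A := Q * Real.exp τ) ha0
        (fun c hc0 hca => (norm_fourier_parabola_le G₀ j hη hR ha0 ha hca ht
          (2 * π * n / h)).trans ?_)
      · refine this.trans_eq ?_
        congr 2
        ring
      · gcongr
        have : (1 - c) ^ 2 ≤ 1 := by nlinarith
        nlinarith)
    (fun n _ => by
      refine (norm_fourier_parabola_le G₀ j hη hR ha0 ha (c := -d) (by linarith) ht
          (-(2 * π * n / h))).trans_eq ?_
      have e1 : τ * (1 - -d) ^ 2 = π ^ 2 / (τ * h ^ 2) := by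
        rw [hd]; field_simp; ring
      rw [← hτd, e1]
      congr 2
      rw [hd]
      field_simp)
    hN (b := fun m => P / (2 * π) * E * (Real.exp (τ * (1 - ((N + m) * h) ^ 2)) /
      √(1 + ((N + m) * h) ^ 2))) (S := Q * (Real.exp τ / Real.exp (τ * (N * h) ^ 2)))
    (fun m x hx => by
      have := norm_integrand_parabola_le G₀ j hη hR ha ha0 t x
      have hx2 : x ^ 2 = ((N + m) * h) ^ 2 := by rw [← hx, sq_abs]
      rw [hx2] at this
      simp only [sub_zero, one_pow, Complex.ofReal_zero, zero_mul, add_zero] at this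
      refine this.trans_eq ?_
      rw [mul_assoc, mul_one_div])
    (fun n => by
      rw [← Finset.mul_sum]
      have := parabola_truncation hτ hh hhη hN n
      have e : Real.exp τ / Real.exp (τ * (N * h) ^ 2) = Real.exp (τ * (1 - (N * h) ^ 2)) := by
        rw [← Real.exp_sub]; congr 1; ring
      rw [e]
      calc h * (P / (2 * π) * E * ∑ m ∈ Finset.range n, Real.exp (τ * (1 - ((N + m) * h) ^ 2)) /
              √(1 + ((N + m) * h) ^ 2))
          = P / (2 * π) * E * (h * ∑ m ∈ Finset.range n, Real.exp (τ * (1 - ((N + m) * h) ^ 2)) /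
              √(1 + ((N + m) * h) ^ 2)) := by ring
        _ ≤ P / (2 * π) * E * (√(π / τ) * Real.exp (τ * (1 - (N * h) ^ 2))) := by gcongr
        _ = _ := by rw [hQ]; ring)
  refine hmain.trans ?_
  have hx1 : 0 < Real.exp (2 * π * a / h) - 1 := by
    have : 1 < Real.exp (2 * π * a / h) := Real.one_lt_exp_iff.mpr (by positivity)
    linarith
  have hx2 : 0 < Real.exp (2 * π ^ 2 / (τ * h ^ 2) - 2 * π / h) - 1 := by
    have : 1 < Real.exp (2 * π ^ 2 / (τ * h ^ 2) - 2 * π / h) := by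
      refine Real.one_lt_exp_iff.mpr ?_
      have : 2 * π ^ 2 / (τ * h ^ 2) - 2 * π / h = 2 * π / h * d := by
        rw [hd]; field_simp
      rw [this]; positivity
    linarith
  have p1 : 0 ≤ Q * Real.exp τ * (1 / (Real.exp (2 * π * a / h) - 1)) := by positivity
  have p2 : 0 ≤ Q * Real.exp (π ^ 2 / (τ * h ^ 2)) *
    (1 / (Real.exp (2 * π ^ 2 / (τ * h ^ 2) - 2 * π / h) - 1)) := by positivity
  have e : 2 * Q * (Real.exp τ / (Real.exp (2 * π * a / h) - 1) +
      Real.exp (π ^ 2 / (τ * h ^ 2)) / (Real.exp (2 * π ^ 2 / (τ * h ^ 2) - 2 * π / h) - 1) +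
      Real.exp τ / Real.exp (τ * (N * h) ^ 2)) =
      2 * (Q * Real.exp τ * (1 / (Real.exp (2 * π * a / h) - 1))) +
      2 * (Q * Real.exp (π ^ 2 / (τ * h ^ 2)) *
        (1 / (Real.exp (2 * π ^ 2 / (τ * h ^ 2) - 2 * π / h) - 1))) +
      2 * (Q * (Real.exp τ / Real.exp (τ * (N * h) ^ 2))) := by ring
  rw [e]
  linarith

end FeynmanKac

/-! ### Elementary estimates for `cosh`, logarithms and `L`. -/

theorem one_add_sq_div_two_le_cosh (x : ℝ) : 1 + x ^ 2 / 2 ≤ Real.cosh x := by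
  rw [← Real.cosh_abs, ← sq_abs]
  set y := |x| with hy
  have h0 : 0 ≤ y := abs_nonneg x
  have h1 : y / 2 ≤ Real.sinh (y / 2) := Real.self_le_sinh_iff.mpr (by linarith)
  have h2 : Real.cosh y = 1 + 2 * Real.sinh (y / 2) ^ 2 := by
    have := Real.cosh_two_mul (y / 2)
    rw [mul_div_cancel₀ _ (two_ne_zero' ℝ)] at this
    rw [this, Real.cosh_sq]
    ring
  rw [h2]
  nlinarith

/-- The addition formula without its nonnegative `sinh` term; it makes the tails of `exp (-c cosh
x)` Gaussian. -/
theorem cosh_add_ge {a y : ℝ} (ha : 0 ≤ a) (hy : 0 ≤ y) :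
    Real.cosh a * (1 + y ^ 2 / 2) ≤ Real.cosh (a + y) := by
  rw [Real.cosh_add]
  have h1 := mul_le_mul_of_nonneg_left (one_add_sq_div_two_le_cosh y) (Real.cosh_pos a).le
  have h2 := mul_nonneg (Real.sinh_nonneg_iff.mpr ha) (Real.sinh_nonneg_iff.mpr hy)
  linarith

theorem le_log_two_mul_cosh (x : ℝ) : x ≤ Real.log (2 * Real.cosh x) := by
  rw [Real.le_log_iff_exp_le (by have := Real.cosh_pos x; positivity), Real.cosh_eq]
  linarith [Real.exp_pos (-x)]

theorem log_cosh_le {x : ℝ} (hx : 0 ≤ x) : Real.log (Real.cosh x) ≤ x := by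
  rw [Real.log_le_iff_le_exp (Real.cosh_pos x), Real.cosh_eq]
  have : Real.exp (-x) ≤ Real.exp x := Real.exp_le_exp.mpr (by linarith)
  linarith

theorem three_halves_le_cosh {x : ℝ} (hx : 1 ≤ x) : 3 / 2 ≤ Real.cosh x := by
  have := one_add_sq_div_two_le_cosh x
  nlinarith

theorem one_sub_exp_neg_mem {x : ℝ} (hx : 0 < x) : 1 - Real.exp (-x) ∈ Ioo 0 1 :=
  ⟨by have := Real.exp_lt_one_iff.mpr (neg_lt_zero.mpr hx); linarith, by
    linarith [Real.exp_pos (-x)]⟩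

theorem Lfun_eq {x : ℝ} (hx : 0 < x) : Lfun x = 1 - Real.log (1 - Real.exp (-x)) := by
  have h := one_sub_exp_neg_mem hx
  rw [Lfun, abs_of_nonpos (Real.log_nonpos h.1.le h.2.le)]
  ring

theorem one_le_Lfun (x : ℝ) : 1 ≤ Lfun x := by
  unfold Lfun
  linarith [abs_nonneg (Real.log (1 - Real.exp (-x)))]

/-- `L` absorbs `-log γ`, which is the length scale of the long paths used below. -/
theorem one_sub_log_le_Lfun {x : ℝ} (hx : 0 < x) : 1 - Real.log x ≤ Lfun x := by
  have h := one_sub_exp_neg_mem hx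
  rw [Lfun_eq hx]
  have := Real.log_le_log h.1 (show 1 - Real.exp (-x) ≤ x by
    linarith [Real.add_one_le_exp (-x)])
  linarith

theorem one_add_exp_neg_le_Lfun {x : ℝ} (hx : 0 < x) : 1 + Real.exp (-x) ≤ Lfun x := by
  have h := one_sub_exp_neg_mem hx
  rw [Lfun_eq hx]
  linarith [Real.log_le_sub_one_of_pos h.1]

/-- A mean value inequality with variable bound, requiring neither continuity nor integrability of
the derivative. -/
theorem norm_sub_le_integral {F : ℝ → ℂ} {g : ℝ → ℝ} {a b : ℝ} (hab : a ≤ b) (hg : Continuous g)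
    (h : ∀ x ∈ Icc a b, ∃ d, HasDerivAt F d x ∧ ‖d‖ ≤ g x) : ‖F b - F a‖ ≤ ∫ x in a..b, g x := by
  choose! d hd using h
  have hB : ∀ x, HasDerivAt (fun u => ∫ y in a..u, g y) (g x) x := fun x =>
    intervalIntegral.integral_hasDerivAt_right (hg.intervalIntegrable _ _)
      (hg.stronglyMeasurableAtFilter _ _) hg.continuousAt
  refine image_norm_le_of_norm_deriv_right_le_deriv_boundary (f := fun x => F x - F a) (f' := d)
    (a := a) (b := b) (B' := g) ?_ (fun x hx => ?_) ?_ hB (fun x hx => (hd x ⟨hx.1, hx.2.le⟩).2)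
    ⟨hab, le_rfl⟩
  · exact fun x hx => ((hd x hx).1.continuousAt.sub continuousAt_const).continuousWithinAt
  · exact ((hd x ⟨hx.1, hx.2.le⟩).1.sub_const _).hasDerivWithinAt
  · simp

theorem norm_sub_le_mul {F : ℝ → ℂ} {c a b : ℝ} (hab : a ≤ b)
    (h : ∀ x ∈ Icc a b, ∃ d, HasDerivAt F d x ∧ ‖d‖ ≤ c) : ‖F b - F a‖ ≤ c * (b - a) := by
  refine (norm_sub_le_integral hab continuous_const h).trans_eq ?_
  simp [mul_comm]

/-- With `u = c * exp x`, the derivative of `log (1 - exp (-u))` is `u exp (-u) / (1 - exp (-u))`,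
which dominates `exp (-u)` since `1 - exp (-u) ≤ u`. This is the origin of `L`. -/
theorem integral_exp_neg_mul_exp_le {c : ℝ} (hc : 0 < c) {X : ℝ} (hX : 0 ≤ X) :
    ∫ x in (0:ℝ)..X, Real.exp (-(c * Real.exp x)) ≤ -Real.log (1 - Real.exp (-c)) := by
  have hpos : ∀ x, 0 < c * Real.exp x := fun x => by positivity
  have hD : ∀ x, HasDerivAt (fun x => Real.log (1 - Real.exp (-(c * Real.exp x))))
      (Real.exp (-(c * Real.exp x)) * (c * Real.exp x) / (1 - Real.exp (-(c * Real.exp x)))) x := by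
    intro x
    have h1 := ((((Real.hasDerivAt_exp x).const_mul c).neg).exp.const_sub 1).log
      (one_sub_exp_neg_mem (hpos x)).1.ne'
    refine h1.congr_deriv ?_
    congr 1
    simp only [Pi.neg_apply]
    ring
  have hcont : Continuous fun x => Real.exp (-(c * Real.exp x)) * (c * Real.exp x) /
      (1 - Real.exp (-(c * Real.exp x))) :=
    Continuous.div (by fun_prop) (by fun_prop) fun x => (one_sub_exp_neg_mem (hpos x)).1.ne'
  have hint := intervalIntegral.integral_eq_sub_of_hasDerivAt (fun x _ => hD x)
    (hcont.intervalIntegrable 0 X)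
  calc ∫ x in (0:ℝ)..X, Real.exp (-(c * Real.exp x)) ≤ ∫ x in (0:ℝ)..X,
      Real.exp (-(c * Real.exp x)) * (c * Real.exp x) / (1 - Real.exp (-(c * Real.exp x))) := by
        refine intervalIntegral.integral_mono_on hX
          ((by fun_prop : Continuous _).intervalIntegrable _ _) (hcont.intervalIntegrable _ _)
          fun x _ => ?_
        rw [le_div_iff₀ (one_sub_exp_neg_mem (hpos x)).1]
        gcongr
        linarith [Real.add_one_le_exp (-(c * Real.exp x))]
    _ ≤ _ := by
        rw [hint]
        have h := one_sub_exp_neg_mem (hpos X)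
        have := Real.log_nonpos h.1.le h.2.le
        simp only [Real.exp_zero, mul_one]
        linarith

/-- Half-line integral of `exp (-c cosh x)`. -/
theorem integral_exp_neg_cosh_le {c : ℝ} (hc : 0 < c) {X : ℝ} (hX : 0 ≤ X) :
    ∫ x in (0:ℝ)..X, Real.exp (-(c * Real.cosh x)) ≤ Lfun c := by
  have hcont : Continuous fun x => Real.exp (-(c * Real.cosh x)) := by
    have := Real.continuous_cosh
    fun_prop
  have hmono : ∫ x in (0:ℝ)..X, Real.exp (-(c * Real.cosh x)) ≤
      ∫ x in (0:ℝ)..(1 + X), Real.exp (-(c * Real.cosh x)) :=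
    intervalIntegral.integral_mono_interval le_rfl hX (by linarith)
      (Eventually.of_forall fun x => (Real.exp_pos _).le) (hcont.intervalIntegrable _ _)
  refine hmono.trans ?_
  rw [← intervalIntegral.integral_add_adjacent_intervals (hcont.intervalIntegrable 0 1)
    (hcont.intervalIntegrable 1 (1 + X)), Lfun_eq hc]
  have h1 : ∫ x in (0:ℝ)..1, Real.exp (-(c * Real.cosh x)) ≤ 1 := by
    calc ∫ x in (0:ℝ)..1, Real.exp (-(c * Real.cosh x)) ≤ ∫ _ in (0:ℝ)..1, (1:ℝ) := by
          refine intervalIntegral.integral_mono_on zero_le_one (hcont.intervalIntegrable _ _)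
            (continuous_const.intervalIntegrable _ _) fun x _ => ?_
          exact Real.exp_le_one_iff.mpr (by have := Real.cosh_pos x; nlinarith)
      _ = 1 := by simp
  -- Cutting at `1` allows `cosh (1 + x) ≥ exp (1 + x) / 2 ≥ exp x`; the piece on `[0, 1]` is the
  -- summand `1` of `L`.
  have h2 : ∫ x in (1:ℝ)..(1 + X), Real.exp (-(c * Real.cosh x)) ≤
      ∫ x in (0:ℝ)..X, Real.exp (-(c * Real.exp x)) := by
    have e : ∫ x in (1:ℝ)..(1 + X), Real.exp (-(c * Real.cosh x)) =
        ∫ x in (0:ℝ)..X, Real.exp (-(c * Real.cosh (1 + x))) := by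
      rw [intervalIntegral.integral_comp_add_left (fun x => Real.exp (-(c * Real.cosh x))) 1]
      simp
    rw [e]
    refine intervalIntegral.integral_mono_on hX
      ((by have := Real.continuous_cosh; fun_prop : Continuous _).intervalIntegrable _ _)
      ((by fun_prop : Continuous _).intervalIntegrable _ _) fun x _ => ?_
    refine Real.exp_le_exp.mpr (neg_le_neg (mul_le_mul_of_nonneg_left ?_ hc.le))
    rw [Real.cosh_eq, Real.exp_add]
    have := Real.exp_one_gt_d9
    have := Real.exp_pos x
    have := Real.exp_pos (-(1 + x))
    nlinarith
  linarith [integral_exp_neg_mul_exp_le hc hX]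

open MeasureTheory in
theorem integral_exp_neg_sq_le {κ : ℝ} (hκ : 0 < κ) (x₀ : ℝ) {X : ℝ} (hX : x₀ ≤ X) :
    ∫ x in x₀..X, Real.exp (-(κ * ((x - x₀) ^ 2 / 2))) ≤ √(π / (2 * κ)) := by
  rw [intervalIntegral.integral_comp_sub_right (fun x => Real.exp (-(κ * (x ^ 2 / 2)))), sub_self]
  have hk : 0 < κ / 2 := by positivity
  have e : (fun x : ℝ => Real.exp (-(κ * (x ^ 2 / 2)))) = fun x => Real.exp (-(κ / 2) * x ^ 2) := by
    ext x; congr 1; ring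
  rw [e, intervalIntegral.integral_of_le (by linarith)]
  calc _ ≤ ∫ x in Ioi (0:ℝ), Real.exp (-(κ / 2) * x ^ 2) :=
        setIntegral_mono_set (integrable_exp_neg_mul_sq hk).integrableOn
          (Eventually.of_forall fun x => (Real.exp_pos _).le)
          (LE.le.eventuallyLE Ioc_subset_Ioi_self)
    _ = √(π / (2 * κ)) := by
        rw [integral_gaussian_Ioi]
        have : π / (κ / 2) = 2 ^ 2 * (π / (2 * κ)) := by field_simp
        rw [this, Real.sqrt_mul (by norm_num), Real.sqrt_sq (by norm_num)]
        ring

theorem integral_exp_neg_cosh_tail_le {c x₀ : ℝ} (hc : 0 < c) (hx₀ : 0 ≤ x₀) {X : ℝ}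
    (hX : x₀ ≤ X) :
    ∫ x in x₀..X, Real.exp (-(c * Real.cosh x)) ≤
      Real.exp (-(c * Real.cosh x₀)) * √(π / (2 * (c * Real.cosh x₀))) := by
  have hk : 0 < c * Real.cosh x₀ := mul_pos hc (Real.cosh_pos _)
  calc _ ≤ ∫ x in x₀..X, Real.exp (-(c * Real.cosh x₀)) *
        Real.exp (-(c * Real.cosh x₀ * ((x - x₀) ^ 2 / 2))) := by
        refine intervalIntegral.integral_mono_on hX
          ((by have := Real.continuous_cosh; fun_prop : Continuous _).intervalIntegrable _ _)
          ((by fun_prop : Continuous _).intervalIntegrable _ _) fun x hx => ?_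
        rw [← Real.exp_add]
        refine Real.exp_le_exp.mpr ?_
        have := cosh_add_ge hx₀ (sub_nonneg.mpr hx.1)
        rw [add_sub_cancel] at this
        nlinarith [mul_le_mul_of_nonneg_left this hc.le]
    _ ≤ _ := by
        rw [intervalIntegral.integral_const_mul]
        gcongr
        exact integral_exp_neg_sq_le hk x₀ hX

/-- The factor gained in the bound of `Ghat` away from the vertex of the hyperbola. -/
noncomputable def farFactor (x : ℝ) : ℝ := if 3 / 2 ≤ Real.cosh x then 3 / 8 else 1

theorem farFactor_nonneg (x : ℝ) : 0 ≤ farFactor x := by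
  unfold farFactor; split_ifs <;> norm_num

theorem farFactor_le_one (x : ℝ) : farFactor x ≤ 1 := by
  unfold farFactor; split_ifs <;> norm_num

theorem farFactor_of_le {x : ℝ} (hx : 3 / 2 ≤ Real.cosh x) : farFactor x = 3 / 8 := if_pos hx

theorem farFactor_anti {x y : ℝ} (hx : 0 ≤ x) (hxy : x ≤ y) : farFactor y ≤ farFactor x := by
  have h : Real.cosh x ≤ Real.cosh y := by
    rw [Real.cosh_le_cosh, abs_of_nonneg hx, abs_of_nonneg (hx.trans hxy)]
    exact hxy
  by_cases hc : 3 / 2 ≤ Real.cosh x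
  · rw [farFactor_of_le hc, farFactor_of_le (hc.trans h)]
  · rw [farFactor, farFactor, if_neg hc]
    split_ifs <;> norm_num

/-- Full weight is charged on `[0, 1]` at most; from `1` on `cosh ≥ 3 / 2`, and only `3 / 8` counts.
-/
theorem norm_sub_le_farFactor {F : ℝ → ℂ} {c a b : ℝ} (hc : 0 ≤ c) (ha : 0 ≤ a) (hab : a ≤ b)
    (h : ∀ x ∈ Icc a b, ∃ d, HasDerivAt F d x ∧ ‖d‖ ≤ c * farFactor x) :
    ‖F b - F a‖ ≤ c * (5 / 8 + 3 / 8 * (b - a)) := by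
  have hone : ∀ a' b', a ≤ a' → a' ≤ b' → b' ≤ b → ‖F b' - F a'‖ ≤ c * (b' - a') :=
    fun a' b' h1 h2 h3 => norm_sub_le_mul h2 fun x hx => by
      obtain ⟨d, hd, hd'⟩ := h x ⟨h1.trans hx.1, hx.2.trans h3⟩
      exact ⟨d, hd, hd'.trans (mul_le_of_le_one_right hc (farFactor_le_one x))⟩
  have hfar : ∀ a' b', a ≤ a' → 1 ≤ a' → a' ≤ b' → b' ≤ b → ‖F b' - F a'‖ ≤ c * (3 / 8) * (b' - a') :=
    fun a' b' h1 h1' h2 h3 => norm_sub_le_mul h2 fun x hx => by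
      obtain ⟨d, hd, hd'⟩ := h x ⟨h1.trans hx.1, hx.2.trans h3⟩
      rw [farFactor_of_le (three_halves_le_cosh (h1'.trans hx.1))] at hd'
      exact ⟨d, hd, hd'⟩
  rcases le_total b 1 with hb | hb
  · refine (hone a b le_rfl hab le_rfl).trans ?_
    gcongr
    linarith
  rcases le_total 1 a with ha1 | ha1
  · refine (hfar a b le_rfl ha1 hab le_rfl).trans ?_
    rw [mul_assoc]
    gcongr
    linarith
  · have e : F b - F a = (F b - F 1) + (F 1 - F a) := by ring
    rw [e]
    refine (norm_add_le _ _).trans ?_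
    have h1 := hfar 1 b ha1 le_rfl hb le_rfl
    have h2 := hone a 1 le_rfl ha1 hb
    nlinarith

theorem sqrt_pi_div_le {κ : ℝ} (hκ : 0.6931 ≤ κ) : √(π / (2 * κ)) ≤ 1.506 := by
  rw [Real.sqrt_le_left (by norm_num), div_le_iff₀ (by linarith)]
  linarith [Real.pi_lt_d4]

theorem sqrt_pi_div_le' {κ : ℝ} (hκ : 4 ≤ κ) : √(π / (2 * κ)) ≤ 0.627 := by
  rw [Real.sqrt_le_left (by norm_num), div_le_iff₀ (by linarith)]
  linarith [Real.pi_lt_d4]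

theorem log_two_pi_le : Real.log (2 * π) ≤ 1.84 := by
  rw [Real.log_le_iff_le_exp (by positivity)]
  have h1 : (1.84 : ℝ) = 1 + 0.84 := by norm_num
  rw [h1, Real.exp_add]
  have h2 : (2.312 : ℝ) ≤ Real.exp 0.84 := by
    have := Real.sum_le_exp_of_nonneg (show (0:ℝ) ≤ 0.84 by norm_num) 5
    refine le_trans ?_ this
    norm_num [Finset.sum_range_succ, Nat.factorial]
  nlinarith [Real.exp_one_gt_d9, Real.pi_lt_d4]

theorem mul_exp_neg_le (x : ℝ) : x * Real.exp (-x) ≤ 0.368 := by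
  have h1 := Real.add_one_le_exp (x - 1)
  have h2 : x * Real.exp (-x) ≤ Real.exp (-1) := by
    calc x * Real.exp (-x) ≤ Real.exp (x - 1) * Real.exp (-x) := by
          gcongr; linarith
      _ = _ := by rw [← Real.exp_add]; congr 1; ring
  refine h2.trans ?_
  rw [Real.exp_neg, inv_le_comm₀ (Real.exp_pos _) (by norm_num)]
  have := Real.exp_one_gt_d9
  norm_num at this ⊢
  linarith

/-- As `L γ ≥ 1 + exp (-γ) ≥ 1 + exp (-κ)`, it suffices that `√(π / (2 κ)) ≤ 1 + 2 exp (-κ)`, which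
is checked on three ranges of `κ`. -/
theorem sqrt_add_one_le_Lfun {κ γ : ℝ} (hκ : 0.6931 ≤ κ) (hγ : 0 < γ) (h : γ ≤ κ) :
    √(π / (2 * κ)) + 1 ≤ 2 * Lfun γ := by
  have h1 := one_add_exp_neg_le_Lfun hγ
  have h2 := one_le_Lfun γ
  have h3 : Real.exp (-κ) ≤ Real.exp (-γ) := Real.exp_le_exp.mpr (by linarith)
  have he := Real.exp_one_lt_d9
  rcases le_total κ 1 with hc | hc
  · have h4 : Real.exp (-1) ≤ Real.exp (-κ) := Real.exp_le_exp.mpr (by linarith)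
    have h5 : 0.36 ≤ Real.exp (-1) := by
      rw [Real.exp_neg, le_inv_comm₀ (by norm_num) (Real.exp_pos _)]
      norm_num at he ⊢
      linarith
    linarith [sqrt_pi_div_le hκ]
  rcases le_total κ (8 / 5) with hc' | hc'
  · have h4 : Real.exp (-(8 / 5)) ≤ Real.exp (-κ) := Real.exp_le_exp.mpr (by linarith)
    have h5 : 1 / 6 ≤ Real.exp (-(8 / 5)) := by
      rw [Real.exp_neg, one_div]
      refine inv_anti₀ (Real.exp_pos _) ?_
      have e : (8 / 5 : ℝ) = 1 + 3 / 5 := by norm_num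
      have := Real.exp_bound_div_one_sub_of_interval (show (0:ℝ) ≤ 3 / 10 by norm_num) (by norm_num)
      have h6 : Real.exp (3 / 5) = Real.exp (3 / 10) * Real.exp (3 / 10) := by
        rw [← Real.exp_add]; norm_num
      rw [e, Real.exp_add, h6]
      have h7 : Real.exp (3 / 10) ≤ 10 / 7 := this.trans (by norm_num)
      have h8 := Real.exp_pos (3 / 10)
      nlinarith [Real.exp_pos 1, mul_le_mul h7 h7 h8.le (by norm_num)]
    have h6 : √(π / (2 * κ)) ≤ 1.26 := by
      rw [Real.sqrt_le_left (by norm_num), div_le_iff₀ (by linarith)]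
      linarith [Real.pi_lt_d4]
    linarith
  · have h6 : √(π / (2 * κ)) ≤ 1 := by
      rw [Real.sqrt_le_left (by norm_num), div_le_iff₀ (by linarith)]
      linarith [Real.pi_lt_d4]
    linarith

/-- Concavity: the sine lies above its chord from the origin to `α`. -/
theorem mul_sin_le {α β : ℝ} (hα : 0 < α) (hαπ : α < π / 2) (hβ : β ∈ Icc 0 α) :
    β * Real.sin α ≤ α * Real.sin β := by
  have hc := strictConcaveOn_sin_Icc.concaveOn
  have h1 : β / α ≤ 1 := div_le_one_of_le₀ hβ.2 hα.le
  have m0 : (0 : ℝ) ∈ Icc 0 π := ⟨le_rfl, Real.pi_pos.le⟩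
  have m1 : α ∈ Icc 0 π := ⟨hα.le, by linarith⟩
  have := hc.2 m0 m1 (sub_nonneg.mpr h1) (div_nonneg hβ.1 hα.le) (sub_add_cancel 1 (β / α))
  simp only [smul_eq_mul, Real.sin_zero, mul_zero, zero_add] at this
  rw [div_mul_cancel₀ _ hα.ne', div_mul_eq_mul_div, div_le_iff₀ hα] at this
  linarith

/-! ### The descent path for the downward Fourier integrals of the hyperbola. -/

/-- The modulus of the integrand of the hyperbolic contour, multiplied by a decreasing Fourier
factor, at height `β`. -/
noncomputable def descentWeight (l α ω x β : ℝ) : ℝ :=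
  farFactor x * Real.exp (max β 0 - α) * Real.exp (ω * β - l * Real.sin β * Real.cosh x)

/-- A function on the strip has partial derivatives dominated by `U * descentWeight`. -/
structure DescentBound (l α ω U : ℝ) (Ψ : ℝ → ℝ → ℂ) : Prop where
  dx : ∀ β ∈ Icc (-1) α, ∀ x, 0 ≤ x → ∃ d, HasDerivAt (fun x => Ψ x β) d x ∧
    ‖d‖ ≤ U * descentWeight l α ω x β
  dβ : ∀ β ∈ Icc (-1) α, ∀ x, 0 ≤ x → ∃ d, HasDerivAt (fun β => Ψ x β) d β ∧
    ‖d‖ ≤ U * descentWeight l α ω x β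

namespace DescentBound

variable {l α ω U : ℝ} {Ψ : ℝ → ℝ → ℂ}

theorem top_line (h : DescentBound l α ω U Ψ) (hU : 0 ≤ U) (hα : 0 < α) {x₀ X : ℝ}
    (hx₀ : 0 ≤ x₀) (hX : x₀ ≤ X) :
    ‖Ψ X α - Ψ x₀ α‖ ≤ U * (farFactor x₀ * (Real.exp (ω * α) *
      ∫ x in x₀..X, Real.exp (-(l * Real.sin α * Real.cosh x)))) := by
  refine (norm_sub_le_integral (F := fun x => Ψ x α) (g := fun x => U * (farFactor x₀ *
    (Real.exp (ω * α) * Real.exp (-(l * Real.sin α * Real.cosh x))))) hX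
    (by have := Real.continuous_cosh; fun_prop) fun x hx => ?_).trans_eq ?_
  · obtain ⟨d, hd, hd'⟩ := h.dx α ⟨by linarith, le_rfl⟩ x (hx₀.trans hx.1)
    refine ⟨d, hd, hd'.trans ?_⟩
    gcongr U * ?_
    rw [descentWeight, max_eq_left hα.le, sub_self, Real.exp_zero, mul_one, ← Real.exp_add,
      ← sub_eq_add_neg]
    exact mul_le_mul_of_nonneg_right (farFactor_anti hx₀ hx.1) (Real.exp_pos _).le
  · simp only [intervalIntegral.integral_const_mul]

/-- By `hc` the exponent of the weight vanishes at `β = α`, and concavity of the sine keeps it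
nonpositive down to `β = 0`. Only `exp (β - α)` remains to be integrated. -/
theorem descend (h : DescentBound l α ω U Ψ) (hU : 0 ≤ U) (hα : 0 < α) (hαπ : α < π / 2)
    (hω : 0 < ω) {x₀ : ℝ} (hx₀ : 0 ≤ x₀) (hc : l * Real.sin α * Real.cosh x₀ = ω * α) :
    ‖Ψ x₀ α - Ψ x₀ 0‖ ≤ U * (farFactor x₀ * (1 - Real.exp (-α))) := by
  refine (norm_sub_le_integral (F := fun β => Ψ x₀ β) (g := fun β => U * (farFactor x₀ *
    Real.exp (β - α))) hα.le (by fun_prop) fun β hβ => ?_).trans_eq ?_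
  · obtain ⟨d, hd, hd'⟩ := h.dβ β ⟨by linarith [hβ.1], hβ.2⟩ x₀ hx₀
    refine ⟨d, hd, hd'.trans ?_⟩
    gcongr U * ?_
    rw [descentWeight, max_eq_left hβ.1]
    refine mul_le_of_le_one_right (mul_nonneg (farFactor_nonneg _) (Real.exp_pos _).le)
      (Real.exp_le_one_iff.mpr ?_)
    have hs : 0 < Real.sin α := Real.sin_pos_of_pos_of_lt_pi hα (by linarith)
    have h1 := mul_sin_le hα hαπ hβ
    have h2 : (ω * β) * Real.sin α ≤ (l * Real.sin β * Real.cosh x₀) * Real.sin α := by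
      have : (l * Real.sin β * Real.cosh x₀) * Real.sin α = ω * (α * Real.sin β) := by
        rw [← mul_assoc, ← hc]; ring
      rw [this, mul_assoc]
      gcongr
    have := le_of_mul_le_mul_right h2 hs
    linarith
  · rw [intervalIntegral.integral_const_mul, intervalIntegral.integral_const_mul,
      intervalIntegral.integral_comp_sub_right (fun β => Real.exp β), integral_exp]
    simp

/-- On `β = 0` the exponent is zero: there is no decay, and the cost is the length, reduced by `exp
(-α)` and `farFactor`. -/
theorem bottom_line (h : DescentBound l α ω U Ψ) (hU : 0 ≤ U) (hα : 0 < α) {x₁ x₀ : ℝ}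
    (hx₁ : 0 ≤ x₁) (hx : x₁ ≤ x₀) :
    ‖Ψ x₀ 0 - Ψ x₁ 0‖ ≤ U * (Real.exp (-α) * (5 / 8 + 3 / 8 * (x₀ - x₁))) := by
  refine (norm_sub_le_farFactor (F := fun x => Ψ x 0) (c := U * Real.exp (-α)) (by positivity) hx₁ hx
    fun x hx => ?_).trans_eq (by ring)
  obtain ⟨d, hd, hd'⟩ := h.dx 0 ⟨by linarith, hα.le⟩ x (hx₁.trans hx.1)
  refine ⟨d, hd, hd'.trans_eq ?_⟩
  simp [descentWeight]
  ring

/-- For `β ≤ 0` one has `β ≤ sin β`, so over `x₁` the growth consumes at most half of `ω β`, and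
`exp (ω β / 2)` has integral at most `2 / ω`. -/
theorem plunge (h : DescentBound l α ω U Ψ) (hU : 0 ≤ U) (hα : 0 < α) (hω : 0 < ω) {x₁ : ℝ}
    (hx₁ : 0 ≤ x₁) (hc : l * Real.cosh x₁ = ω / 2) :
    ‖Ψ x₁ 0 - Ψ x₁ (-1)‖ ≤ U * (Real.exp (-α) * (2 / ω)) := by
  refine (norm_sub_le_integral (F := fun β => Ψ x₁ β) (g := fun β => U * (Real.exp (-α) *
    Real.exp (ω / 2 * β))) (a := -1) (b := 0) (by norm_num) (by fun_prop) fun β hβ => ?_).trans ?_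
  · obtain ⟨d, hd, hd'⟩ := h.dβ β ⟨hβ.1, by linarith [hβ.2]⟩ x₁ hx₁
    refine ⟨d, hd, hd'.trans ?_⟩
    gcongr U * ?_
    rw [descentWeight, max_eq_right hβ.2, zero_sub]
    have h1 : Real.exp (ω * β - l * Real.sin β * Real.cosh x₁) ≤ Real.exp (ω / 2 * β) := by
      refine Real.exp_le_exp.mpr ?_
      have e : l * Real.sin β * Real.cosh x₁ = ω / 2 * Real.sin β := by rw [← hc]; ring
      rw [e]
      have h2 : β ≤ Real.sin β := by
        have := Real.sin_le (neg_nonneg.mpr hβ.2)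
        rw [Real.sin_neg] at this
        linarith
      nlinarith
    calc _ ≤ 1 * Real.exp (-α) * Real.exp (ω / 2 * β) := by
          gcongr
          exact farFactor_le_one _
      _ = _ := by rw [one_mul]
  · rw [intervalIntegral.integral_const_mul, intervalIntegral.integral_const_mul,
      intervalIntegral.integral_comp_mul_left (fun β => Real.exp β) (by positivity), integral_exp]
    gcongr U * (Real.exp (-α) * ?_)
    rw [smul_eq_mul, mul_zero, Real.exp_zero, inv_div]
    refine mul_le_of_le_one_right (by positivity) ?_
    linarith [Real.exp_pos (ω / 2 * -1)]

/-- At `β = -1` the gain `exp (-ω)` loses at most `exp (ω / 2)`, because `l sin 1 cosh x ≤ ω / 2` up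
to `x₁`. -/
theorem deep_line (h : DescentBound l α ω U Ψ) (hU : 0 ≤ U) (hα : 0 < α) (hl : 0 < l) {x₁ : ℝ}
    (hx₁ : 0 ≤ x₁) (hc : l * Real.cosh x₁ = ω / 2) :
    ‖Ψ x₁ (-1) - Ψ 0 (-1)‖ ≤ U * (Real.exp (-α) * (Real.exp (-(ω / 2)) * x₁)) := by
  refine (norm_sub_le_mul (F := fun x => Ψ x (-1)) (c := U * (Real.exp (-α) * Real.exp (-(ω / 2))))
    hx₁ fun x hx => ?_).trans_eq (by ring)
  obtain ⟨d, hd, hd'⟩ := h.dx (-1) ⟨le_rfl, by linarith⟩ x hx.1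
  refine ⟨d, hd, hd'.trans ?_⟩
  gcongr U * ?_
  rw [descentWeight, max_eq_right (by norm_num), zero_sub]
  have h1 : Real.exp (ω * -1 - l * Real.sin (-1) * Real.cosh x) ≤ Real.exp (-(ω / 2)) := by
    refine Real.exp_le_exp.mpr ?_
    rw [Real.sin_neg]
    have h2 : Real.cosh x ≤ Real.cosh x₁ := by
      rw [Real.cosh_le_cosh, abs_of_nonneg hx.1, abs_of_nonneg hx₁]
      exact hx.2
    have h3 : l * Real.cosh x ≤ ω / 2 := by rw [← hc]; gcongr
    have h4 := Real.sin_le_one 1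
    have h5 : 0 ≤ l * Real.cosh x := mul_nonneg hl.le (Real.cosh_pos x).le
    nlinarith
  calc _ ≤ 1 * Real.exp (-α) * Real.exp (-(ω / 2)) := by
        gcongr
        exact farFactor_le_one _
    _ = _ := by rw [one_mul]

end DescentBound

theorem two_mul_div_sin_le_pi {α : ℝ} (hα : 0 < α) (hαπ : α < π / 2) : 2 * α / Real.sin α ≤ π := by
  have hs : 0 < Real.sin α := Real.sin_pos_of_pos_of_lt_pi hα (by linarith)
  rw [div_le_iff₀ hs]
  have := Real.mul_le_sin hα.le hαπ.le
  rw [div_mul_eq_mul_div, div_le_iff₀ Real.pi_pos] at this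
  linarith

theorem exp_neg_mul_two_div_le {α ω : ℝ} (hω : 0 < ω) (h : 4 ≤ ω * α) :
    Real.exp (-α) * (2 / ω) ≤ 0.184 := by
  have h1 : 2 / ω ≤ α / 2 := by
    rw [div_le_iff₀ hω]
    linarith
  calc Real.exp (-α) * (2 / ω) ≤ Real.exp (-α) * (α / 2) := by gcongr
    _ = (α * Real.exp (-α)) / 2 := by ring
    _ ≤ 0.184 := by linarith [mul_exp_neg_le α]

/-- By the arithmetic-geometric mean `α + ω / 4 ≥ √(ω α) ≥ 2`; the remaining `exp (-ω / 4)` absorbs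
the factor `ω`. -/
theorem exp_neg_mul_exp_neg_mul_le {α ω : ℝ} (hα : 0 < α) (hω : 0 < ω) (h : 4 ≤ ω * α) :
    Real.exp (-α) * Real.exp (-(ω / 2)) * ω ≤ 0.21 := by
  have h1 : 2 ≤ α + ω / 4 := by
    refine (sq_le_sq₀ (by norm_num) (by positivity)).mp ?_
    nlinarith [sq_nonneg (α - ω / 4)]
  have h2 : Real.exp (-(α + ω / 4)) ≤ 0.14 := by
    have h3 : Real.exp (-(α + ω / 4)) ≤ Real.exp (-2) := Real.exp_le_exp.mpr (by linarith)
    refine h3.trans ?_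
    rw [Real.exp_neg, inv_le_comm₀ (Real.exp_pos _) (by norm_num)]
    have e4 : Real.exp 2 = Real.exp 1 * Real.exp 1 := by rw [← Real.exp_add]; norm_num
    rw [e4]
    have := Real.exp_one_gt_d9
    norm_num at this ⊢
    nlinarith
  have e3 : Real.exp (-α) * Real.exp (-(ω / 2)) =
      Real.exp (-(α + ω / 4)) * Real.exp (-(ω / 4)) := by
    rw [← Real.exp_add, ← Real.exp_add]; congr 1; ring
  have h6 := mul_exp_neg_le (ω / 4)
  rw [e3]
  calc Real.exp (-(α + ω / 4)) * Real.exp (-(ω / 4)) * ω =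
      Real.exp (-(α + ω / 4)) * (4 * (ω / 4 * Real.exp (-(ω / 4)))) := by ring
    _ ≤ 0.14 * (4 * 0.368) := by gcongr
    _ ≤ _ := by norm_num

/-- Cost of the descent to the line `β = 0` over the vertex. -/
theorem DescentBound.norm_sub_zero_le {l α ω U : ℝ} {Ψ : ℝ → ℝ → ℂ}
    (h : DescentBound l α ω U Ψ) (hU : 0 ≤ U) (hl : 0 < l) (hα : 0 < α) (hαπ : α < π / 2)
    (hω : 0 < ω) {x₀ X : ℝ} (hx₀ : 0 ≤ x₀) (hX : x₀ ≤ X)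
    (hc : l * Real.sin α * Real.cosh x₀ = ω * α) :
    ‖Ψ X α - Ψ x₀ 0‖ ≤ U * (farFactor x₀ * (√(π / (2 * (ω * α))) + (1 - Real.exp (-α)))) := by
  have hs : 0 < Real.sin α := Real.sin_pos_of_pos_of_lt_pi hα (by linarith)
  have h1 := h.top_line hU hα hx₀ hX
  have h2 := h.descend hU hα hαπ hω hx₀ hc
  have h3 := integral_exp_neg_cosh_tail_le (mul_pos hl hs) hx₀ hX
  rw [hc] at h3
  have h4 : Real.exp (ω * α) * ∫ x in x₀..X, Real.exp (-(l * Real.sin α * Real.cosh x)) ≤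
      √(π / (2 * (ω * α))) := by
    calc _ ≤ Real.exp (ω * α) * (Real.exp (-(ω * α)) * √(π / (2 * (ω * α)))) := by gcongr
      _ = _ := by rw [← mul_assoc, ← Real.exp_add, add_neg_cancel, Real.exp_zero, one_mul]
  have e : Ψ X α - Ψ x₀ 0 = (Ψ X α - Ψ x₀ α) + (Ψ x₀ α - Ψ x₀ 0) := by ring
  rw [e, mul_add, mul_add]
  refine (norm_add_le _ _).trans (add_le_add (h1.trans ?_) h2)
  have := farFactor_nonneg x₀
  gcongr

/-- The endpoint `b` must not depend on `Ψ`: the two half-lines use different `Ψ` and have to meet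
in one point. The path runs inwards along `β = α` to `x₀`, where the weight has grown to size one,
then down to `β = 0`, then inwards along `β = 0` at the cost of its length. Where that would be too
long, it plunges at `x₁` to `β = -1`, where the frequency factor wins, and ends over `x = 0`. The
cases decide how much of this path is used. -/
theorem exists_descent {l α ω : ℝ} (hl : 0 < l) (hα : 0 < α) (hαπ : α < π / 2) (hω : 0 < ω) :
    ∃ b ∈ Icc (-1) α, ∃ X₀, 0 ≤ X₀ ∧ ∀ (U : ℝ) (Ψ : ℝ → ℝ → ℂ), 0 ≤ U →
      DescentBound l α ω U Ψ → ∀ X, X₀ ≤ X → ‖Ψ X α - Ψ 0 b‖ ≤ U * (2 * Lfun (l * Real.sin α)) := by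
  have hs : 0 < Real.sin α := Real.sin_pos_of_pos_of_lt_pi hα (by linarith)
  have hs1 : Real.sin α ≤ 1 := Real.sin_le_one α
  set γ := l * Real.sin α with hγd
  have hγ : 0 < γ := mul_pos hl hs
  set κ := ω * α with hκd
  have hκ : 0 < κ := mul_pos hω hα
  have hL1 := one_le_Lfun γ
  have hLlog := one_sub_log_le_Lfun hγ
  have hlog2 := Real.log_two_gt_d9
  have hea : Real.exp (-α) ≤ 1 := Real.exp_le_one_iff.mpr (by linarith)
  have hea0 := Real.exp_pos (-α)
  -- Low frequency: staying on the top line loses only `exp κ ≤ 2`.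
  by_cases hA1 : κ ≤ Real.log 2
  · refine ⟨α, ⟨by linarith, le_rfl⟩, 0, le_rfl, fun U Ψ hU h X hX => ?_⟩
    refine (h.top_line hU hα le_rfl hX).trans ?_
    have h1 := integral_exp_neg_cosh_le hγ hX
    have h2 : Real.exp κ ≤ 2 := by
      rw [← Real.exp_log (show (0:ℝ) < 2 by norm_num)]
      exact Real.exp_le_exp.mpr hA1
    gcongr U * ?_
    calc _ ≤ 1 * (2 * Lfun γ) := by
          have h0 : 0 ≤ ∫ x in (0:ℝ)..X, Real.exp (-(γ * Real.cosh x)) :=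
            intervalIntegral.integral_nonneg hX fun x _ => (Real.exp_pos _).le
          gcongr
          exact farFactor_le_one _
      _ = _ := one_mul _
  have hκ69 : 0.6931 ≤ κ := by linarith
  -- The weight never exceeds one on the top line, so its Gaussian tail from `x = 0` suffices.
  by_cases hA2 : κ ≤ γ
  · refine ⟨α, ⟨by linarith, le_rfl⟩, 0, le_rfl, fun U Ψ hU h X hX => ?_⟩
    refine (h.top_line hU hα le_rfl hX).trans ?_
    have h1 := integral_exp_neg_cosh_tail_le hγ le_rfl hX
    rw [Real.cosh_zero, mul_one] at h1
    have h2 := sqrt_pi_div_le (hκ69.trans hA2)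
    gcongr U * ?_
    have h3 : Real.exp κ * ∫ x in (0:ℝ)..X, Real.exp (-(γ * Real.cosh x)) ≤ 1.506 := by
      calc _ ≤ Real.exp κ * (Real.exp (-γ) * √(π / (2 * γ))) := by gcongr
        _ = Real.exp (κ - γ) * √(π / (2 * γ)) := by
            rw [← mul_assoc, ← Real.exp_add, ← sub_eq_add_neg]
        _ ≤ 1 * 1.506 := by
            gcongr
            exact Real.exp_le_one_iff.mpr (by linarith)
        _ = _ := one_mul _
    have h0 : 0 ≤ Real.exp κ * ∫ x in (0:ℝ)..X, Real.exp (-(γ * Real.cosh x)) :=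
      mul_nonneg (Real.exp_pos _).le
        (intervalIntegral.integral_nonneg hX fun x _ => (Real.exp_pos _).le)
    calc _ ≤ 1 * (1.506 : ℝ) := by
          gcongr
          exact farFactor_le_one _
      _ ≤ _ := by linarith
  push Not at hA1 hA2
  have hquot : 1 ≤ κ / γ := by rw [one_le_div hγ]; exact hA2.le
  set x₀ := Real.arcosh (κ / γ) with hx₀d
  have hx₀ : 0 ≤ x₀ := Real.arcosh_nonneg hquot
  have hch : Real.cosh x₀ = κ / γ := Real.cosh_arcosh hquot
  have hc : l * Real.sin α * Real.cosh x₀ = ω * α := by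
    rw [hch, ← hγd, ← hκd]; field_simp
  -- Here `x₀ ≤ 1`, and no gain from `farFactor` is available; the descent and the flat part
  -- together cost at most `√(π / (2 κ)) + 1`.
  by_cases hB1 : κ < 3 / 2 * γ
  · refine ⟨0, ⟨by norm_num, hα.le⟩, x₀, hx₀, fun U Ψ hU h X hX => ?_⟩
    have h1 := h.norm_sub_zero_le hU hl hα hαπ hω hx₀ hX hc
    have hx1 : x₀ ≤ 1 := by
      by_contra hcon
      push Not at hcon
      have := three_halves_le_cosh hcon.le
      rw [hch, le_div_iff₀ hγ] at this
      linarith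
    have h2 : ‖Ψ x₀ 0 - Ψ 0 0‖ ≤ U * Real.exp (-α) * (x₀ - 0) := by
      refine norm_sub_le_mul (F := fun x => Ψ x 0) hx₀ fun x hx => ?_
      obtain ⟨d, hd, hd'⟩ := h.dx 0 ⟨by norm_num, hα.le⟩ x hx.1
      refine ⟨d, hd, hd'.trans ?_⟩
      gcongr U * ?_
      simp only [descentWeight, max_self, zero_sub, Real.sin_zero, mul_zero, zero_mul, sub_self,
        Real.exp_zero, mul_one]
      exact mul_le_of_le_one_left hea0.le (farFactor_le_one x)
    have h3 := sqrt_add_one_le_Lfun hκ69 hγ hA2.le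
    have e : Ψ X α - Ψ 0 0 = (Ψ X α - Ψ x₀ 0) + (Ψ x₀ 0 - Ψ 0 0) := by ring
    rw [e]
    refine (norm_add_le _ _).trans ((add_le_add h1 h2).trans ?_)
    rw [mul_assoc, ← mul_add]
    gcongr U * ?_
    have h4 : farFactor x₀ * (√(π / (2 * (ω * α))) + (1 - Real.exp (-α))) ≤
        √(π / (2 * (ω * α))) + (1 - Real.exp (-α)) :=
      mul_le_of_le_one_left (by have := Real.sqrt_nonneg (π / (2 * (ω * α))); linarith)
        (farFactor_le_one _)
    have h5 : Real.exp (-α) * (x₀ - 0) ≤ Real.exp (-α) := by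
      rw [sub_zero]; exact mul_le_of_le_one_right hea0.le hx1
    rw [← hκd] at h4 ⊢
    linarith
  push Not at hB1
  have hff : farFactor x₀ = 3 / 8 := farFactor_of_le (by rw [hch, le_div_iff₀ hγ]; exact hB1)
  have hx₀log : x₀ ≤ Real.log 2 + Real.log (κ / γ) := by
    have := le_log_two_mul_cosh x₀
    rwa [hch, Real.log_mul (by norm_num) (by positivity)] at this
  have hflat : ∀ (U : ℝ) (Ψ : ℝ → ℝ → ℂ), 0 ≤ U → DescentBound l α ω U Ψ → ∀ X, x₀ ≤ X →
      ∀ x₁, 0 ≤ x₁ → x₁ ≤ x₀ →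
      ‖Ψ X α - Ψ x₁ 0‖ ≤ U * (3 / 8 * √(π / (2 * κ)) + 5 / 8 + 3 / 8 * (x₀ - x₁)) := by
    intro U Ψ hU h X hX x₁ hx₁ hx₁₀
    have h1 := h.norm_sub_zero_le hU hl hα hαπ hω hx₀ hX hc
    have h2 := h.bottom_line hU hα hx₁ hx₁₀
    have e : Ψ X α - Ψ x₁ 0 = (Ψ X α - Ψ x₀ 0) + (Ψ x₀ 0 - Ψ x₁ 0) := by ring
    rw [e]
    refine (norm_add_le _ _).trans ((add_le_add h1 h2).trans ?_)
    rw [← mul_add, hff]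
    gcongr U * ?_
    nlinarith
  -- The flat part has length at most `3 log 2 - log γ`, and `L` pays for `-log γ`.
  by_cases hB2 : κ ≤ 4
  · refine ⟨0, ⟨by norm_num, hα.le⟩, x₀, hx₀, fun U Ψ hU h X hX => ?_⟩
    refine (hflat U Ψ hU h X hX 0 le_rfl hx₀).trans ?_
    gcongr U * ?_
    have h1 := sqrt_pi_div_le hκ69
    have h2 : Real.log (κ / γ) ≤ 2 * Real.log 2 - Real.log γ := by
      rw [Real.log_div hκ.ne' hγ.ne']
      have : Real.log κ ≤ Real.log ((2:ℝ) ^ 2) := Real.log_le_log hκ (by norm_num; exact hB2)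
      rw [Real.log_pow] at this
      push_cast at this
      linarith
    have := Real.log_two_lt_d9
    linarith
  push Not at hB2
  have hsq := sqrt_pi_div_le' hB2.le
  have hpi := log_two_pi_le
  have hrat : κ / γ = ω / (2 * l) * (2 * α / Real.sin α) := by
    rw [hκd, hγd]; field_simp
  have hrpi := two_mul_div_sin_le_pi hα hαπ
  have hr0 : 0 < 2 * α / Real.sin α := by positivity
  have hlogr : Real.log 2 + Real.log (2 * α / Real.sin α) ≤ 1.84 := by
    rw [← Real.log_mul (by norm_num) hr0.ne']
    exact (Real.log_le_log (by positivity) (by linarith)).trans hpi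
  -- In `κ / γ = ω / (2 l) * (2 α / sin α)` the first factor is at most one and the second at most
  -- `π`, so `x₀ ≤ log (2 π)`.
  by_cases hB3 : ω ≤ 2 * l
  · refine ⟨0, ⟨by norm_num, hα.le⟩, x₀, hx₀, fun U Ψ hU h X hX => ?_⟩
    refine (hflat U Ψ hU h X hX 0 le_rfl hx₀).trans ?_
    gcongr U * ?_
    have h2 : Real.log (κ / γ) ≤ Real.log (2 * α / Real.sin α) := by
      refine Real.log_le_log (by positivity) ?_
      rw [hrat]
      exact mul_le_of_le_one_left hr0.le (div_le_one_of_le₀ hB3 (by positivity))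
    linarith
  -- High frequency: the flat part is left at `x₁`, after a length of at most about `log (2 π)`, and
  -- the path plunges below `β = 0`.
  · push Not at hB3
    have hq1 : 1 ≤ ω / (2 * l) := by rw [one_le_div (by positivity)]; exact hB3.le
    set x₁ := Real.arcosh (ω / (2 * l)) with hx₁d
    have hx₁ : 0 ≤ x₁ := Real.arcosh_nonneg hq1
    have hch₁ : Real.cosh x₁ = ω / (2 * l) := Real.cosh_arcosh hq1
    have hc₁ : l * Real.cosh x₁ = ω / 2 := by rw [hch₁]; field_simp
    have hr1 : 1 ≤ 2 * α / Real.sin α := by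
      rw [one_le_div hs]
      linarith [Real.sin_le hα.le]
    have hx₁₀ : x₁ ≤ x₀ := by
      rw [hx₁d, hx₀d, Real.arcosh_le_arcosh (by positivity) (by positivity), hrat]
      exact le_mul_of_one_le_right (by positivity) hr1
    have hdiff : x₀ - x₁ ≤ 1.84 := by
      have h1 := log_cosh_le hx₁
      rw [hch₁] at h1
      rw [hrat, Real.log_mul (by positivity) hr0.ne'] at hx₀log
      linarith
    refine ⟨-1, ⟨le_rfl, by linarith⟩, x₀, hx₀, fun U Ψ hU h X hX => ?_⟩
    have h1 := hflat U Ψ hU h X hX x₁ hx₁ hx₁₀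
    have h2 := h.plunge hU hα hω hx₁ hc₁
    have h3 := h.deep_line hU hα hl hx₁ hc₁
    have e : Ψ X α - Ψ 0 (-1) = (Ψ X α - Ψ x₁ 0) + (Ψ x₁ 0 - Ψ x₁ (-1)) +
      (Ψ x₁ (-1) - Ψ 0 (-1)) := by ring
    rw [e]
    refine (norm_add_le _ _).trans ((add_le_add ((norm_add_le _ _).trans (add_le_add h1 h2))
      h3).trans ?_)
    rw [← mul_add, ← mul_add]
    gcongr U * ?_
    have h4 := exp_neg_mul_two_div_le hω hB2.le
    have hx₁log : x₁ ≤ ω - Real.log γ := by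
      have h5 := le_log_two_mul_cosh x₁
      have e2 : 2 * (ω / (2 * l)) = ω / l := by field_simp
      rw [hch₁, e2, Real.log_div hω.ne' hl.ne'] at h5
      have h6 : Real.log γ ≤ Real.log l := Real.log_le_log hγ (by
        rw [hγd]; exact mul_le_of_le_one_right hl.le hs1)
      have h7 := Real.log_le_sub_one_of_pos hω
      linarith
    set P := Real.exp (-α) * Real.exp (-(ω / 2)) with hP
    have hP0 : 0 ≤ P := by positivity
    have hP1 : P ≤ 1 := mul_le_one₀ hea (Real.exp_pos _).le (Real.exp_le_one_iff.mpr (by linarith))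
    have hPω : P * ω ≤ 0.21 := exp_neg_mul_exp_neg_mul_le hα hω hB2.le
    have h9 : Real.exp (-α) * (Real.exp (-(ω / 2)) * x₁) ≤ 0.21 + (Lfun γ - 1) := by
      rw [← mul_assoc, ← hP]
      have : P * x₁ ≤ P * (ω + (Lfun γ - 1)) := by gcongr; linarith
      have h10 : P * (Lfun γ - 1) ≤ Lfun γ - 1 := mul_le_of_le_one_left (by linarith) hP1
      linarith
    linarith

/-! ### Truncation of the hyperbolic sum. -/

/-- The truncation estimate for the hyperbola. -/
theorem hyperbola_truncation {γ h : ℝ} (hγ : 0 < γ) (hh : 0 < h) {N : ℕ} (hN : 1 ≤ N) (n : ℕ) :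
    h * ∑ m ∈ Finset.range n, farFactor ((N + m) * h) *
        Real.exp (-(γ * Real.cosh ((N + m) * h))) ≤
      2 * (1 + Lfun γ) / Real.exp (γ * Real.cosh (N * h)) +
        Lfun γ / (Real.exp (π ^ 2 / h) - 1) := by
  have hN' : (1 : ℝ) ≤ N := by exact_mod_cast hN
  have hx0 : 0 ≤ N * h := by positivity
  have hxh : h ≤ N * h := le_mul_of_one_le_left hh.le hN'
  set x := N * h with hx
  set c := γ * Real.cosh x with hc
  have hc0 : 0 < c := mul_pos hγ (Real.cosh_pos x)
  have hL1 := one_le_Lfun γ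
  have hLlog := one_sub_log_le_Lfun hγ
  set L := Lfun γ
  have hcont : Continuous fun u => Real.exp (-(γ * Real.cosh u)) := by
    have := Real.continuous_cosh
    fun_prop
  have hmono : ∀ u v, 0 ≤ u → u ≤ v →
      Real.exp (-(γ * Real.cosh v)) ≤ Real.exp (-(γ * Real.cosh u)) := by
    intro u v hu huv
    refine Real.exp_le_exp.mpr (neg_le_neg (mul_le_mul_of_nonneg_left ?_ hγ.le))
    rw [Real.cosh_le_cosh, abs_of_nonneg hu, abs_of_nonneg (hu.trans huv)]
    exact huv
  have hXn : x ≤ x + h * n := by have : 0 ≤ h * n := by positivity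
                                 linarith
  -- For `c ≥ 1 / 2` the Gaussian tail suffices; otherwise the whole integral is at most `L` and
  -- `exp (-c) ≥ 1 / 2`.
  have hT : ∫ u in x..(x + h * n), Real.exp (-(γ * Real.cosh u)) ≤ 2 * L * Real.exp (-c) := by
    rcases le_total (1 / 2) c with hc2 | hc2
    · refine (integral_exp_neg_cosh_tail_le hγ hx0 hXn).trans ?_
      rw [← hc, mul_comm]
      gcongr
      have : √(π / (2 * c)) ≤ 2 := by
        rw [Real.sqrt_le_left (by norm_num), div_le_iff₀ (by linarith)]
        linarith [Real.pi_lt_d4]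
      linarith
    · have h1 : ∫ u in x..(x + h * n), Real.exp (-(γ * Real.cosh u)) ≤
          ∫ u in (0:ℝ)..(x + h * n), Real.exp (-(γ * Real.cosh u)) :=
        intervalIntegral.integral_mono_interval hx0 hXn le_rfl
          (Eventually.of_forall fun x => (Real.exp_pos _).le) (hcont.intervalIntegrable _ _)
      have h2 := integral_exp_neg_cosh_le hγ (hx0.trans hXn)
      have h3 : 1 / 2 ≤ Real.exp (-c) := by linarith [Real.add_one_le_exp (-c)]
      nlinarith
  have hsum : h * ∑ m ∈ Finset.range n, Real.exp (-(γ * Real.cosh (x + h * ((m + 1 : ℕ) : ℝ)))) ≤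
      ∫ u in x..(x + h * n), Real.exp (-(γ * Real.cosh u)) := by
    have hanti : AntitoneOn (fun u : ℝ => Real.exp (-(γ * Real.cosh (x + h * u))))
        (Icc (0:ℝ) (0 + n)) := by
      intro u hu v hv huv
      have := hu.1
      exact hmono _ _ (by positivity) (by gcongr)
    have h1 := hanti.sum_le_integral
    rw [intervalIntegral.integral_comp_add_mul (fun u => Real.exp (-(γ * Real.cosh u))) hh.ne' x]
      at h1
    simp only [zero_add, mul_zero, add_zero, smul_eq_mul] at h1
    calc _ ≤ h * (h⁻¹ * ∫ u in x..(x + h * n), Real.exp (-(γ * Real.cosh u))) := by gcongr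
      _ = _ := by field_simp
  have htot : h * ∑ m ∈ Finset.range n, farFactor ((N + m) * h) *
        Real.exp (-(γ * Real.cosh ((N + m) * h))) ≤ farFactor x * (h + 2 * L) * Real.exp (-c) := by
    have e : ∀ m : ℕ, ((N:ℝ) + m) * h = x + h * m := fun m => by rw [hx]; ring
    calc h * ∑ m ∈ Finset.range n, farFactor ((N + m) * h) *
        Real.exp (-(γ * Real.cosh ((N + m) * h)))
        ≤ h * ∑ m ∈ Finset.range n, farFactor x *
          Real.exp (-(γ * Real.cosh (x + h * m))) := by
          refine mul_le_mul_of_nonneg_left (Finset.sum_le_sum fun m _ => ?_) hh.le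
          rw [e]
          have : (0:ℝ) ≤ h * m := by positivity
          exact mul_le_mul_of_nonneg_right (farFactor_anti hx0 (by linarith)) (Real.exp_pos _).le
      _ = farFactor x * (h * ∑ m ∈ Finset.range n, Real.exp (-(γ * Real.cosh (x + h * m)))) := by
          rw [← Finset.mul_sum]; ring
      _ ≤ farFactor x * (h * ∑ m ∈ Finset.range (n + 1),
            Real.exp (-(γ * Real.cosh (x + h * m)))) := by
          have := farFactor_nonneg x
          gcongr
          exact Nat.le_succ n
      _ = farFactor x * (h * ∑ m ∈ Finset.range n, Real.exp (-(γ * Real.cosh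
            (x + h * ((m + 1 : ℕ) : ℝ)))) + h * Real.exp (-c)) := by
          rw [Finset.sum_range_succ', Nat.cast_zero, mul_zero, add_zero, ← hc]; ring
      _ ≤ farFactor x * (2 * L * Real.exp (-c) + h * Real.exp (-c)) := by
          have := farFactor_nonneg x
          exact mul_le_mul_of_nonneg_left (add_le_add (hsum.trans hT) le_rfl) this
      _ = _ := by ring
  refine htot.trans ?_
  rw [div_eq_mul_inv _ (Real.exp c), ← Real.exp_neg]
  have hE : 0 < Real.exp (-c) := Real.exp_pos _
  have hden : 0 < Real.exp (π ^ 2 / h) - 1 := by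
    have : 1 < Real.exp (π ^ 2 / h) := Real.one_lt_exp_iff.mpr (by positivity)
    linarith
  have hlast : 0 ≤ L / (Real.exp (π ^ 2 / h) - 1) := div_nonneg (by linarith) hden.le
  -- The first omitted node costs `h`, which `L` need not dominate. Up to `2` it fits directly, up
  -- to `8` with the factor `3 / 8`. Beyond, `h` is traded for `2 c - log γ`, and `c exp (-c)` is
  -- charged to the second term of the bound, then at least `2 L / 5`.
  rcases le_total h 2 with h2 | h2
  · have : farFactor x * (h + 2 * L) ≤ 2 * (1 + L) :=
      (mul_le_of_le_one_left (by linarith) (farFactor_le_one x)).trans (by linarith)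
    nlinarith
  have hff : farFactor x = 3 / 8 := farFactor_of_le (three_halves_le_cosh (by linarith))
  rw [hff]
  rcases le_total h 8 with h8 | h8
  · have : 3 / 8 * (h + 2 * L) ≤ 2 * (1 + L) := by linarith
    nlinarith
  · have hexp : Real.exp (π ^ 2 / h) - 1 ≤ 5 / 2 := by
      have h1 : π ^ 2 / h ≤ 5 / 4 := by
        rw [div_le_iff₀ hh]
        nlinarith [Real.pi_lt_d4, Real.pi_pos]
      have h3 : Real.exp (5 / 4) ≤ 7 / 2 := by
        have e : Real.exp (5 / 4) = Real.exp 1 * Real.exp (1 / 4) := by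
          rw [← Real.exp_add]; norm_num
        have h4 : Real.exp (1 / 4) ≤ 1.285 := by
          have h5 := Real.exp_bound' (show (0:ℝ) ≤ 1 / 4 by norm_num) (by norm_num) (n := 3)
            (by norm_num)
          refine h5.trans ?_
          norm_num [Finset.sum_range_succ, Nat.factorial]
        rw [e]
        have := Real.exp_one_lt_d9
        nlinarith [Real.exp_pos 1, Real.exp_pos (1 / 4)]
      linarith [Real.exp_le_exp.mpr h1]
    have hlow : 2 / 5 * L ≤ L / (Real.exp (π ^ 2 / h) - 1) := by
      rw [le_div_iff₀ hden]
      nlinarith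
    have hcexp : c * Real.exp (-c) ≤ 0.368 := mul_exp_neg_le c
    have hhlog : h ≤ 2 * c - 1 + (L - 1) := by
      have h1 := le_log_two_mul_cosh h
      have h3 : 2 * Real.cosh h ≤ 2 * c / γ := by
        rw [le_div_iff₀ hγ, hc]
        have : Real.cosh h ≤ Real.cosh x := by
          rw [Real.cosh_le_cosh, abs_of_nonneg hh.le, abs_of_nonneg hx0]
          exact hxh
        nlinarith
      have h4 := Real.log_le_log (by have := Real.cosh_pos h; positivity) h3
      rw [Real.log_div (by positivity) hγ.ne'] at h4
      have h5 := Real.log_le_sub_one_of_pos (show 0 < 2 * c by positivity)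
      linarith
    have : 3 / 8 * (h + 2 * L) * Real.exp (-c) ≤
        3 / 4 * (c * Real.exp (-c)) + 2 * (1 + L) * Real.exp (-c) := by nlinarith
    linarith

/-! ### Geometry of the hyperbola and bounds of the integrand. -/

theorem differentiable_hyperbola (η α : ℝ) : Differentiable ℂ (hyperbola η α) := by
  unfold hyperbola; fun_prop

theorem hyperbola_arg (α x θ : ℝ) : Complex.I * (x + θ * Complex.I) - α =
    ((-(α + θ) : ℝ) : ℂ) + (x : ℂ) * Complex.I := by
  push_cast
  linear_combination (θ : ℂ) * Complex.I_sq

theorem hyperbola_eq (η α x θ : ℝ) : hyperbola η α (x + θ * Complex.I) =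
    ((η * (1 - Real.sin (α + θ) * Real.cosh x) : ℝ) : ℂ) +
      ((η * (Real.cos (α + θ) * Real.sinh x) : ℝ) : ℂ) * Complex.I := by
  rw [hyperbola, hyperbola_arg, Complex.sin_add_mul_I, ← Complex.ofReal_sin, ← Complex.ofReal_cos,
    Real.sin_neg, Real.cos_neg]
  push_cast
  ring

theorem hyperbola_re (η α x θ : ℝ) : (hyperbola η α (x + θ * Complex.I)).re =
    η * (1 - Real.sin (α + θ) * Real.cosh x) := by
  rw [hyperbola_eq]; simp only [Complex.add_re, Complex.ofReal_re, Complex.re_ofReal_mul,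
    Complex.I_re, mul_zero, add_zero]

theorem hyperbola_im (η α x θ : ℝ) : (hyperbola η α (x + θ * Complex.I)).im =
    η * (Real.cos (α + θ) * Real.sinh x) := by
  rw [hyperbola_eq]; simp only [Complex.add_im, Complex.ofReal_im, Complex.im_ofReal_mul,
    Complex.I_im, mul_one, zero_add]

theorem norm_hyperbola {η : ℝ} (hη : 0 < η) (α x θ : ℝ) :
    ‖hyperbola η α (x + θ * Complex.I)‖ = η * (Real.cosh x - Real.sin (α + θ)) := by
  have h0 : 0 ≤ Real.cosh x - Real.sin (α + θ) := by
    linarith [Real.one_le_cosh x, Real.sin_le_one (α + θ)]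
  rw [← sq_eq_sq₀ (norm_nonneg _) (by positivity), hyperbola_eq, QuadDecay.norm_sq]
  linear_combination η ^ 2 * Real.sinh x ^ 2 * Real.sin_sq_add_cos_sq (α + θ) +
    η ^ 2 * (Real.sin (α + θ) ^ 2 - 1) * Real.cosh_sq x

theorem deriv_hyperbola (η α : ℝ) (φ : ℂ) :
    deriv (hyperbola η α) φ = η * (Complex.cos (Complex.I * φ - α) * Complex.I) := by
  have h : HasDerivAt (fun φ : ℂ => Complex.I * φ - α) (Complex.I * 1) φ :=
    ((hasDerivAt_id φ).const_mul Complex.I).sub_const _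
  have := ((h.csin.const_add 1).const_mul (η : ℂ)).deriv
  refine Eq.trans this ?_
  rw [mul_one]

theorem norm_deriv_hyperbola {η : ℝ} (hη : 0 < η) (α x θ : ℝ) :
    ‖deriv (hyperbola η α) (x + θ * Complex.I)‖ =
      η * √((Real.cosh x - Real.sin (α + θ)) * (Real.cosh x + Real.sin (α + θ))) := by
  rw [deriv_hyperbola, hyperbola_arg, norm_mul, norm_mul, Complex.norm_I, mul_one,
    Complex.norm_real, Real.norm_of_nonneg hη.le]
  congr 1
  have e : Complex.cos (((-(α + θ) : ℝ) : ℂ) + (x : ℂ) * Complex.I) =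
      ((Real.cos (α + θ) * Real.cosh x : ℝ) : ℂ) +
        ((Real.sin (α + θ) * Real.sinh x : ℝ) : ℂ) * Complex.I := by
    rw [Complex.cos_add_mul_I, ← Complex.ofReal_sin, ← Complex.ofReal_cos, Real.sin_neg,
      Real.cos_neg]
    push_cast
    ring
  rw [e, ← Real.sqrt_sq (norm_nonneg _), QuadDecay.norm_sq]
  congr 1
  linear_combination Real.cosh x ^ 2 * Real.sin_sq_add_cos_sq (α + θ) -
    Real.sin (α + θ) ^ 2 * Real.cosh_sq x

namespace FeynmanKac

variable {M : FeynmanKac}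

theorem radius_le_of_hyperbola {η α δ : ℝ} (hη : 0 < η) (hα : 0 < α) (hαδ : α < π / 2 - δ)
    (h : ∀ φ ∈ strip α (π / 2 - α - δ), M.radius < ‖hyperbola η α φ‖) :
    M.radius ≤ η * (1 - Real.cos δ) := by
  set a := π / 2 - α - δ with ha
  have ha0 : 0 < a := by rw [ha]; linarith
  have hc : Tendsto (fun c => η * (1 - Real.sin (α + c))) (nhdsWithin a (Iio a))
      (nhds (η * (1 - Real.sin (α + a)))) :=
    ((by fun_prop : Continuous fun c : ℝ => η * (1 - Real.sin (α + c))).tendsto a).mono_left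
      nhdsWithin_le_nhds
  have e : Real.sin (α + a) = Real.cos δ := by
    rw [ha, ← Real.sin_pi_div_two_sub]; congr 1; ring
  rw [e] at hc
  refine ge_of_tendsto hc ?_
  filter_upwards [self_mem_nhdsWithin, nhdsWithin_le_nhds (Ioi_mem_nhds ha0)] with c hc hc'
  have := h ((0 : ℝ) + c * Complex.I) ⟨by simp; linarith [mem_Ioi.mp hc'], by simpa using hc⟩
  rw [norm_hyperbola hη] at this
  simpa using this.le

/-- With `s = sin (α + θ)`, `‖z‖ + z.re = η (1 - s) (1 + cosh x)` is smallest at the vertex. Only an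
upper bound on `s` is needed, so lines below the stated strip are available too. -/
theorem hyperbola_mem_region {η α θ S : ℝ} (hη : 0 < η) (hR : M.radius ≤ η * (1 - S))
    (hs : Real.sin (α + θ) < S) (x : ℝ) :
    hyperbola η α (x + θ * Complex.I) ∈ M.region := by
  show 2 * M.radius < _
  rw [norm_hyperbola hη, hyperbola_re]
  set s := Real.sin (α + θ)
  have h1 := Real.one_le_cosh x
  have h2 := Real.sin_le_one (α + θ)
  have h3 : η * (Real.cosh x - s) + η * (1 - s * Real.cosh x) = η * (1 - s) * (1 + Real.cosh x) := by
    ring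
  rw [h3]
  have h4 : η * (1 - S) < η * (1 - s) := by gcongr
  have h5 : 0 ≤ η * (1 - s) := mul_nonneg hη.le (by linarith)
  nlinarith

/-- The bound of the integrand on the hyperbola, before estimation in `x`. -/
theorem norm_integrand_hyperbola_le {G₀ : Fin 2 → ℂ} {j : Fin 2} {η α θ x k : ℝ} (hη : 0 < η)
    (hs : Real.sin (α + θ) < 1)
    (hk : ‖M.Ghat G₀ j (hyperbola η α (x + θ * Complex.I))‖ ≤ 8 * k *
      (‖hyperbola η α (x + θ * Complex.I)‖⁻¹ * (‖G₀ j‖ + 4 * |M.C (1 - j)| *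
        ‖hyperbola η α (x + θ * Complex.I)‖ ^ (-M.α (1 - j)) * ‖G₀ (1 - j)‖))) (hk0 : 0 ≤ k)
    (t : ℝ) {s' : ℝ} (hs1 : s' < 1) (hss : Real.sin (α + θ) ≤ s')
    (hκ : (Real.cosh x + Real.sin (α + θ)) / (Real.cosh x - Real.sin (α + θ)) ≤
      (1 + s') / (1 - s')) :
    ‖M.integrand G₀ j (hyperbola η α) t (x + θ * Complex.I)‖ ≤
      k * (4 / π * hypConst M G₀ j η s' * Real.exp (η * t)) *
        Real.exp (-(η * t * Real.sin (α + θ) * Real.cosh x)) := by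
  have hα := M.α_mem (1 - j)
  rw [norm_hyperbola hη] at hk
  rw [norm_integrand, hyperbola_re, norm_deriv_hyperbola hη]
  set β := M.α (1 - j) with hβ
  set s := Real.sin (α + θ)
  set C := |M.C (1 - j)|
  have hC : 0 ≤ C := abs_nonneg _
  have h1 := Real.one_le_cosh x
  set c := Real.cosh x
  have hcs : 0 < c - s := by linarith
  have hs'0 : 0 < 1 - s' := by linarith
  have hpow : 4 * C * (η * (c - s)) ^ (-β) ≤ 4 * C / (η ^ β * (1 - s') ^ β) := by
    rw [div_eq_mul_inv, ← Real.mul_rpow hη.le hs'0.le, ← Real.rpow_neg (by positivity)]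
    gcongr 4 * C * ?_
    exact Real.rpow_le_rpow_of_nonpos (by positivity) (by gcongr) (by linarith [hα.1])
  have hsq : √((c - s) * (c + s)) = √((c + s) / (c - s)) * (c - s) := by
    have : (c - s) * (c + s) = (c + s) / (c - s) * (c - s) ^ 2 := by field_simp
    rw [this, Real.sqrt_mul' _ (sq_nonneg _), Real.sqrt_sq hcs.le]
  have hexp : Real.exp (η * (1 - s * c) * t) = Real.exp (η * t) * Real.exp (-(η * t * s * c)) := by
    rw [← Real.exp_add]; congr 1; ring
  rw [hsq, hexp]
  calc _ ≤ (2 * π)⁻¹ * (Real.exp (η * t) * Real.exp (-(η * t * s * c))) *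
        (8 * k * ((η * (c - s))⁻¹ * (‖G₀ j‖ + 4 * C * (η * (c - s)) ^ (-β) * ‖G₀ (1 - j)‖))) *
        (η * (√((c + s) / (c - s)) * (c - s))) := by gcongr
    _ = k * (4 / π * (√((c + s) / (c - s)) * (‖G₀ j‖ + 4 * C * (η * (c - s)) ^ (-β) *
        ‖G₀ (1 - j)‖)) * Real.exp (η * t)) * Real.exp (-(η * t * s * c)) := by
        have e : (η * (c - s))⁻¹ * (η * (c - s)) = 1 := inv_mul_cancel₀ (by positivity)
        have e2 : (2 * π)⁻¹ * 8 = 4 / π := by field_simp; norm_num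
        linear_combination (2 * π)⁻¹ * (Real.exp (η * t) * Real.exp (-(η * t * s * c))) *
          8 * k * (‖G₀ j‖ + 4 * C * (η * (c - s)) ^ (-β) * ‖G₀ (1 - j)‖) *
          √((c + s) / (c - s)) * e + k * √((c + s) / (c - s)) *
          (‖G₀ j‖ + 4 * C * (η * (c - s)) ^ (-β) * ‖G₀ (1 - j)‖) * Real.exp (η * t) *
          Real.exp (-(η * t * s * c)) * e2
    _ ≤ _ := by
        unfold hypConst
        have : 0 ≤ ‖G₀ j‖ + 4 * C * (η * (c - s)) ^ (-β) * ‖G₀ (1 - j)‖ := by positivity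
        gcongr

end FeynmanKac

/-- The derivative is `2 / cos β - 2 ≥ 0`. -/
theorem monotoneOn_log_sub {α : ℝ} (hαπ : α < π / 2) :
    MonotoneOn (fun β => Real.log (1 + Real.sin β) - Real.log (1 - Real.sin β) - 2 * β)
      (Icc 0 α) := by
  have hpos : ∀ β ∈ Icc 0 α, 0 < Real.cos β := fun β hβ =>
    Real.cos_pos_of_mem_Ioo ⟨by linarith [hβ.1, Real.pi_pos], by linarith [hβ.2]⟩
  have hs : ∀ β ∈ Icc 0 α, 0 < 1 + Real.sin β ∧ 0 < 1 - Real.sin β := by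
    intro β hβ
    have h1 := hpos β hβ
    have h2 := Real.sin_sq_add_cos_sq β
    constructor <;> nlinarith [Real.sin_le_one β, Real.neg_one_le_sin β]
  have hd : ∀ β ∈ Icc 0 α, HasDerivAt
      (fun β => Real.log (1 + Real.sin β) - Real.log (1 - Real.sin β) - 2 * β)
      (Real.cos β / (1 + Real.sin β) - -Real.cos β / (1 - Real.sin β) - 2 * 1) β := by
    intro β hβ
    exact ((((Real.hasDerivAt_sin β).const_add 1).log (hs β hβ).1.ne').sub
      (((Real.hasDerivAt_sin β).const_sub 1).log (hs β hβ).2.ne')).sub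
      ((hasDerivAt_id β).const_mul 2)
  refine monotoneOn_of_deriv_nonneg (convex_Icc 0 α)
    (fun β hβ => (hd β hβ).continuousAt.continuousWithinAt)
    (fun β hβ => (hd β (interior_subset hβ)).differentiableAt.differentiableWithinAt) fun β hβ => ?_
  have hβ' := interior_subset hβ
  rw [(hd β hβ').deriv]
  have h1 := hs β hβ'
  have h2 := hpos β hβ'
  have h3 := Real.sin_sq_add_cos_sq β
  have e : Real.cos β / (1 + Real.sin β) - -Real.cos β / (1 - Real.sin β) - 2 * 1 =
      2 * (1 - Real.cos β) / Real.cos β := by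
    have h4 := h1.1.ne'
    have h5 := h1.2.ne'
    have h6 := h2.ne'
    field_simp
    linear_combination (2 : ℝ) * h3
  rw [e]
  exact div_nonneg (by linarith [Real.cos_le_one β]) h2.le

/-- On lowering the line from `α` to `β` the constant shrinks at least by `exp (β - α)`; this is the
middle factor of `descentWeight`. -/
theorem sqrt_ratio_le_exp_mul {α β : ℝ} (hαπ : α < π / 2) (hβ : β ∈ Icc 0 α) :
    √((1 + Real.sin β) / (1 - Real.sin β)) ≤
      Real.exp (β - α) * √((1 + Real.sin α) / (1 - Real.sin α)) := by
  have hs : ∀ b ∈ Icc 0 α, 0 < 1 + Real.sin b ∧ 0 < 1 - Real.sin b := by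
    intro b hb
    have h1 : 0 < Real.cos b :=
      Real.cos_pos_of_mem_Ioo ⟨by linarith [hb.1, Real.pi_pos], by linarith [hb.2]⟩
    have h2 := Real.sin_sq_add_cos_sq b
    constructor <;> nlinarith [Real.sin_le_one b, Real.neg_one_le_sin b]
  have hα : α ∈ Icc 0 α := ⟨hβ.1.trans hβ.2, le_rfl⟩
  have hm := monotoneOn_log_sub hαπ hβ hα hβ.2
  obtain ⟨b1, b2⟩ := hs β hβ
  obtain ⟨a1, a2⟩ := hs α hα
  simp only [← Real.log_div b1.ne' b2.ne', ← Real.log_div a1.ne' a2.ne'] at hm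
  have h1 : (1 + Real.sin β) / (1 - Real.sin β) ≤
      Real.exp (β - α) ^ 2 * ((1 + Real.sin α) / (1 - Real.sin α)) := by
    rw [← Real.log_le_log_iff (by positivity) (by positivity), Real.log_mul (by positivity)
      (by positivity), Real.log_pow, Real.log_exp]
    push_cast
    linarith
  calc _ ≤ √(Real.exp (β - α) ^ 2 * ((1 + Real.sin α) / (1 - Real.sin α))) := Real.sqrt_le_sqrt h1
    _ = _ := by rw [Real.sqrt_mul (sq_nonneg _), Real.sqrt_sq (Real.exp_pos _).le]

section hypConst

variable (M : FeynmanKac) (G₀ : Fin 2 → ℂ) (j : Fin 2)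

theorem hypConst_factor_le {η : ℝ} (hη : 0 < η) {s s' : ℝ} (hss : s ≤ s') (hs' : s' < 1) :
    ‖G₀ j‖ + 4 * |M.C (1 - j)| / (η ^ M.α (1 - j) * (1 - s) ^ M.α (1 - j)) * ‖G₀ (1 - j)‖ ≤
    ‖G₀ j‖ + 4 * |M.C (1 - j)| / (η ^ M.α (1 - j) * (1 - s') ^ M.α (1 - j)) * ‖G₀ (1 - j)‖ := by
  have hα := M.α_mem (1 - j)
  have h0 : 0 < 1 - s' := by linarith
  have h1 : (1 - s') ^ M.α (1 - j) ≤ (1 - s) ^ M.α (1 - j) :=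
    Real.rpow_le_rpow h0.le (by linarith) hα.1.le
  have h2 : 0 < (1 - s') ^ M.α (1 - j) := Real.rpow_pos_of_pos h0 _
  have h3 : 0 < η ^ M.α (1 - j) := Real.rpow_pos_of_pos hη _
  gcongr

theorem hypConst_factor_nonneg {η : ℝ} (hη : 0 < η) {s : ℝ} (hs : s < 1) :
    0 ≤ ‖G₀ j‖ + 4 * |M.C (1 - j)| / (η ^ M.α (1 - j) * (1 - s) ^ M.α (1 - j)) *
      ‖G₀ (1 - j)‖ := by
  have h0 : 0 < 1 - s := by linarith
  positivity

theorem hypConst_nonneg {η : ℝ} (hη : 0 < η) {s : ℝ} (hs : s < 1) : 0 ≤ hypConst M G₀ j η s :=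
  mul_nonneg (Real.sqrt_nonneg _) (hypConst_factor_nonneg M G₀ j hη hs)

theorem hypConst_mono {η : ℝ} (hη : 0 < η) {s s' : ℝ} (hs : 0 ≤ s) (hss : s ≤ s') (hs' : s' < 1) :
    hypConst M G₀ j η s ≤ hypConst M G₀ j η s' := by
  unfold hypConst
  have h0 : 0 < 1 - s' := by linarith
  refine mul_le_mul (Real.sqrt_le_sqrt ?_) (hypConst_factor_le M G₀ j hη hss hs')
    (hypConst_factor_nonneg M G₀ j hη (hss.trans_lt hs')) (Real.sqrt_nonneg _)
  have h1 : 0 ≤ 1 + s' := by linarith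
  gcongr

theorem hypConst_sin_le {η : ℝ} (hη : 0 < η) {α β : ℝ} (hαπ : α < π / 2) (hβ : β ∈ Icc 0 α) :
    hypConst M G₀ j η (Real.sin β) ≤ Real.exp (β - α) * hypConst M G₀ j η (Real.sin α) := by
  unfold hypConst
  have hsin : Real.sin β ≤ Real.sin α := Real.sin_le_sin_of_le_of_le_pi_div_two
    (by linarith [hβ.1, Real.pi_pos]) hαπ.le hβ.2
  have hα1 : Real.sin α < 1 := by
    rw [← Real.sin_pi_div_two]
    exact Real.sin_lt_sin_of_lt_of_le_pi_div_two (by linarith [hβ.1, hβ.2, Real.pi_pos]) le_rfl hαπ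
  rw [← mul_assoc]
  exact mul_le_mul (sqrt_ratio_le_exp_mul hαπ hβ) (hypConst_factor_le M G₀ j hη hsin hα1)
    (hypConst_factor_nonneg M G₀ j hη (hsin.trans_lt hα1))
    (mul_nonneg (Real.exp_pos _).le (Real.sqrt_nonneg _))

end hypConst

/-- The square root of this ratio is `|z'| / |z|` on the hyperbola with `c = cosh x`; for `s ≥ 0` it
is largest at the vertex. -/
theorem ratio_le_of_nonneg {c s : ℝ} (hc : 1 ≤ c) (hs : 0 ≤ s) (hs1 : s < 1) :
    (c + s) / (c - s) ≤ (1 + s) / (1 - s) := by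
  rw [div_le_div_iff₀ (by linarith) (by linarith)]
  nlinarith

theorem ratio_le_of_nonpos {c s : ℝ} (hc : 1 ≤ c) (hs : s ≤ 0) :
    (c + s) / (c - s) ≤ (1 + 0) / (1 - 0) := by
  rw [div_le_div_iff₀ (by linarith) (by norm_num)]
  linarith

namespace FeynmanKac

variable {M : FeynmanKac}

theorem norm_integrand_hyperbola_le_upper (G₀ : Fin 2 → ℂ) (j : Fin 2) {η α θ S : ℝ} (hη : 0 < η)
    (hR : M.radius ≤ η * (1 - S)) (hS : S < 1) (hs0 : 0 ≤ Real.sin (α + θ))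
    (hs : Real.sin (α + θ) < S) (t x : ℝ) :
    ‖M.integrand G₀ j (hyperbola η α) t (x + θ * Complex.I)‖ ≤
      4 / π * hypConst M G₀ j η S * Real.exp (η * t) *
        Real.exp (-(η * t * Real.sin (α + θ) * Real.cosh x)) := by
  have h1 := norm_Ghat_le (radius_lt_norm_of_mem_region
    (hyperbola_mem_region (θ := θ) (α := α) hη hR hs x)) G₀ j
  have := norm_integrand_hyperbola_le (k := 1) hη (hs.trans hS) (by rwa [mul_one]) zero_le_one t hS
    hs.le ((ratio_le_of_nonneg (Real.one_le_cosh x) hs0 (hs.trans hS)).trans ?_)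
  · rwa [one_mul] at this
  · have : 0 < 1 - S := by linarith
    have : 0 ≤ 1 + S := by linarith
    gcongr

/-- Heights are measured by `β = α + Im φ`, so that the contour is a vertical line at `β = 0`; the
range down to `-1` serves the plunge. Once `cosh x ≥ 3 / 2`, `‖z‖` exceeds `3 R / 2`, which gives
`farFactor`. -/
theorem norm_integrand_hyperbola_le_lower (G₀ : Fin 2 → ℂ) (j : Fin 2) {η α β S : ℝ} (hη : 0 < η)
    (hα : 0 < α) (hαπ : α < π / 2) (hR : M.radius ≤ η * (1 - S))
    (hαS : Real.sin α < S) (hS : S < 1) (hβ : β ∈ Icc (-1) α) (t x : ℝ) :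
    ‖M.integrand G₀ j (hyperbola η α) t (x + (β - α : ℝ) * Complex.I)‖ ≤
      farFactor x * (4 / π * hypConst M G₀ j η (Real.sin α) * Real.exp (η * t)) *
        Real.exp (max β 0 - α) * Real.exp (-(η * t * Real.sin β * Real.cosh x)) := by
  have hπ := Real.pi_gt_three
  have hθ : α + (β - α) = β := by ring
  have hsβ : Real.sin β ≤ Real.sin α := Real.sin_le_sin_of_le_of_le_pi_div_two
    (by linarith [hβ.1]) hαπ.le hβ.2
  have hsα : 0 < Real.sin α := Real.sin_pos_of_pos_of_lt_pi hα (by linarith)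
  have hreg : hyperbola η α (x + (β - α : ℝ) * Complex.I) ∈ M.region :=
    hyperbola_mem_region hη hR (by rw [hθ]; linarith) x
  have hk : ‖M.Ghat G₀ j (hyperbola η α (x + (β - α : ℝ) * Complex.I))‖ ≤ 8 * farFactor x *
      (‖hyperbola η α (x + (β - α : ℝ) * Complex.I)‖⁻¹ * (‖G₀ j‖ + 4 * |M.C (1 - j)| *
        ‖hyperbola η α (x + (β - α : ℝ) * Complex.I)‖ ^ (-M.α (1 - j)) * ‖G₀ (1 - j)‖)) := by
    by_cases hc : 3 / 2 ≤ Real.cosh x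
    · rw [farFactor_of_le hc]
      have e : (8 * (3 / 8) : ℝ) = 3 := by norm_num
      rw [e]
      refine norm_Ghat_le_of_far (radius_lt_norm_of_mem_region hreg) ?_ G₀ j
      rw [norm_hyperbola hη, hθ]
      have h1 : 3 / 2 * (1 - S) ≤ Real.cosh x - Real.sin β := by nlinarith
      nlinarith
    · rw [farFactor, if_neg hc, mul_one]
      exact norm_Ghat_le (radius_lt_norm_of_mem_region hreg) G₀ j
  have hff := farFactor_nonneg x
  rcases le_total 0 β with h0 | h0
  · have hs0 : 0 ≤ Real.sin β := Real.sin_nonneg_of_nonneg_of_le_pi h0 (by linarith [hβ.2])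
    have := norm_integrand_hyperbola_le hη (s' := Real.sin β) (by rw [hθ]; linarith) hk hff t
      (by linarith) (by rw [hθ]) (by
        rw [hθ]
        exact ratio_le_of_nonneg (Real.one_le_cosh x) hs0 (by linarith))
    rw [hθ] at this
    refine this.trans ?_
    rw [max_eq_left h0]
    refine mul_le_mul_of_nonneg_right ?_ (Real.exp_pos _).le
    have h2 := hypConst_sin_le M G₀ j hη hαπ ⟨h0, hβ.2⟩
    calc farFactor x * (4 / π * hypConst M G₀ j η (Real.sin β) * Real.exp (η * t)) ≤
        farFactor x * (4 / π * (Real.exp (β - α) * hypConst M G₀ j η (Real.sin α)) *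
          Real.exp (η * t)) := by gcongr
      _ = _ := by ring
  · have hs0 : Real.sin β ≤ 0 := Real.sin_nonpos_of_nonpos_of_neg_pi_le h0 (by linarith [hβ.1])
    have := norm_integrand_hyperbola_le hη (s' := 0) (by rw [hθ]; linarith) hk hff t
      (by linarith) (by rw [hθ]; exact hs0) (by
        rw [hθ]
        exact ratio_le_of_nonpos (Real.one_le_cosh x) hs0)
    rw [hθ] at this
    refine this.trans ?_
    rw [max_eq_right h0]
    refine mul_le_mul_of_nonneg_right ?_ (Real.exp_pos _).le
    have h2 := hypConst_sin_le M G₀ j hη hαπ (β := 0) ⟨le_rfl, hα.le⟩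
    rw [Real.sin_zero] at h2
    calc farFactor x * (4 / π * hypConst M G₀ j η 0 * Real.exp (η * t)) ≤
        farFactor x * (4 / π * (Real.exp (0 - α) * hypConst M G₀ j η (Real.sin α)) *
          Real.exp (η * t)) := by gcongr
      _ = _ := by ring

end FeynmanKac

/-! ### Fourier integrals and error bound for the hyperbola. -/

theorem exp_neg_cosh_le {c : ℝ} (hc : 0 < c) (x : ℝ) :
    Real.exp (-(c * Real.cosh x)) ≤ 2 / c * (1 + x ^ 2)⁻¹ := by
  have h1 := one_add_sq_div_two_le_cosh x
  have h2 : c / 2 * (1 + x ^ 2) ≤ c * Real.cosh x := by nlinarith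
  calc Real.exp (-(c * Real.cosh x)) ≤ Real.exp (-(c / 2 * (1 + x ^ 2))) :=
        Real.exp_le_exp.mpr (by linarith)
    _ ≤ (c / 2 * (1 + x ^ 2))⁻¹ := exp_neg_le_inv (by positivity)
    _ = _ := by rw [mul_inv, inv_div]

open MeasureTheory in
theorem integrable_exp_neg_cosh {c : ℝ} (hc : 0 < c) :
    Integrable fun x => Real.exp (-(c * Real.cosh x)) := by
  have hcont : Continuous fun x => Real.exp (-(c * Real.cosh x)) := by
    have := Real.continuous_cosh
    fun_prop
  refine (integrable_inv_one_add_sq.const_mul (2 / c)).mono' hcont.aestronglyMeasurable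
    (Eventually.of_forall fun x => ?_)
  rw [Real.norm_of_nonneg (Real.exp_pos _).le]
  exact exp_neg_cosh_le hc x

open MeasureTheory in
theorem integral_univ_exp_neg_cosh_le {c : ℝ} (hc : 0 < c) :
    ∫ x, Real.exp (-(c * Real.cosh x)) ≤ 2 * Lfun c := by
  have hcont : Continuous fun x => Real.exp (-(c * Real.cosh x)) := by
    have := Real.continuous_cosh
    fun_prop
  refine le_of_tendsto (intervalIntegral_tendsto_integral (integrable_exp_neg_cosh hc)
    tendsto_neg_atTop_atBot tendsto_id) ?_
  filter_upwards [eventually_ge_atTop 0] with X hX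
  have h1 := integral_exp_neg_cosh_le hc hX
  have h2 : ∫ x in (-X)..0, Real.exp (-(c * Real.cosh x)) =
      ∫ x in (0:ℝ)..X, Real.exp (-(c * Real.cosh x)) := by
    have := intervalIntegral.integral_comp_neg (a := 0) (b := X)
      (fun x => Real.exp (-(c * Real.cosh x)))
    simp only [Real.cosh_neg, neg_zero] at this
    exact this.symm
  rw [← intervalIntegral.integral_add_adjacent_intervals (hcont.intervalIntegrable (-X) 0)
    (hcont.intervalIntegrable 0 _), h2]
  simp only [id]
  linarith

namespace FeynmanKac

variable {M : FeynmanKac}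

-- Since `sin (α + y) ≥ sin α` for the lines above, one majorant `exp (-γ cosh x)`, of mass at most
-- `2 L`, serves them all.
open MeasureTheory in
theorem norm_fourier_hyperbola_le_upper (G₀ : Fin 2 → ℂ) (j : Fin 2) {η α δ : ℝ} (hη : 0 < η)
    (hα : 0 < α) (hδ : 0 < δ) (hαδ : α < π / 2 - δ) (hR : M.radius ≤ η * (1 - Real.cos δ)) {c : ℝ}
    (hc0 : 0 ≤ c) (hc : c < π / 2 - α - δ) {t : ℝ} (ht : 0 < t) (ω : ℝ) :
    ‖∫ x : ℝ, M.integrand G₀ j (hyperbola η α) t x * Complex.exp (ω * x * Complex.I)‖ ≤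
      4 / π * hypConst M G₀ j η (Real.cos δ) * Real.exp (η * t) *
        (2 * Lfun (η * t * Real.sin α)) * Real.exp (-(ω * c)) := by
  have hcosδ : Real.cos δ < 1 := by
    rw [← Real.cos_zero]
    exact Real.cos_lt_cos_of_nonneg_of_le_pi_div_two le_rfl (by linarith) hδ
  have hsα : 0 < Real.sin α := Real.sin_pos_of_pos_of_lt_pi hα (by linarith)
  have hγ : 0 < η * t * Real.sin α := by positivity
  set A := 4 / π * hypConst M G₀ j η (Real.cos δ) * Real.exp (η * t) with hA
  have hA0 : 0 ≤ A := by
    have := hypConst_nonneg M G₀ j hη hcosδ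
    positivity
  have hs1 : ∀ y ∈ uIcc 0 c, Real.sin (α + y) < Real.cos δ := by
    intro y hy
    rw [uIcc_of_le hc0] at hy
    rw [← Real.sin_pi_div_two_sub]
    exact Real.sin_lt_sin_of_lt_of_le_pi_div_two (by linarith [hy.1, Real.pi_pos]) (by linarith)
      (by linarith [hy.2])
  have hs2 : ∀ y ∈ uIcc 0 c, Real.sin α ≤ Real.sin (α + y) := by
    intro y hy
    rw [uIcc_of_le hc0] at hy
    exact Real.sin_le_sin_of_le_of_le_pi_div_two (by linarith [Real.pi_pos]) (by linarith [hy.2])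
      (by linarith [hy.1])
  have hbd : ∀ x y : ℝ, y ∈ uIcc 0 c →
      ‖M.integrand G₀ j (hyperbola η α) t (x + y * Complex.I)‖ ≤
        A * Real.exp (-(η * t * Real.sin α * Real.cosh x)) := by
    intro x y hy
    refine (norm_integrand_hyperbola_le_upper G₀ j hη hR hcosδ (hsα.le.trans (hs2 y hy)) (hs1 y hy)
      t x).trans ?_
    have := hs2 y hy
    have := Real.cosh_pos x
    gcongr
  refine norm_integral_mul_exp_le (D := A * (2 / (η * t * Real.sin α))) ?_ ?_ ?_
  · refine differentiableOn_integrand G₀ j (differentiable_hyperbola η α) t fun φ hφ => ?_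
    rw [← Complex.re_add_im φ]
    exact hyperbola_mem_region hη hR (hs1 _ hφ) _
  · intro x y hy
    refine (hbd x y hy).trans ?_
    rw [mul_assoc A]
    exact mul_le_mul_of_nonneg_left (exp_neg_cosh_le hγ x) hA0
  · calc ∫ x : ℝ, ‖M.integrand G₀ j (hyperbola η α) t (x + c * Complex.I)‖ ≤
        ∫ x : ℝ, A * Real.exp (-(η * t * Real.sin α * Real.cosh x)) := by
          exact integral_mono_of_nonneg (Eventually.of_forall fun x => norm_nonneg _)
            ((integrable_exp_neg_cosh hγ).const_mul A)
            (Eventually.of_forall fun x => hbd x c right_mem_uIcc)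
      _ ≤ _ := by
          rw [integral_const_mul]
          gcongr
          exact integral_univ_exp_neg_cosh_le hγ

-- No single shifted line gives the rate `α` with an integrable majorant. A primitive of the full
-- integrand on a convex strip reduces the integral to two endpoint values, and `exists_descent`
-- joins both to the same point of the imaginary axis, each at cost `2 L`.
open MeasureTheory in
theorem norm_fourier_hyperbola_le_lower (G₀ : Fin 2 → ℂ) (j : Fin 2) {η α S : ℝ} (hη : 0 < η)
    (hα : 0 < α) (hαπ : α < π / 2) (hR : M.radius ≤ η * (1 - S))
    (hαS : Real.sin α < S) (hS : S < 1) {t : ℝ} (ht : 0 < t) {ω : ℝ} (hω : 0 < ω) :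
    ‖∫ x : ℝ, M.integrand G₀ j (hyperbola η α) t x * Complex.exp ((-ω : ℝ) * x * Complex.I)‖ ≤
      4 / π * hypConst M G₀ j η (Real.sin α) * Real.exp (η * t) *
        (4 * Lfun (η * t * Real.sin α)) * Real.exp (-(ω * α)) := by
  have hπ := Real.pi_gt_three
  have hsα : 0 < Real.sin α := Real.sin_pos_of_pos_of_lt_pi hα (by linarith)
  have hγ : 0 < η * t * Real.sin α := by positivity
  set A := 4 / π * hypConst M G₀ j η (Real.sin α) * Real.exp (η * t) with hA
  have hA0 : 0 ≤ A := by
    have := hypConst_nonneg M G₀ j hη (hαS.trans hS)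
    positivity
  -- a convex open strip on which the integrand is holomorphic
  set D : Set ℂ := {φ | -(π / 2) - α < φ.im} ∩ {φ | φ.im < Real.arcsin S - α} with hD
  have hDc : Convex ℝ D := (convex_halfSpace_im_gt _).inter (convex_halfSpace_im_lt _)
  have hDo : IsOpen D := (isOpen_lt continuous_const Complex.continuous_im).inter
    (isOpen_lt Complex.continuous_im continuous_const)
  have hDreg : ∀ φ ∈ D, hyperbola η α φ ∈ M.region := by
    intro φ hφ
    have h1 : -(π / 2) - α < φ.im := hφ.1
    have h2 : φ.im < Real.arcsin S - α := hφ.2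
    rw [← Complex.re_add_im φ]
    refine hyperbola_mem_region hη hR ?_ _
    rw [← Real.sin_arcsin (show -1 ≤ S by linarith) hS.le]
    exact Real.sin_lt_sin_of_lt_of_le_pi_div_two (by linarith) (Real.arcsin_le_pi_div_two S)
      (by linarith)
  have hαS' : α < Real.arcsin S := by
    rw [Real.lt_arcsin_iff_sin_lt ⟨by linarith, hαπ.le⟩ ⟨by linarith, hS.le⟩]
    exact hαS
  have hmem : ∀ β ∈ Icc (-1) α, ∀ x : ℝ, (x + (β - α : ℝ) * Complex.I : ℂ) ∈ D := by
    intro β hβ x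
    constructor
    · show -(π / 2) - α < (x + (β - α : ℝ) * Complex.I : ℂ).im
      simp; linarith [hβ.1]
    · show (x + (β - α : ℝ) * Complex.I : ℂ).im < Real.arcsin S - α
      simp; linarith [hβ.2]
  set f : ℂ → ℂ := fun φ => M.integrand G₀ j (hyperbola η α) t φ *
    Complex.exp ((-ω : ℝ) * φ * Complex.I) with hf
  have hfd : DifferentiableOn ℂ f D :=
    (differentiableOn_integrand G₀ j (differentiable_hyperbola η α) t hDreg).mul
      (by fun_prop : Differentiable ℂ fun φ : ℂ =>
        Complex.exp ((-ω : ℝ) * φ * Complex.I)).differentiableOn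
  obtain ⟨Φ, hΦ⟩ := hDc.exists_forall_hasDerivWithinAt hfd
  have hΦ' : ∀ φ ∈ D, HasDerivAt Φ (f φ) φ := fun φ hφ =>
    (hΦ φ hφ).hasDerivAt (hDo.mem_nhds hφ)
  have hfb : ∀ β ∈ Icc (-1) α, ∀ x : ℝ, ‖f (x + (β - α : ℝ) * Complex.I)‖ ≤
      A * Real.exp (-(ω * α)) * descentWeight (η * t) α ω x β := by
    intro β hβ x
    have h1 := norm_integrand_hyperbola_le_lower G₀ j hη hα hαπ hR hαS hS hβ t x
    have h2 : ‖Complex.exp ((-ω : ℝ) * (x + (β - α : ℝ) * Complex.I) * Complex.I)‖ =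
        Real.exp (ω * (β - α)) := by
      rw [Complex.norm_exp]
      congr 1
      simp
    rw [hf]
    simp only
    rw [norm_mul, h2]
    refine (mul_le_mul_of_nonneg_right h1 (Real.exp_pos _).le).trans_eq ?_
    rw [descentWeight, ← hA]
    have e : Real.exp (-(η * t * Real.sin β * Real.cosh x)) * Real.exp (ω * (β - α)) =
        Real.exp (-(ω * α)) * Real.exp (ω * β - η * t * Real.sin β * Real.cosh x) := by
      rw [← Real.exp_add, ← Real.exp_add]; congr 1; ring
    linear_combination farFactor x * A * Real.exp (max β 0 - α) * e
  obtain ⟨b, hb, X₀, hX₀, hdesc⟩ := exists_descent (l := η * t) (by positivity) hα hαπ hω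
  -- `ε = -1` reflects the left half-line onto the right one; the weight is even in `x`.
  have hside : ∀ ε : ℝ, |ε| = 1 → DescentBound (η * t) α ω (A * Real.exp (-(ω * α)))
      (fun x β => Φ ((ε * x : ℝ) + (β - α : ℝ) * Complex.I)) := by
    intro ε hε
    have hsym : ∀ x β, descentWeight (η * t) α ω (ε * x) β = descentWeight (η * t) α ω x β := by
      intro x β
      have hc : Real.cosh (ε * x) = Real.cosh x := by
        rw [← Real.cosh_abs, abs_mul, hε, one_mul, Real.cosh_abs]
      rw [descentWeight, descentWeight, farFactor, farFactor, hc]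
    constructor
    · intro β hβ x _
      have h1 : HasDerivAt (fun x : ℝ => (((ε * x : ℝ) : ℂ) + (β - α : ℝ) * Complex.I)) (ε : ℂ) x := by
        have := (((hasDerivAt_id x).const_mul ε).ofReal_comp).add_const (((β - α : ℝ) : ℂ) * Complex.I)
        simpa using this
      refine ⟨_, (hΦ' _ (hmem β hβ (ε * x))).comp (𝕜' := ℂ) x h1, ?_⟩
      rw [norm_mul, Complex.norm_real, Real.norm_eq_abs, hε, mul_one, ← hsym x β]
      exact hfb β hβ (ε * x)
    · intro β hβ x _
      have h1 : HasDerivAt (fun β : ℝ => (((ε * x : ℝ) : ℂ) + (β - α : ℝ) * Complex.I))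
          Complex.I β := by
        have := ((((hasDerivAt_id β).sub_const α).ofReal_comp).mul_const Complex.I).const_add
          ((ε * x : ℝ) : ℂ)
        simpa using this
      refine ⟨_, (hΦ' _ (hmem β hβ (ε * x))).comp (𝕜' := ℂ) β h1, ?_⟩
      rw [norm_mul, Complex.norm_I, mul_one, ← hsym x β]
      exact hfb β hβ (ε * x)
  have hαmem : α ∈ Icc (-1) α := ⟨by linarith, le_rfl⟩
  have hreal : ∀ x : ℝ, (x : ℂ) = x + ((α - α : ℝ) : ℂ) * Complex.I := by intro x; simp
  have hcont : Continuous fun x : ℝ => f x := by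
    refine hfd.continuousOn.comp_continuous Complex.continuous_ofReal fun x => ?_
    rw [hreal]
    exact hmem α hαmem x
  have hint : Integrable fun x : ℝ => f x := by
    refine ((integrable_exp_neg_cosh hγ).const_mul A).mono' hcont.aestronglyMeasurable
      (Eventually.of_forall fun x => ?_)
    have h1 := hfb α hαmem x
    rw [← hreal] at h1
    refine h1.trans ?_
    rw [descentWeight, max_eq_left hα.le, sub_self, Real.exp_zero, mul_one, mul_assoc]
    gcongr
    have e : Real.exp (-(ω * α)) * (farFactor x * Real.exp (ω * α - η * t * Real.sin α *
        Real.cosh x)) = farFactor x * Real.exp (-(η * t * Real.sin α * Real.cosh x)) := by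
      rw [mul_left_comm, ← Real.exp_add]; congr 2; ring
    rw [e]
    exact mul_le_of_le_one_left (Real.exp_pos _).le (farFactor_le_one x)
  refine le_of_tendsto ((intervalIntegral_tendsto_integral hint tendsto_neg_atTop_atBot
    tendsto_id).norm) ?_
  filter_upwards [eventually_ge_atTop X₀] with X hX
  have hftc : ∫ x in (-X)..(id X), f x = Φ X - Φ (-X : ℝ) := by
    refine intervalIntegral.integral_eq_sub_of_hasDerivAt (f := fun x : ℝ => Φ x) (fun x _ => ?_)
      (hcont.intervalIntegrable _ _)
    refine (hΦ' _ ?_).comp_ofReal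
    rw [hreal]
    exact hmem α hαmem x
  rw [hftc]
  have hU : 0 ≤ A * Real.exp (-(ω * α)) := by positivity
  have hp := hdesc _ _ hU (hside 1 (by simp)) X hX
  have hn := hdesc _ _ hU (hside (-1) (by simp)) X hX
  have e : Φ X - Φ (-X : ℝ) =
      (Φ ((1 * X : ℝ) + (α - α : ℝ) * Complex.I) - Φ ((1 * 0 : ℝ) + (b - α : ℝ) * Complex.I)) -
      (Φ ((-1 * X : ℝ) + (α - α : ℝ) * Complex.I) -
        Φ ((-1 * 0 : ℝ) + (b - α : ℝ) * Complex.I)) := by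
    simp
  rw [e]
  refine (norm_sub_le _ _).trans ((add_le_add hp hn).trans_eq ?_)
  ring

end FeynmanKac

namespace FeynmanKac

variable {M : FeynmanKac}

/-- Error bound for the hyperbolic contour. -/
theorem IsSolution.norm_sub_cim_hyperbola_le {T : ℝ} {G₀ : Fin 2 → ℂ} {G : Fin 2 → ℝ → ℂ}
    (hG : M.IsSolution T G₀ G) (j : Fin 2) {α δ y η t h : ℝ} {N : ℕ} (hα : 0 < α) (hδ : 0 < δ)
    (hαδ : α < π / 2 - δ) (hy : 0 < y) (hy' : y < min α (π / 2 - α - δ)) (hη : 0 < η) (ht : 0 < t)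
    (htT : t ≤ T) (hh : 0 < h) (hN : 1 ≤ N) (hR : M.radius ≤ η * (1 - Real.cos δ)) :
    ‖G j t - M.cim G₀ j (hyperbola η α) h N t‖ ≤
      16 / π * Real.exp (η * t) *
        (hypConst M G₀ j η (Real.cos δ) *
            (Lfun (η * t * Real.sin α) / (Real.exp (2 * π * (π / 2 - α - δ) / h) - 1)) +
          hypConst M G₀ j η (Real.sin (α + y)) *
            (Lfun (η * t * Real.sin α) / (Real.exp (2 * π * α / h) - 1) +
              (1 + Lfun (η * t * Real.sin α)) /
                Real.exp (η * t * Real.sin α * Real.cosh (N * h)))) := by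
  have hπ := Real.pi_gt_three
  have hy2 : y < π / 2 - α - δ := hy'.trans_le (min_le_right _ _)
  have hαπ : α < π / 2 := by linarith
  have hsα : 0 < Real.sin α := Real.sin_pos_of_pos_of_lt_pi hα (by linarith)
  have hcosα : 0 < Real.cos α := Real.cos_pos_of_mem_Ioo ⟨by linarith, hαπ⟩
  have hcosδ : Real.cos δ < 1 := by
    rw [← Real.cos_zero]
    exact Real.cos_lt_cos_of_nonneg_of_le_pi_div_two le_rfl (by linarith) hδ
  have hαS : Real.sin α < Real.cos δ := by
    rw [← Real.sin_pi_div_two_sub]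
    exact Real.sin_lt_sin_of_lt_of_le_pi_div_two (by linarith) (by linarith) hαδ
  have hαy : Real.sin α ≤ Real.sin (α + y) :=
    Real.sin_le_sin_of_le_of_le_pi_div_two (by linarith) (by linarith) (by linarith)
  have hyS : Real.sin (α + y) < 1 := by
    refine lt_of_le_of_lt ?_ hcosδ
    rw [← Real.sin_pi_div_two_sub]
    exact Real.sin_le_sin_of_le_of_le_pi_div_two (by linarith) (by linarith) (by linarith)
  have hγ : 0 < η * t * Real.sin α := by positivity
  have hL := one_le_Lfun (η * t * Real.sin α)
  set L := Lfun (η * t * Real.sin α) with hLd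
  set Kq := hypConst M G₀ j η (Real.sin α) with hKq
  have hKq0 : 0 ≤ Kq := hypConst_nonneg M G₀ j hη (hαS.trans hcosδ)
  -- The downward and truncation estimates carry the constant at `sin α`, which lies below both
  -- constants of the statement.
  have hK1 : Kq ≤ hypConst M G₀ j η (Real.cos δ) := hypConst_mono M G₀ j hη hsα.le hαS.le hcosδ
  have hK2 : Kq ≤ hypConst M G₀ j η (Real.sin (α + y)) := hypConst_mono M G₀ j hη hsα.le hαy hyS
  set Kδ := hypConst M G₀ j η (Real.cos δ) with hKδ
  set Ky := hypConst M G₀ j η (Real.sin (α + y))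
  set E := 4 / π * Real.exp (η * t) with hE
  have hE0 : 0 < E := by positivity
  set a := π / 2 - α - δ with ha
  have ha0 : 0 < a := by linarith
  have hz : ∀ x : ℝ, hyperbola η α x = hyperbola η α (x + (0:ℝ) * Complex.I) := by intro x; simp
  have hα0 : α + 0 = α := add_zero α
  have hαmem : α ∈ Icc (-1) α := ⟨by linarith, le_rfl⟩
  have hline : ∀ s x : ℝ, ‖M.integrand G₀ j (hyperbola η α) s x‖ ≤
      farFactor x * (4 / π * Kq * Real.exp (η * s)) *
        Real.exp (-(η * s * Real.sin α * Real.cosh x)) := by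
    intro s x
    have := norm_integrand_hyperbola_le_lower G₀ j hη hα hαπ hR hαS hcosδ hαmem s x
    simpa [max_eq_left hα.le] using this
  have hmain := hG.norm_sub_cim_le j (differentiable_hyperbola η α) (ε := η * (1 - Real.sin α))
    (σ := η)
    (fun x => by
      rw [hz]
      exact hyperbola_mem_region hη hR (by rw [hα0]; exact hαS) x)
    (by have : 0 < 1 - Real.sin α := by linarith
        positivity)
    (fun x => by
      rw [hz, norm_hyperbola hη, hα0]
      have := Real.one_le_cosh x
      gcongr)
    (fun x => by
      rw [hz, hyperbola_re, hα0]
      have := mul_pos hη (mul_pos hsα (Real.cosh_pos x))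
      linarith)
    (by
      simp only [hz, hyperbola_im, hα0]
      have : Tendsto Real.sinh atTop atTop :=
        tendsto_atTop_mono' _ ((eventually_ge_atTop 0).mono fun x hx =>
          Real.self_le_sinh_iff.mpr hx) tendsto_id
      exact (this.const_mul_atTop hcosα).const_mul_atTop hη)
    (by
      simp only [hz, hyperbola_im, hα0]
      have : Tendsto Real.sinh atBot atBot :=
        tendsto_atBot_mono' _ ((eventually_le_atBot 0).mono fun x hx =>
          Real.sinh_le_self_iff.mpr hx) tendsto_id
      exact (this.const_mul_atBot hcosα).const_mul_atBot hη)
    (fun s hs => ⟨4 / π * Kq * Real.exp (η * s) * (2 / (η * s * Real.sin α)), fun x => by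
      refine (hline s x).trans ?_
      rw [mul_assoc _ (2 / (η * s * Real.sin α))]
      refine mul_le_mul (mul_le_of_le_one_left (by positivity) (farFactor_le_one x))
        (exp_neg_cosh_le (by positivity) x) (Real.exp_pos _).le (by positivity)⟩)
    ⟨ht, htT⟩ hh (u := 2 * π * a / h) (w := 2 * π * α / h)
    (A := E * Kδ * (2 * L)) (B := E * Kq * (4 * L)) (by positivity) (by positivity)
    (fun n _ => by
      have := le_mul_exp_of_forall_lt (ω := 2 * π * n / h) (A := E * Kδ * (2 * L)) ha0
        (fun c hc0 hca => (norm_fourier_hyperbola_le_upper G₀ j hη hα hδ hαδ hR hc0 hca ht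
          (2 * π * n / h)).trans_eq (by rw [← hLd, ← hKδ, hE]; ring))
      refine this.trans_eq ?_
      congr 2
      ring)
    (fun n hn => by
      have hn' : (0:ℝ) < n := by exact_mod_cast hn
      refine (norm_fourier_hyperbola_le_lower G₀ j hη hα hαπ hR hαS hcosδ ht
          (ω := 2 * π * n / h) (by positivity)).trans_eq ?_
      have e1 : 2 * π * n / h * α = n * (2 * π * α / h) := by ring
      rw [e1, ← hLd, ← hKq, hE]
      ring)
    hN (b := fun m => E * Kq * (farFactor ((N + m) * h) *
      Real.exp (-(η * t * Real.sin α * Real.cosh ((N + m) * h)))))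
    (S := E * Kq * (2 * (1 + L) / Real.exp (η * t * Real.sin α * Real.cosh (N * h)) +
        L / (Real.exp (π ^ 2 / h) - 1)))
    (fun m x hx => by
      have hc : Real.cosh x = Real.cosh ((N + m) * h) := by rw [← hx, Real.cosh_abs]
      have hff : farFactor x = farFactor ((N + m) * h) := by rw [farFactor, farFactor, hc]
      refine (hline t x).trans_eq ?_
      rw [hc, hff, hE]
      ring)
    (fun n => by
      rw [← Finset.mul_sum, mul_left_comm]
      exact mul_le_mul_of_nonneg_left (hyperbola_truncation hγ hh hN n) (by positivity))
  refine hmain.trans ?_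
  have hx1 : 0 < Real.exp (2 * π * a / h) - 1 := by
    have : 1 < Real.exp (2 * π * a / h) := Real.one_lt_exp_iff.mpr (by positivity)
    linarith
  have hx2 : 0 < Real.exp (2 * π * α / h) - 1 := by
    have : 1 < Real.exp (2 * π * α / h) := Real.one_lt_exp_iff.mpr (by positivity)
    linarith
  -- The second truncation term is absorbed by the upward Fourier term, since `a < π / 2`.
  have hx3 : L / (Real.exp (π ^ 2 / h) - 1) ≤ L / (Real.exp (2 * π * a / h) - 1) := by
    gcongr
    rw [ha]
    nlinarith
  have p1 : E * Kq * (L / (Real.exp (π ^ 2 / h) - 1)) ≤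
      E * Kδ * (L / (Real.exp (2 * π * a / h) - 1)) := by
    have h0 : 0 ≤ L / (Real.exp (2 * π * a / h) - 1) := by positivity
    exact (mul_le_mul_of_nonneg_left hx3 (mul_nonneg hE0.le hKq0)).trans
      (mul_le_mul_of_nonneg_right (mul_le_mul_of_nonneg_left hK1 hE0.le) h0)
  have hT0 : 0 ≤ L / (Real.exp (2 * π * α / h) - 1) +
      (1 + L) / Real.exp (η * t * Real.sin α * Real.cosh (N * h)) := by positivity
  have p2 : E * Kq * (L / (Real.exp (2 * π * α / h) - 1) +
      (1 + L) / Real.exp (η * t * Real.sin α * Real.cosh (N * h))) ≤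
      E * Ky * (L / (Real.exp (2 * π * α / h) - 1) +
      (1 + L) / Real.exp (η * t * Real.sin α * Real.cosh (N * h))) := by gcongr
  have e1 : (16 / π * Real.exp (η * t) : ℝ) = 4 * E := by rw [hE]; ring
  rw [e1]
  calc _ = 2 * (E * Kδ * (L / (Real.exp (2 * π * a / h) - 1))) +
        2 * (E * Kq * (L / (Real.exp (π ^ 2 / h) - 1))) +
        4 * (E * Kq * (L / (Real.exp (2 * π * α / h) - 1) +
          (1 + L) / Real.exp (η * t * Real.sin α * Real.cosh (N * h)))) := by ring
    _ ≤ 2 * (E * Kδ * (L / (Real.exp (2 * π * a / h) - 1))) +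
        2 * (E * Kδ * (L / (Real.exp (2 * π * a / h) - 1))) +
        4 * (E * Ky * (L / (Real.exp (2 * π * α / h) - 1) +
          (1 + L) / Real.exp (η * t * Real.sin α * Real.cosh (N * h)))) := by linarith
    _ = _ := by ring

end FeynmanKac

/-! ### Spectral accuracy. -/

theorem one_div_exp_sub_one_le {u u₀ : ℝ} (hu₀ : 0 < u₀) (hu : u₀ ≤ u) :
    1 / (Real.exp u - 1) ≤ (1 - Real.exp (-u₀))⁻¹ * Real.exp (-u) := by
  rw [← exp_neg_pow_div u (hu₀.trans_le hu), div_eq_inv_mul]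
  have h0 := (one_sub_exp_neg_mem hu₀).1
  gcongr

theorem one_div_exp_sub_one_nonneg {u : ℝ} (hu : 0 ≤ u) : 0 ≤ 1 / (Real.exp u - 1) :=
  one_div_nonneg.mpr (sub_nonneg.mpr (Real.one_le_exp hu))

/-- The constant depends only on the lower bound `u₀` of the rate, which makes the estimates uniform
in `t` and `N`. -/
theorem exp_mul_one_div_exp_sub_one_le {u₀ u c x n : ℝ} (hu₀ : 0 < u₀) (hu : u₀ ≤ u) (hn : 1 ≤ n)
    (h : x - u * n ≤ -c * n) :
    Real.exp x * (1 / (Real.exp (u * n) - 1)) ≤ (1 - Real.exp (-u₀))⁻¹ * Real.exp (-c * n) := by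
  have hd := (one_sub_exp_neg_mem hu₀).1
  calc _ ≤ Real.exp x * ((1 - Real.exp (-u₀))⁻¹ * Real.exp (-(u * n))) := by
        gcongr
        exact one_div_exp_sub_one_le hu₀ (by nlinarith)
    _ = (1 - Real.exp (-u₀))⁻¹ * Real.exp (x - u * n) := by
        rw [mul_left_comm, ← Real.exp_add]; rfl
    _ ≤ _ := by gcongr

theorem Lfun_anti {x y : ℝ} (hx : 0 < x) (hxy : x ≤ y) : Lfun y ≤ Lfun x := by
  rw [Lfun_eq hx, Lfun_eq (hx.trans_le hxy)]
  have := Real.log_le_log (one_sub_exp_neg_mem hx).1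
    (show 1 - Real.exp (-x) ≤ 1 - Real.exp (-y) by
      have := Real.exp_le_exp.mpr (neg_le_neg hxy)
      linarith)
  linarith

theorem hypConst_le_one (M : FeynmanKac) (G₀ : Fin 2 → ℂ) (j : Fin 2) {η s : ℝ} (hη : 1 ≤ η)
    (hs : s < 1) : hypConst M G₀ j η s ≤ hypConst M G₀ j 1 s := by
  unfold hypConst
  have h1 : (1:ℝ) ^ M.α (1 - j) ≤ η ^ M.α (1 - j) :=
    Real.rpow_le_rpow zero_le_one hη (M.α_mem (1 - j)).1.le
  have h2 : 0 < (1 - s) ^ M.α (1 - j) := Real.rpow_pos_of_pos (by linarith) _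
  have h3 : (0:ℝ) < 1 ^ M.α (1 - j) := Real.rpow_pos_of_pos one_pos _
  gcongr

namespace FeynmanKac

variable {M : FeynmanKac}

set_option maxHeartbeats 600000 in
theorem IsSolution.parabola_spectral {T : ℝ} {G₀ : Fin 2 → ℂ} {G : Fin 2 → ℝ → ℂ}
    (hG : M.IsSolution T G₀ G) (j : Fin 2) {a t₀ t₁ : ℝ} (ha0 : 0 < a) (ha : a < 1) (ht₀ : 0 < t₀)
    (ht₁ : t₀ ≤ t₁) (hT : t₁ ≤ T) {κ l : ℝ} (hκ : 0 < κ) (hl : 1 < l) (hκl : κ * t₁ * l < π) :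
    ∃ K : ℝ, ∀ᶠ N : ℕ in atTop, ∀ t ∈ Icc t₀ t₁,
      ‖G j t - M.cim G₀ j (parabola (κ * N)) (l / N) N t‖ ≤
        K * Real.exp (-(min (min (2 * π * a / l - κ * t₁)
          (π ^ 2 / (κ * t₁ * l ^ 2) - 2 * π / l)) (κ * t₀ * (l ^ 2 - 1))) * N) := by
  have hl0 : 0 < l := by linarith
  have ht₁0 : 0 < t₁ := ht₀.trans_le ht₁
  set c := min (min (2 * π * a / l - κ * t₁) (π ^ 2 / (κ * t₁ * l ^ 2) - 2 * π / l))
    (κ * t₀ * (l ^ 2 - 1)) with hc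
  have hc1 : c ≤ 2 * π * a / l - κ * t₁ := (min_le_left _ _).trans (min_le_left _ _)
  have hc2 : c ≤ π ^ 2 / (κ * t₁ * l ^ 2) - 2 * π / l := (min_le_left _ _).trans (min_le_right _ _)
  have hc3 : c ≤ κ * t₀ * (l ^ 2 - 1) := min_le_right _ _
  set u₁ := 2 * π * a / l with hu₁
  have hu₁0 : 0 < u₁ := by positivity
  set b₁ := π ^ 2 / (κ * t₁ * l ^ 2) with hb₁
  set u₂ := 2 * b₁ - 2 * π / l with hu₂
  -- The inequality `π / l < b₁` is exactly `κ t₁ l < π`.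
  have hu₂0 : 0 < u₂ := by
    have : π / l < b₁ := by
      rw [hb₁, div_lt_div_iff₀ hl0 (by positivity)]
      have := Real.pi_pos
      nlinarith [mul_pos (mul_pos Real.pi_pos hl0) (sub_pos.mpr hκl)]
    have e : 2 * π / l = 2 * (π / l) := by ring
    rw [hu₂, e]
    linarith
  have hd1 := (one_sub_exp_neg_mem hu₁0).1
  have hd2 := (one_sub_exp_neg_mem hu₂0).1
  have hP := M.parabolaConst_pos j ha
  set F := M.parabolaConst j a * (√t₀)⁻¹ * (‖G₀ j‖ + ‖G₀ (1 - j)‖) with hF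
  have hF0 : 0 ≤ F := by positivity
  refine ⟨F * ((1 - Real.exp (-u₁))⁻¹ + (1 - Real.exp (-u₂))⁻¹ + 1), ?_⟩
  have hlin : Tendsto (fun N : ℕ => κ * N) atTop atTop :=
    tendsto_natCast_atTop_atTop.const_mul_atTop hκ
  -- The radius is fixed while the contour grows linearly, so the contour condition holds for large
  -- `N`.
  have hlin2 : Tendsto (fun N : ℕ => κ * N * (1 - a) ^ 2) atTop atTop :=
    hlin.atTop_mul_const (by have : 0 < 1 - a := by linarith
                             positivity)
  filter_upwards [eventually_ge_atTop 1, hlin.eventually_ge_atTop 1,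
    hlin2.eventually_ge_atTop M.radius] with N hN hη1 hR t ht
  have hN1 : (1:ℝ) ≤ N := by exact_mod_cast hN
  have hN0 : (0:ℝ) < N := by linarith
  have ht0 : 0 < t := ht₀.trans_le ht.1
  set η := κ * N with hη
  have hη0 : 0 < η := by positivity
  have hκt : κ * t * l < π := lt_of_le_of_lt (by have := ht.2; gcongr) hκl
  have hmain := hG.norm_sub_cim_parabola_le j (h := l / N) ha0 ha hη0 ht0 (ht.2.trans hT)
    (by positivity) (by
      rw [lt_div_iff₀ (by positivity), hη]
      have : l / N * (κ * N * t) = κ * t * l := by field_simp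
      rwa [this]) hN hR
  refine hmain.trans ?_
  have hpre : M.parabolaConst j a * √(η / π) * t ^ (-(1 / 2) : ℝ) *
      (η⁻¹ * ‖G₀ j‖ + η ^ (-(1 + M.α (1 - j))) * ‖G₀ (1 - j)‖) ≤ F := by
    have h1 : √(η / π) ≤ η := by
      rw [Real.sqrt_le_left hη0.le, div_le_iff₀ Real.pi_pos]
      nlinarith [Real.pi_gt_three]
    have h2 : t ^ (-(1 / 2) : ℝ) ≤ (√t₀)⁻¹ := by
      rw [Real.rpow_neg ht0.le, ← Real.sqrt_eq_rpow]
      exact inv_anti₀ (Real.sqrt_pos.mpr ht₀) (Real.sqrt_le_sqrt ht.1)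
    have h3 : η * (η⁻¹ * ‖G₀ j‖ + η ^ (-(1 + M.α (1 - j))) * ‖G₀ (1 - j)‖) ≤
        ‖G₀ j‖ + ‖G₀ (1 - j)‖ := by
      have e1 : η * η ^ (-(1 + M.α (1 - j))) = η ^ (-M.α (1 - j)) := by
        rw [neg_add, Real.rpow_add hη0, Real.rpow_neg_one, ← mul_assoc, mul_inv_cancel₀ hη0.ne',
          one_mul]
      have e2 : η ^ (-M.α (1 - j)) ≤ 1 :=
        Real.rpow_le_one_of_one_le_of_nonpos hη1 (by linarith [(M.α_mem (1 - j)).1])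
      rw [mul_add, ← mul_assoc, ← mul_assoc, mul_inv_cancel₀ hη0.ne', one_mul, e1]
      gcongr
      exact mul_le_of_le_one_left (norm_nonneg _) e2
    calc _ ≤ M.parabolaConst j a * η * (√t₀)⁻¹ *
          (η⁻¹ * ‖G₀ j‖ + η ^ (-(1 + M.α (1 - j))) * ‖G₀ (1 - j)‖) := by gcongr
      _ = M.parabolaConst j a * (√t₀)⁻¹ *
          (η * (η⁻¹ * ‖G₀ j‖ + η ^ (-(1 + M.α (1 - j))) * ‖G₀ (1 - j)‖)) := by ring
      _ ≤ F := by rw [hF]; gcongr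
  set b := π ^ 2 / (κ * t * l ^ 2) with hb
  -- The downward rate decreases in `t`, so `t₁` is the worst time; for the truncation it is `t₀`.
  have hbb : b₁ ≤ b := by
    rw [hb₁, hb]
    have := ht.2
    gcongr
  have e1 : 2 * π * a / (l / N) = u₁ * N := by rw [hu₁]; field_simp
  have e2 : π ^ 2 / (η * t * (l / N) ^ 2) = b * N := by rw [hb, hη]; field_simp
  have e3 : 2 * π ^ 2 / (η * t * (l / N) ^ 2) - 2 * π / (l / N) = (2 * b - 2 * π / l) * N := by
    rw [hb, hη]; field_simp
  have e4 : (N : ℝ) * (l / N) = l := by field_simp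
  rw [e1, e2, e3, e4]
  have hT1 : Real.exp (η * t) / (Real.exp (u₁ * N) - 1) ≤
      (1 - Real.exp (-u₁))⁻¹ * Real.exp (-c * N) := by
    rw [div_eq_mul_one_div]
    refine exp_mul_one_div_exp_sub_one_le hu₁0 le_rfl hN1 ?_
    have h1 : η * t ≤ κ * t₁ * N := by
      rw [hη, mul_right_comm]
      have := ht.2
      gcongr
    have h2 := mul_le_mul_of_nonneg_right hc1 hN0.le
    linarith
  have hu : u₂ ≤ 2 * b - 2 * π / l := by rw [hu₂]; linarith
  have hT2 : Real.exp (b * N) / (Real.exp ((2 * b - 2 * π / l) * N) - 1) ≤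
      (1 - Real.exp (-u₂))⁻¹ * Real.exp (-c * N) := by
    rw [div_eq_mul_one_div]
    refine exp_mul_one_div_exp_sub_one_le hu₂0 hu hN1 ?_
    have h2 := mul_le_mul_of_nonneg_right (hc2.trans (sub_le_sub_right hbb _)) hN0.le
    linarith
  have hT3 : Real.exp (η * t) / Real.exp (η * t * l ^ 2) ≤ 1 * Real.exp (-c * N) := by
    rw [← Real.exp_sub, one_mul]
    refine Real.exp_le_exp.mpr ?_
    have h1 : κ * t₀ * (l ^ 2 - 1) ≤ κ * t * (l ^ 2 - 1) := by
      have : 0 ≤ l ^ 2 - 1 := by nlinarith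
      have := ht.1
      gcongr
    have : η * t - η * t * l ^ 2 = -(κ * t * (l ^ 2 - 1)) * N := by rw [hη]; ring
    rw [this]
    gcongr
    linarith
  calc _ ≤ F * ((1 - Real.exp (-u₁))⁻¹ * Real.exp (-c * N) +
        (1 - Real.exp (-u₂))⁻¹ * Real.exp (-c * N) + 1 * Real.exp (-c * N)) := by
        refine mul_le_mul hpre (add_le_add (add_le_add hT1 hT2) hT3) ?_ hF0
        have h1 := one_div_exp_sub_one_nonneg (mul_pos hu₁0 hN0).le
        have h2 := one_div_exp_sub_one_nonneg (mul_pos (hu₂0.trans_le hu) hN0).le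
        rw [div_eq_mul_one_div _ (Real.exp (u₁ * N) - 1),
          div_eq_mul_one_div _ (Real.exp ((2 * b - 2 * π / l) * N) - 1)]
        positivity
    _ = _ := by ring

theorem IsSolution.hyperbola_spectral {T : ℝ} {G₀ : Fin 2 → ℂ} {G : Fin 2 → ℝ → ℂ}
    (hG : M.IsSolution T G₀ G) (j : Fin 2) {α δ t₀ t₁ : ℝ} (hα : 0 < α) (hδ : 0 < δ)
    (hαδ : α < π / 2 - δ) (ht₀ : 0 < t₀) (hT : t₁ ≤ T) {κ l : ℝ} (hκ : 0 < κ)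
    (hl : 0 < l) (hsl : 1 < Real.sin α * Real.cosh l) :
    ∃ K : ℝ, ∀ᶠ N : ℕ in atTop, ∀ t ∈ Icc t₀ t₁,
      ‖G j t - M.cim G₀ j (hyperbola (κ * N) α) (l / N) N t‖ ≤
        K * Real.exp (-(min (min (2 * π * (π / 2 - α - δ) / l - κ * t₁)
          (2 * π * α / l - κ * t₁)) (κ * t₀ * (Real.sin α * Real.cosh l - 1))) * N) := by
  have hπ := Real.pi_gt_three
  have hsα : 0 < Real.sin α := Real.sin_pos_of_pos_of_lt_pi hα (by linarith)
  have hcosδ : Real.cos δ < 1 := by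
    rw [← Real.cos_zero]
    exact Real.cos_lt_cos_of_nonneg_of_le_pi_div_two le_rfl (by linarith) hδ
  set a := π / 2 - α - δ with ha
  have ha0 : 0 < a := by linarith
  -- The rate does not involve `y`; any admissible value serves.
  set y := min α a / 2 with hy
  have hm0 : 0 < min α a := lt_min hα ha0
  have hy0 : 0 < y := by positivity
  have hyS : Real.sin (α + y) < 1 := by
    refine lt_of_le_of_lt ?_ hcosδ
    have : min α a ≤ a := min_le_right _ _
    rw [← Real.sin_pi_div_two_sub]
    exact Real.sin_le_sin_of_le_of_le_pi_div_two (by linarith) (by linarith) (by linarith)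
  set c := min (min (2 * π * a / l - κ * t₁) (2 * π * α / l - κ * t₁))
    (κ * t₀ * (Real.sin α * Real.cosh l - 1)) with hc
  have hc1 : c ≤ 2 * π * a / l - κ * t₁ := (min_le_left _ _).trans (min_le_left _ _)
  have hc2 : c ≤ 2 * π * α / l - κ * t₁ := (min_le_left _ _).trans (min_le_right _ _)
  have hc3 : c ≤ κ * t₀ * (Real.sin α * Real.cosh l - 1) := min_le_right _ _
  set u₁ := 2 * π * a / l with hu₁
  have hu₁0 : 0 < u₁ := by positivity
  set u₂ := 2 * π * α / l with hu₂
  have hu₂0 : 0 < u₂ := by positivity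
  have hd1 := (one_sub_exp_neg_mem hu₁0).1
  have hd2 := (one_sub_exp_neg_mem hu₂0).1
  set L₀ := Lfun (κ * t₀ * Real.sin α) with hL₀
  have hL₀1 : 1 ≤ L₀ := one_le_Lfun _
  set K₁ := hypConst M G₀ j 1 (Real.cos δ)
  have hK₁ : 0 ≤ K₁ := hypConst_nonneg M G₀ j one_pos hcosδ
  set K₂ := hypConst M G₀ j 1 (Real.sin (α + y))
  have hK₂ : 0 ≤ K₂ := hypConst_nonneg M G₀ j one_pos hyS
  refine ⟨16 / π * (K₁ * (L₀ * (1 - Real.exp (-u₁))⁻¹) + K₂ * (L₀ * (1 - Real.exp (-u₂))⁻¹ +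
    (1 + L₀))), ?_⟩
  have hlin : Tendsto (fun N : ℕ => κ * N) atTop atTop :=
    tendsto_natCast_atTop_atTop.const_mul_atTop hκ
  have hlin2 : Tendsto (fun N : ℕ => κ * N * (1 - Real.cos δ)) atTop atTop :=
    hlin.atTop_mul_const (by linarith)
  filter_upwards [eventually_ge_atTop 1, hlin.eventually_ge_atTop 1,
    hlin2.eventually_ge_atTop M.radius] with N hN hη1 hR t ht
  have hN1 : (1:ℝ) ≤ N := by exact_mod_cast hN
  have hN0 : (0:ℝ) < N := by linarith
  have ht0 : 0 < t := ht₀.trans_le ht.1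
  set η := κ * N with hη
  have hη0 : 0 < η := by positivity
  have hmain := hG.norm_sub_cim_hyperbola_le j (h := l / N) hα hδ hαδ hy0
    (half_lt_self hm0) hη0 ht0 (ht.2.trans hT) (by positivity) hN hR
  refine hmain.trans ?_
  have e1 : 2 * π * a / (l / N) = u₁ * N := by rw [hu₁]; field_simp
  have e2 : 2 * π * α / (l / N) = u₂ * N := by rw [hu₂]; field_simp
  have e3 : (N : ℝ) * (l / N) = l := by field_simp
  rw [← ha, e1, e2, e3]
  have hLL : Lfun (η * t * Real.sin α) ≤ L₀ := by
    refine Lfun_anti (by positivity) ?_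
    have h1 : κ * t₀ ≤ η * t := by
      rw [hη]
      calc κ * t₀ = κ * 1 * t₀ := by ring
        _ ≤ κ * N * t := by have := ht.1; gcongr
    gcongr
  have hLp := one_le_Lfun (η * t * Real.sin α)
  set L := Lfun (η * t * Real.sin α)
  have hq1 := hypConst_le_one M G₀ j hη1 hcosδ
  have hq2 := hypConst_le_one M G₀ j hη1 hyS
  have hq1' := hypConst_nonneg M G₀ j hη0 hcosδ
  have hq2' := hypConst_nonneg M G₀ j hη0 hyS
  have hgeom : ∀ u, 0 < u → c ≤ u - κ * t₁ → Real.exp (η * t) * (1 / (Real.exp (u * N) - 1)) ≤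
      (1 - Real.exp (-u))⁻¹ * Real.exp (-c * N) := by
    intro u hu hcu
    refine exp_mul_one_div_exp_sub_one_le hu le_rfl hN1 ?_
    have h1 : η * t ≤ κ * t₁ * N := by
      rw [hη, mul_right_comm]
      have := ht.2
      gcongr
    have h2 := mul_le_mul_of_nonneg_right hcu hN0.le
    linarith
  have hT1 := hgeom u₁ hu₁0 hc1
  have hT2 := hgeom u₂ hu₂0 hc2
  have hT3 : Real.exp (η * t) * (1 / Real.exp (η * t * Real.sin α * Real.cosh l)) ≤
      Real.exp (-c * N) := by
    rw [mul_one_div, ← Real.exp_sub]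
    refine Real.exp_le_exp.mpr ?_
    have h1 : κ * t₀ * (Real.sin α * Real.cosh l - 1) ≤ κ * t * (Real.sin α * Real.cosh l - 1) := by
      have : 0 ≤ Real.sin α * Real.cosh l - 1 := by linarith
      have := ht.1
      gcongr
    have : η * t - η * t * Real.sin α * Real.cosh l =
        -(κ * t * (Real.sin α * Real.cosh l - 1)) * N := by rw [hη]; ring
    rw [this]
    gcongr
    linarith
  have hp1 := one_div_exp_sub_one_nonneg (mul_pos hu₁0 hN0).le
  have hp2 := one_div_exp_sub_one_nonneg (mul_pos hu₂0 hN0).le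
  calc _ = 16 / π * (hypConst M G₀ j η (Real.cos δ) *
          (L * (Real.exp (η * t) * (1 / (Real.exp (u₁ * N) - 1)))) +
        hypConst M G₀ j η (Real.sin (α + y)) *
          (L * (Real.exp (η * t) * (1 / (Real.exp (u₂ * N) - 1))) + (1 + L) *
            (Real.exp (η * t) * (1 / Real.exp (η * t * Real.sin α * Real.cosh l))))) := by ring
    _ ≤ 16 / π * (K₁ * (L₀ * ((1 - Real.exp (-u₁))⁻¹ * Real.exp (-c * N))) +
        K₂ * (L₀ * ((1 - Real.exp (-u₂))⁻¹ * Real.exp (-c * N)) +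
          (1 + L₀) * Real.exp (-c * N))) := by gcongr
    _ = _ := by ring

end FeynmanKac

/-- With `l = 2` and `κ t₁ = π a / 4` the three rates are `3 π a / 4`, `π / a - π` and `3 κ t₀`. -/
theorem exists_parabola_params {a t₀ t₁ : ℝ} (ha0 : 0 < a) (ha : a < 1) (ht₀ : 0 < t₀)
    (ht₁ : t₀ ≤ t₁) : ∃ κ l : ℝ, 0 < κ ∧ 1 < l ∧ κ * t₁ * l < π ∧
      0 < min (min (2 * π * a / l - κ * t₁) (π ^ 2 / (κ * t₁ * l ^ 2) - 2 * π / l))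
        (κ * t₀ * (l ^ 2 - 1)) := by
  have ht₁0 : 0 < t₁ := ht₀.trans_le ht₁
  have hπ := Real.pi_pos
  have e : π * a / (4 * t₁) * t₁ = π * a / 4 := by field_simp
  refine ⟨π * a / (4 * t₁), 2, by positivity, by norm_num, ?_, lt_min (lt_min ?_ ?_) ?_⟩
  · rw [e]; nlinarith
  · rw [e]; nlinarith
  · rw [e, sub_pos, div_lt_div_iff₀ (by norm_num) (by positivity)]
    nlinarith [mul_pos hπ hπ]
  · have : (0:ℝ) < 2 ^ 2 - 1 := by norm_num
    positivity

/-- With `l = 2 / sin α` the quadratic lower bound of `cosh` gives `sin α cosh l ≥ sin α + 2 / sin α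
> 1`. Then `κ t₁` is half of the smaller of the two Fourier rates. -/
theorem exists_hyperbola_params {α δ t₀ t₁ : ℝ} (hα : 0 < α) (hδ : 0 < δ) (hαδ : α < π / 2 - δ)
    (ht₀ : 0 < t₀) (ht₁ : t₀ ≤ t₁) :
    ∃ κ l : ℝ, 0 < κ ∧ 0 < l ∧ 1 < Real.sin α * Real.cosh l ∧
      0 < min (min (2 * π * (π / 2 - α - δ) / l - κ * t₁) (2 * π * α / l - κ * t₁))
        (κ * t₀ * (Real.sin α * Real.cosh l - 1)) := by
  have ht₁0 : 0 < t₁ := ht₀.trans_le ht₁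
  have hπ := Real.pi_pos
  have hsα : 0 < Real.sin α := Real.sin_pos_of_pos_of_lt_pi hα (by linarith)
  set a := π / 2 - α - δ with ha
  have ha0 : 0 < a := by linarith
  have hm0 : 0 < min α a := lt_min hα ha0
  have hcosh : 1 < Real.sin α * Real.cosh (2 / Real.sin α) := by
    have h1 := mul_le_mul_of_nonneg_left (one_add_sq_div_two_le_cosh (2 / Real.sin α)) hsα.le
    have h2 : Real.sin α * (1 + (2 / Real.sin α) ^ 2 / 2) = Real.sin α + 2 / Real.sin α := by
      field_simp
    have h3 : 2 ≤ 2 / Real.sin α := by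
      rw [le_div_iff₀ hsα]; linarith [Real.sin_le_one α]
    linarith
  set l := 2 / Real.sin α with hl
  have hl0 : 0 < l := by positivity
  have e : π * min α a / (l * t₁) * t₁ = π * min α a / l := by field_simp
  refine ⟨π * min α a / (l * t₁), l, by positivity, hl0, hcosh, lt_min (lt_min ?_ ?_) ?_⟩
  · rw [e, ← sub_div]
    refine div_pos ?_ hl0
    nlinarith [min_le_right α a, mul_pos hπ ha0]
  · rw [e, ← sub_div]
    refine div_pos ?_ hl0
    nlinarith [min_le_left α a, mul_pos hπ hα]
  · have : 0 < Real.sin α * Real.cosh l - 1 := by linarith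
    positivity

/-! ### The theorem. -/

theorem theorem3p3 (M : FeynmanKac) (T : ℝ) (G₀ : Fin 2 → ℂ) (G : Fin 2 → ℝ → ℂ)
    (hG : M.IsSolution T G₀ G) (j : Fin 2) :
    -- parabolic contour: error bound
    (∀ (a η t h : ℝ) (N : ℕ), 0 < a → a < 1 → 0 < η → 0 < t → t ≤ T → 0 < h → h < π / (η * t) →
      1 ≤ N → (∀ φ ∈ strip (π / (η * t * h) - 1) a, M.radius < ‖parabola η φ‖) →
      ‖G j t - M.cim G₀ j (parabola η) h N t‖ ≤
        max (16 * (1 - a)⁻¹) (64 * |M.C (1 - j)| * (1 - a) ^ (-(1 + 2 * M.α (1 - j)))) *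
          √(η / π) * t ^ (-(1 / 2) : ℝ) *
          (η⁻¹ * ‖G₀ j‖ + η ^ (-(1 + M.α (1 - j))) * ‖G₀ (1 - j)‖) *
          (Real.exp (η * t) / (Real.exp (2 * π * a / h) - 1) +
            Real.exp (π ^ 2 / (η * t * h ^ 2)) /
              (Real.exp (2 * π ^ 2 / (η * t * h ^ 2) - 2 * π / h) - 1) +
            Real.exp (η * t) / Real.exp (η * t * (N * h) ^ 2))) ∧
    -- hyperbolic contour: error bound
    (∀ (α δ y η t h : ℝ) (N : ℕ), 0 < α → 0 < δ → α < π / 2 - δ →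
      0 < y → y < min α (π / 2 - α - δ) → 0 < η → 0 < t → t ≤ T → 0 < h → 1 ≤ N →
      (∀ φ ∈ strip α (π / 2 - α - δ), M.radius < ‖hyperbola η α φ‖) →
      ‖G j t - M.cim G₀ j (hyperbola η α) h N t‖ ≤
        16 / π * Real.exp (η * t) *
          (hypConst M G₀ j η (Real.cos δ) *
              (Lfun (η * t * Real.sin α) / (Real.exp (2 * π * (π / 2 - α - δ) / h) - 1)) +
            hypConst M G₀ j η (Real.sin (α + y)) *
              (Lfun (η * t * Real.sin α) / (Real.exp (2 * π * α / h) - 1) +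
                (1 + Lfun (η * t * Real.sin α)) /
                  Real.exp (η * t * Real.sin α * Real.cosh (N * h))))) ∧
    -- parabolic contour: spectral accuracy, uniformly on `[t₀, t₁]`, for `h = l / N`, `η = κ N`
    (∀ a t₀ t₁ : ℝ, 0 < a → a < 1 → 0 < t₀ → t₀ ≤ t₁ → t₁ ≤ T →
      (∃ κ l : ℝ, 0 < κ ∧ 1 < l ∧ κ * t₁ * l < π ∧
        0 < min (min (2 * π * a / l - κ * t₁) (π ^ 2 / (κ * t₁ * l ^ 2) - 2 * π / l))
          (κ * t₀ * (l ^ 2 - 1))) ∧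
      ∀ κ l : ℝ, 0 < κ → 1 < l → κ * t₁ * l < π →
        ∃ K : ℝ, ∀ᶠ N : ℕ in atTop, ∀ t ∈ Icc t₀ t₁,
          ‖G j t - M.cim G₀ j (parabola (κ * N)) (l / N) N t‖ ≤
            K * Real.exp (-(min (min (2 * π * a / l - κ * t₁)
              (π ^ 2 / (κ * t₁ * l ^ 2) - 2 * π / l)) (κ * t₀ * (l ^ 2 - 1))) * N)) ∧
    -- hyperbolic contour: spectral accuracy, uniformly on `[t₀, t₁]`, for `h = l / N`, `η = κ N`
    (∀ α δ t₀ t₁ : ℝ, 0 < α → 0 < δ → α < π / 2 - δ → 0 < t₀ → t₀ ≤ t₁ → t₁ ≤ T →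
      (∃ κ l : ℝ, 0 < κ ∧ 0 < l ∧ 1 < Real.sin α * Real.cosh l ∧
        0 < min (min (2 * π * (π / 2 - α - δ) / l - κ * t₁) (2 * π * α / l - κ * t₁))
          (κ * t₀ * (Real.sin α * Real.cosh l - 1))) ∧
      ∀ κ l : ℝ, 0 < κ → 0 < l → 1 < Real.sin α * Real.cosh l →
        ∃ K : ℝ, ∀ᶠ N : ℕ in atTop, ∀ t ∈ Icc t₀ t₁,
          ‖G j t - M.cim G₀ j (hyperbola (κ * N) α) (l / N) N t‖ ≤
            K * Real.exp (-(min (min (2 * π * (π / 2 - α - δ) / l - κ * t₁)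
              (2 * π * α / l - κ * t₁)) (κ * t₀ * (Real.sin α * Real.cosh l - 1))) * N)) := by
  refine ⟨?_, ?_, ?_, ?_⟩
  · intro a η t h N ha0 ha hη ht htT hh hhη hN hR
    -- The step restriction says that the strip reaches below the real axis.
    have hd : 0 < π / (η * t * h) - 1 := by
      rw [lt_div_iff₀ (by positivity), mul_comm] at hhη
      rw [sub_pos, one_lt_div (by positivity)]
      exact hhη
    exact hG.norm_sub_cim_parabola_le j ha0 ha hη ht htT hh hhη hN
      (FeynmanKac.radius_le_of_parabola hη ha0 hd hR)
  · intro α δ y η t h N hα hδ hαδ hy hy' hη ht htT hh hN hR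
    exact hG.norm_sub_cim_hyperbola_le j hα hδ hαδ hy hy' hη ht htT hh hN
      (FeynmanKac.radius_le_of_hyperbola hη hα hαδ hR)
  · intro a t₀ t₁ ha0 ha ht₀ ht₁ hT
    exact ⟨exists_parabola_params ha0 ha ht₀ ht₁, fun κ l hκ hl hκl =>
      hG.parabola_spectral j ha0 ha ht₀ ht₁ hT hκ hl hκl⟩
  · intro α δ t₀ t₁ hα hδ hαδ ht₀ ht₁ hT
    exact ⟨exists_hyperbola_params hα hδ hαδ ht₀ ht₁, fun κ l hκ hl hsl =>
      hG.hyperbola_spectral j hα hδ hαδ ht₀ hT hκ hl hsl⟩
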